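/- Let $m\ge 5$ and $\ell\ge 1$ be integers, $B^m\subset\mathbb{R}^m$ the unit ball, $r=|x|$, $y=x/r$. Define $u^{(\ell)}:\mathbb{R}^m\setminus\{0\}\to\mathbb{R}^{m^\ell}$ recursively by $u^{(1)}_{i_1}=y_{i_1}$ and, for $\ell\ge2$, $$u^{(\ell)}_{i_1\dots i_\ell}=\sqrt{\tfrac{\ell+m-3}{2\ell+m-4}}\Big(y_{i_\ell}\,u^{(\ell-1)}_{i_1\dots i_{\ell-1}}-\tfrac{1}{\ell+m-3}\,r\,\partial_{x_{i_\ell}}u^{(\ell-1)}_{i_1\dots i_{\ell-1}}\Big),$$ let $\alpha\in(0,\frac{\pi}{2})$ satisfy $$\sin^2\alpha=\frac{\ell(\ell+m-2)+2m-8}{2\ell(\ell+m-2)},$$ and let $q=(\sin\alpha\cdot u^{(\ell)},\cos\alpha):B^m\to\mathbb{S}^{m^\ell}\subset\mathbb{R}^{m^\ell}\times\mathbb{R}$. For $u\in W^{2,2}(B^m,\mathbb{S}^n)=\{u\in W^{2,2}(B^m,\mathbb{R}^{n+1}) : u(x)\in\mathbb{S}^n\text{ a.e.}\}$ let $E_2(u)=\frac12\int_{B^m}(|\Delta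 u|^2-|du|^4)\,dx$. The map $u$ is called weakly biharmonic if $$\Delta^2u+2\operatorname{div}(|du|^2du)-\big(\langle\Delta^2u,u\rangle-2|du|^4\big)u=0$$ in the sense of distributions, and proper if moreover $\Delta u+|du|^2u$ does not vanish almost everywhere. A variation of $u$ is a family $u_t\in W^{2,2}(B^m,\mathbb{S}^n)$, $|t|<\varepsilon$, with $u_0=u$ and $u_t-u\in W^{2,2}_0(B^m,\mathbb{R}^{n+1})$, that is twice continuously differentiable in $t$ with respect to the norm of $W^{2,2}\cap W^{1,4}$. A weakly biharmonic map $u$ is called strictly stable if for every variation of $u$ with $\eta=\frac{d}{dt}\big|_{t=0}u_t\neq0$ the function $t\mapsto E_2(u_t)$ is twice continuously differentiable near $0$ and $$\frac{d^2}{dt^2}\Big|_{t=0}E_2(u_t)>0.$$ If $$m^2-12\big(\ell(\ell+m-2)+2m-8\big)>0,$$ then $q$ is a proper weakly biharmonic map and is strictly stable. -/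

import Mathlib

open MeasureTheory Filter Topology
open scoped ENNReal ContDiff

namespace BiharmonicBall

instance factOneLeFour : Fact ((1 : ℝ≥0∞) ≤ 4) := ⟨by norm_num⟩

/-- Lebesgue measure on the unit ball `B^m`. Maps on `B^m` are functions on the whole space of
which only the values almost everywhere on the ball matter. -/
noncomputable def ballVol (m : ℕ) : Measure (EuclideanSpace ℝ (Fin m)) :=
  volume.restrict (Metric.ball 0 1)

/-- The `i`-th standard basis vector. -/
noncomputable def stdVec {m : ℕ} (i : Fin m) : EuclideanSpace ℝ (Fin m) :=
  EuclideanSpace.single i 1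

section Sobolev

variable {m : ℕ} {F : Type*} [NormedAddCommGroup F] [InnerProductSpace ℝ F]

/-- Smooth maps with compact support in the open unit ball. -/
def IsTest (φ : EuclideanSpace ℝ (Fin m) → F) : Prop :=
  ContDiff ℝ ∞ φ ∧ HasCompactSupport φ ∧ tsupport φ ⊆ Metric.ball 0 1

/-- `g` is the `i`-th weak partial derivative of `f` on the unit ball. -/
def IsWeakPartial (i : Fin m) (f g : EuclideanSpace ℝ (Fin m) → F) : Prop :=
  LocallyIntegrableOn f (Metric.ball 0 1) ∧ LocallyIntegrableOn g (Metric.ball 0 1) ∧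
    ∀ φ : EuclideanSpace ℝ (Fin m) → ℝ, IsTest φ →
      ∫ x, (fderiv ℝ φ x (stdVec i)) • f x ∂(ballVol m) = -∫ x, φ x • g x ∂(ballVol m)

open Classical in
/-- A representative of the `i`-th weak partial derivative on the unit ball (unique up to null
sets), and `0` if there is none. -/
noncomputable def wPartial (i : Fin m) (f : EuclideanSpace ℝ (Fin m) → F) :
    EuclideanSpace ℝ (Fin m) → F :=
  if h : ∃ g, IsWeakPartial i f g then h.choose else 0

/-- The Sobolev space `W^{2,2}(B^m, F)`. -/
def MemW22 (f : EuclideanSpace ℝ (Fin m) → F) : Prop :=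
  MemLp f 2 (ballVol m) ∧
    ∀ i, (∃ g, IsWeakPartial i f g) ∧ MemLp (wPartial i f) 2 (ballVol m) ∧
      ∀ j, (∃ g, IsWeakPartial j (wPartial i f) g) ∧
        MemLp (wPartial j (wPartial i f)) 2 (ballVol m)

/-- The norm of `W^{2,2}(B^m, F)`. -/
noncomputable def w22Norm (f : EuclideanSpace ℝ (Fin m) → F) : ℝ≥0∞ :=
  eLpNorm f 2 (ballVol m) + ∑ i, eLpNorm (wPartial i f) 2 (ballVol m) +
    ∑ i, ∑ j, eLpNorm (wPartial j (wPartial i f)) 2 (ballVol m)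

/-- The space `W^{2,2}_0(B^m, F)`: the closure of the test maps in `W^{2,2}`. -/
def MemW22Zero (f : EuclideanSpace ℝ (Fin m) → F) : Prop :=
  MemW22 f ∧ ∀ ε : ℝ≥0∞, 0 < ε → ∃ φ, IsTest φ ∧ w22Norm (f - φ) < ε

/-- The (weak) Laplacian, with the analysts' sign. -/
noncomputable def wLaplacian (f : EuclideanSpace ℝ (Fin m) → F) :
    EuclideanSpace ℝ (Fin m) → F :=
  fun x => ∑ i, wPartial i (wPartial i f) x

/-- `|du|²`, the square of the Hilbert-Schmidt norm of the (weak) differential. -/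
noncomputable def gradSq (u : EuclideanSpace ℝ (Fin m) → F) (x : EuclideanSpace ℝ (Fin m)) : ℝ :=
  ∑ i, ‖wPartial i u x‖ ^ 2

/-- The class `W^{2,2}(B^m, S)`, where `S` is the unit sphere of `F`. -/
def MemW22Sphere (u : EuclideanSpace ℝ (Fin m) → F) : Prop :=
  MemW22 u ∧ ∀ᵐ x ∂(ballVol m), u x ∈ Metric.sphere (0 : F) 1

/-- The tension field `τ(u) = Δu + |du|² u` of a map to the unit sphere of `F`. -/
noncomputable def tension (u : EuclideanSpace ℝ (Fin m) → F) (x : EuclideanSpace ℝ (Fin m)) : F :=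
  wLaplacian u x + gradSq u x • u x

/-- The bienergy `½ ∫ (|Δu|² - |du|⁴)` of a map to the unit sphere of `F`. -/
noncomputable def bienergy (u : EuclideanSpace ℝ (Fin m) → F) : ℝ :=
  (1 / 2) * ∫ x, (‖wLaplacian u x‖ ^ 2 - gradSq u x ^ 2) ∂(ballVol m)

/-- A weak biharmonic map: a map `u ∈ W^{2,2}(B^m, S)` that solves
`Δ²u + 2 div(|du|² du) - (⟨Δ²u, u⟩ - 2|du|⁴) u = 0` in the sense of distributions.
For a test map `φ`, the distribution `⟨Δ²u, u⟩ u` is evaluated at `φ` by moving one Laplacian to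
the other side: `⟨Δ²u, u⟩ ⟨u, φ⟩ = ⟨Δ²u, ⟨u, φ⟩ u⟩` becomes `⟨Δu, Δ(⟨u, φ⟩ u)⟩`. -/
def IsWeakBiharmonic (u : EuclideanSpace ℝ (Fin m) → F) : Prop :=
  MemW22Sphere u ∧
    ∀ φ : EuclideanSpace ℝ (Fin m) → F, IsTest φ →
      ∫ x, (inner ℝ (wLaplacian u x) (Laplacian.laplacian φ x)
        - 2 * gradSq u x * ∑ i, inner ℝ (wPartial i u x) (fderiv ℝ φ x (stdVec i))
        - inner ℝ (wLaplacian u x) (wLaplacian (fun y => (inner ℝ (u y) (φ y) : ℝ) • u y) x)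
        + 2 * gradSq u x ^ 2 * inner ℝ (u x) (φ x)) ∂(ballVol m) = 0

/-- A proper weak biharmonic map: one that is not harmonic, i.e. whose tension field does not
vanish. -/
def IsProperWeakBiharmonic (u : EuclideanSpace ℝ (Fin m) → F) : Prop :=
  IsWeakBiharmonic u ∧ ¬ (∀ᵐ x ∂(ballVol m), tension u x = 0)

/-- A variation `(v t)` of `u`: for `t` close to `0`, `v t` is a map in `W^{2,2}(B^m, S)` with
`v t - u ∈ W^{2,2}_0(B^m, F)`; moreover `v 0 = u`, and `t ↦ v t` is twice continuously
differentiable near `t = 0` with respect to the norm of `W^{2,2} ∩ W^{1,4}`, the space on which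
the bienergy is defined: the map and its weak second partial derivatives are `C²` curves in `L²`,
and its weak first partial derivatives are `C²` curves in `L⁴`. -/
structure IsVariation (u : EuclideanSpace ℝ (Fin m) → F) (v : ℝ → Lp F 2 (ballVol m)) :
    Prop where
  start : v 0 =ᵐ[ballVol m] u
  sphere : ∀ᶠ t in 𝓝 (0 : ℝ), MemW22Sphere (v t)
  boundary : ∀ᶠ t in 𝓝 (0 : ℝ), MemW22Zero (fun x => v t x - u x)
  contDiff_zero : ContDiffAt ℝ 2 v 0
  contDiff_one : ∀ i, ∃ g : ℝ → Lp F 4 (ballVol m), ContDiffAt ℝ 2 g 0 ∧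
    ∀ᶠ t in 𝓝 (0 : ℝ), g t =ᵐ[ballVol m] wPartial i (v t)
  contDiff_two : ∀ i j, ∃ g : ℝ → Lp F 2 (ballVol m), ContDiffAt ℝ 2 g 0 ∧
    ∀ᶠ t in 𝓝 (0 : ℝ), g t =ᵐ[ballVol m] wPartial j (wPartial i (v t))

/-- Strict stability of a biharmonic map: for every variation with non-zero variational vector
field `η = d/dt v t |_{t = 0}`, the second derivative of the bienergy at `t = 0` exists and is
positive. -/
def IsStrictlyStable (u : EuclideanSpace ℝ (Fin m) → F) : Prop :=
  IsWeakBiharmonic u ∧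
    ∀ v : ℝ → Lp F 2 (ballVol m), IsVariation u v → deriv v 0 ≠ 0 →
      ContDiffAt ℝ 2 (fun t => bienergy (v t)) 0 ∧
        0 < iteratedDeriv 2 (fun t => bienergy (v t)) 0

end Sobolev

/-- The components of the generalized radial projection `u^{(ℓ)} : ℝ^m ∖ {0} → S^{m^ℓ - 1}`:
`u^{(1)}_i = y_i` with `y = x / r`, and
`u^{(ℓ)}_{i_1 … i_ℓ} = C_{ℓ,m} (y_{i_ℓ} u^{(ℓ-1)}_{i_1 … i_{ℓ-1}}
  - (ℓ + m - 3)⁻¹ r ∂_{i_ℓ} u^{(ℓ-1)}_{i_1 … i_{ℓ-1}})`,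
with `C_{ℓ,m} = √((ℓ + m - 3) / (2ℓ + m - 4))`. The value for `ℓ = 0` is a convention that is
not used. -/
noncomputable def radialProj (m : ℕ) :
    (l : ℕ) → (Fin l → Fin m) → EuclideanSpace ℝ (Fin m) → ℝ
  | 0, _, _ => 1
  | 1, i, x => x (i 0) / ‖x‖
  | (n + 2), i, x =>
      let l : ℝ := (n : ℝ) + 2
      √((l + m - 3) / (2 * l + m - 4)) *
        (x (i (Fin.last (n + 1))) / ‖x‖ * radialProj m (n + 1) (Fin.init i) x
          - 1 / (l + m - 3) * ‖x‖ *
            fderiv ℝ (radialProj m (n + 1) (Fin.init i)) x (stdVec (i (Fin.last (n + 1)))))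

/-- The Euclidean space `ℝ^{m^ℓ} × ℝ`, of dimension `m^ℓ + 1`, whose unit sphere is
`S^{m^ℓ}`. -/
abbrev Target (m l : ℕ) : Type := EuclideanSpace ℝ ((Fin l → Fin m) ⊕ Unit)

/-- The map `q = (sin α · u^{(ℓ)}, cos α)`. -/
noncomputable def qMap (m l : ℕ) (α : ℝ) (x : EuclideanSpace ℝ (Fin m)) : Target m l :=
  WithLp.toLp 2 (Sum.elim (fun i => Real.sin α * radialProj m l i x) (fun _ => Real.cos α))

end BiharmonicBall

/-!
Away from the origin the map `q = h + e`, with `h = (sin α · u^{(ℓ)}, 0)` and `e = (0, cos α)`, is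
smooth and homogeneous of degree zero, and `h` is an eigenmap: `Δh = -λ r⁻² h` with
`λ = ℓ (ℓ + m - 2)`, `|h|² = s = sin² α`, and hence `|dh|² = λ s r⁻²`. The eigenmap property of
`u^{(ℓ)}` (`eigenMap_radialVec`) follows by induction on `ℓ`, since the recursion is the operator
that raises the degree of spherical harmonics (`lap_degree_raising`). Everything else only uses the
data collected in `BiharmonicCone`.

**Biharmonicity.** Homogeneous maps of degree `> 1 - m` may be integrated by parts against test maps
without a contribution of the origin (`integral_bilin_pd`); in particular their weak derivatives are
the classical ones. The equation for `q` then becomes an algebraic identity, which holds because of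
`2 λ s = λ + 2 m - 8`: the linear part `Δ² q + 2 div (|dq|² dq)` and the normal part
`⟨Δ² q, q⟩ - 2 |dq|⁴` vanish separately (`BiharmonicCone.integral_linear`,
`BiharmonicCone.integral_normal`). The tension field has the component `λ s (1 - s) r⁻² ≠ 0` in the
direction of `e`, so `q` is proper.

**Stability.** Along a variation with first derivative `η`, the terms of the second derivative of
the bienergy that contain the second derivative of the variation vanish by the linear part of the
equation, and what is left is
`∫ (|Δη|² - 4 ⟨dη, dq⟩² - 2 |dq|² |dη|²) ≥ ∫ |Δη|² - 6 λ s ∫ r⁻² |dη|²`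
(`BiharmonicCone.second_variation_lower_bound`). For `m ≥ 8` the inequality of Rellich type
`∫ |Δη|² ≥ m² / 4 ∫ r⁻² |dη|²` holds (`rellich_test`), and the right-hand side controls
`∫ |η|²` by Hardy's inequality; the stability condition says that `6 λ s < m² / 4` and forces
`m ≥ 8`. Both the equation and the inequality are closed conditions on the triple `(η, dη, Δη)`, so
that they pass from test maps to the closure `W^{2,2}_0` (`mem_closure_testJets`,
`coercive_closure`), in which the derivatives of a variation lie.
-/

namespace BiharmonicBall

/-! ### Partial derivatives and the Laplacian away from the origin -/

section Calculus

variable {m : ℕ} {F G H : Type*} [NormedAddCommGroup F] [NormedSpace ℝ F]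
  [NormedAddCommGroup G] [NormedSpace ℝ G] [NormedAddCommGroup H] [NormedSpace ℝ H]

/-- The classical `i`-th partial derivative. -/
noncomputable def pd (i : Fin m) (f : EuclideanSpace ℝ (Fin m) → F)
    (x : EuclideanSpace ℝ (Fin m)) : F :=
  fderiv ℝ f x (stdVec i)

/-- The classical Laplacian, as the sum of the pure second partial derivatives. -/
noncomputable def lap (f : EuclideanSpace ℝ (Fin m) → F) (x : EuclideanSpace ℝ (Fin m)) : F :=
  ∑ i, pd i (pd i f) x

/-- Smoothness away from the origin. -/
def SmoothOff (f : EuclideanSpace ℝ (Fin m) → F) : Prop :=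
  ContDiffOn ℝ ∞ f {0}ᶜ

theorem SmoothOff.contDiffAt {f : EuclideanSpace ℝ (Fin m) → F} (hf : SmoothOff f)
    {x : EuclideanSpace ℝ (Fin m)} (hx : x ≠ 0) : ContDiffAt ℝ ∞ f x :=
  (ContDiffOn.contDiffAt hf) (isOpen_compl_singleton.mem_nhds hx)

theorem SmoothOff.differentiableAt {f : EuclideanSpace ℝ (Fin m) → F} (hf : SmoothOff f)
    {x : EuclideanSpace ℝ (Fin m)} (hx : x ≠ 0) : DifferentiableAt ℝ f x :=
  (hf.contDiffAt hx).differentiableAt (by simp)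

theorem SmoothOff.of_contDiff {f : EuclideanSpace ℝ (Fin m) → F} (hf : ContDiff ℝ ∞ f) :
    SmoothOff f := hf.contDiffOn

theorem SmoothOff.pd {f : EuclideanSpace ℝ (Fin m) → F} (hf : SmoothOff f) (i : Fin m) :
    SmoothOff (pd i f) :=
  (ContDiffOn.fderiv_of_isOpen hf isOpen_compl_singleton (m := ∞) (by simp)).clm_apply
    contDiffOn_const

theorem contDiff_pd {f : EuclideanSpace ℝ (Fin m) → F} (hf : ContDiff ℝ ∞ f) (i : Fin m) :
    ContDiff ℝ ∞ (pd i f) :=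
  (hf.fderiv_right (m := ∞) (by simp)).clm_apply contDiff_const

theorem contDiff_lap {f : EuclideanSpace ℝ (Fin m) → F} (hf : ContDiff ℝ ∞ f) :
    ContDiff ℝ ∞ (lap f) :=
  ContDiff.sum fun i _ => contDiff_pd (contDiff_pd hf i) i

theorem SmoothOff.congr {f g : EuclideanSpace ℝ (Fin m) → F} (hf : SmoothOff f)
    (h : ∀ x, x ≠ 0 → g x = f x) : SmoothOff g :=
  ContDiffOn.congr hf h

theorem SmoothOff.bilin {f : EuclideanSpace ℝ (Fin m) → F} {g : EuclideanSpace ℝ (Fin m) → G}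
    (B : F →L[ℝ] G →L[ℝ] H) (hf : SmoothOff f) (hg : SmoothOff g) :
    SmoothOff (fun x => B (f x) (g x)) :=
  (B.contDiff.comp_contDiffOn hf).clm_apply hg

theorem SmoothOff.mul {f g : EuclideanSpace ℝ (Fin m) → ℝ}
    (hf : SmoothOff f) (hg : SmoothOff g) : SmoothOff (fun x => f x * g x) :=
  ContDiffOn.mul hf hg

theorem SmoothOff.add {f g : EuclideanSpace ℝ (Fin m) → F}
    (hf : SmoothOff f) (hg : SmoothOff g) : SmoothOff (fun x => f x + g x) :=
  ContDiffOn.add hf hg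

theorem SmoothOff.const_smul {f : EuclideanSpace ℝ (Fin m) → F} (c : ℝ)
    (hf : SmoothOff f) : SmoothOff (fun x => c • f x) :=
  ContDiffOn.const_smul c hf

theorem pd_congr_off {f g : EuclideanSpace ℝ (Fin m) → F} (h : ∀ x, x ≠ 0 → f x = g x)
    (i : Fin m) {x : EuclideanSpace ℝ (Fin m)} (hx : x ≠ 0) : pd i f x = pd i g x := by
  have : f =ᶠ[𝓝 x] g := by
    filter_upwards [isOpen_compl_singleton.mem_nhds hx] with y hy using h y hy
  simp only [pd, this.fderiv_eq]

theorem lap_congr_off {f g : EuclideanSpace ℝ (Fin m) → F} (h : ∀ x, x ≠ 0 → f x = g x)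
    {x : EuclideanSpace ℝ (Fin m)} (hx : x ≠ 0) : lap f x = lap g x :=
  Finset.sum_congr rfl fun i _ => pd_congr_off (fun _ hy => pd_congr_off h i hy) i hx

theorem pd_bilin {f : EuclideanSpace ℝ (Fin m) → F} {g : EuclideanSpace ℝ (Fin m) → G}
    (B : F →L[ℝ] G →L[ℝ] H) {x : EuclideanSpace ℝ (Fin m)} (hf : DifferentiableAt ℝ f x)
    (hg : DifferentiableAt ℝ g x) (i : Fin m) :
    pd i (fun x => B (f x) (g x)) x = B (pd i f x) (g x) + B (f x) (pd i g x) := by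
  have h := B.hasFDerivAt_of_bilinear hf.hasFDerivAt hg.hasFDerivAt
  simp only [pd, h.fderiv]
  simp [add_comm]

theorem pd_smul {f : EuclideanSpace ℝ (Fin m) → ℝ} {g : EuclideanSpace ℝ (Fin m) → G}
    {x : EuclideanSpace ℝ (Fin m)} (hf : DifferentiableAt ℝ f x)
    (hg : DifferentiableAt ℝ g x) (i : Fin m) :
    pd i (fun x => f x • g x) x = pd i f x • g x + f x • pd i g x :=
  pd_bilin (ContinuousLinearMap.lsmul ℝ ℝ) hf hg i

theorem pd_mul {f g : EuclideanSpace ℝ (Fin m) → ℝ}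
    {x : EuclideanSpace ℝ (Fin m)} (hf : DifferentiableAt ℝ f x)
    (hg : DifferentiableAt ℝ g x) (i : Fin m) :
    pd i (fun x => f x * g x) x = pd i f x * g x + f x * pd i g x :=
  pd_smul hf hg i

theorem pd_const_smul {f : EuclideanSpace ℝ (Fin m) → F} (c : ℝ)
    {x : EuclideanSpace ℝ (Fin m)} (hf : DifferentiableAt ℝ f x) (i : Fin m) :
    pd i (fun x => c • f x) x = c • pd i f x := by
  simp only [pd, fderiv_fun_const_smul hf]; rfl

theorem pd_const_mul {f : EuclideanSpace ℝ (Fin m) → ℝ} (c : ℝ)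
    {x : EuclideanSpace ℝ (Fin m)} (hf : DifferentiableAt ℝ f x) (i : Fin m) :
    pd i (fun x => c * f x) x = c * pd i f x :=
  pd_const_smul c hf i

theorem pd_add {f g : EuclideanSpace ℝ (Fin m) → F}
    {x : EuclideanSpace ℝ (Fin m)} (hf : DifferentiableAt ℝ f x) (hg : DifferentiableAt ℝ g x)
    (i : Fin m) : pd i (fun x => f x + g x) x = pd i f x + pd i g x := by
  simp only [pd, fderiv_fun_add hf hg]; rfl

theorem pd_sub {f g : EuclideanSpace ℝ (Fin m) → F}
    {x : EuclideanSpace ℝ (Fin m)} (hf : DifferentiableAt ℝ f x) (hg : DifferentiableAt ℝ g x)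
    (i : Fin m) : pd i (fun x => f x - g x) x = pd i f x - pd i g x := by
  simp only [pd, fderiv_fun_sub hf hg]; rfl

theorem pd_sum {ι : Type*} {s : Finset ι} {f : ι → EuclideanSpace ℝ (Fin m) → F}
    {x : EuclideanSpace ℝ (Fin m)} (hf : ∀ k ∈ s, DifferentiableAt ℝ (f k) x)
    (i : Fin m) : pd i (fun x => ∑ k ∈ s, f k x) x = ∑ k ∈ s, pd i (f k) x := by
  simp only [pd, fderiv_fun_sum hf, sum_apply]

theorem pd_const (c : F) (i : Fin m) (x : EuclideanSpace ℝ (Fin m)) :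
    pd i (fun _ => c) x = 0 := by
  simp [pd]

theorem lap_const (c : F) (x : EuclideanSpace ℝ (Fin m)) : lap (fun _ => c) x = 0 :=
  Finset.sum_eq_zero fun i _ => by rw [funext fun y => pd_const c i y, pd_const]

theorem pd_pd_eq {f : EuclideanSpace ℝ (Fin m) → F} {x : EuclideanSpace ℝ (Fin m)}
    (hf : ContDiffAt ℝ ∞ f x) (i j : Fin m) :
    pd i (pd j f) x = fderiv ℝ (fderiv ℝ f) x (stdVec i) (stdVec j) := by
  have h2 : DifferentiableAt ℝ (fderiv ℝ f) x :=
    (hf.fderiv_right (m := 1) (by norm_cast)).differentiableAt (by simp)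
  have := (h2.hasFDerivAt.clm_apply (hasFDerivAt_const (stdVec j) x)).fderiv
  change fderiv ℝ (fun y => fderiv ℝ f y (stdVec j)) x (stdVec i) = _
  rw [this]; simp

theorem laplacian_eq_lap {f : EuclideanSpace ℝ (Fin m) → F} (hf : ContDiff ℝ ∞ f)
    (x : EuclideanSpace ℝ (Fin m)) : Laplacian.laplacian f x = lap f x := by
  rw [InnerProductSpace.laplacian_eq_iteratedFDeriv_orthonormalBasis f
    (EuclideanSpace.basisFun (Fin m) ℝ)]
  refine Finset.sum_congr rfl fun i _ => ?_
  rw [pd_pd_eq hf.contDiffAt, iteratedFDeriv_two_apply]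
  simp [stdVec]

theorem pd_comm {f : EuclideanSpace ℝ (Fin m) → F} (hf : SmoothOff f)
    {x : EuclideanSpace ℝ (Fin m)} (hx : x ≠ 0) (i j : Fin m) :
    pd i (pd j f) x = pd j (pd i f) x := by
  have hs := ((hf.contDiffAt hx).isSymmSndFDerivAt (by
    simp only [minSmoothness_of_isRCLikeNormedField]; norm_cast)).eq
  rw [pd_pd_eq (hf.contDiffAt hx), pd_pd_eq (hf.contDiffAt hx), hs]

theorem lap_bilin {f : EuclideanSpace ℝ (Fin m) → F} {g : EuclideanSpace ℝ (Fin m) → G}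
    (B : F →L[ℝ] G →L[ℝ] H) {x : EuclideanSpace ℝ (Fin m)} (hx : x ≠ 0) (hf : SmoothOff f)
    (hg : SmoothOff g) :
    lap (fun x => B (f x) (g x)) x
      = B (lap f x) (g x) + (2 : ℝ) • ∑ i, B (pd i f x) (pd i g x) + B (f x) (lap g x) := by
  simp only [lap, map_sum, sum_apply, Finset.smul_sum,
    ← Finset.sum_add_distrib]
  refine Finset.sum_congr rfl fun i _ => ?_
  rw [pd_congr_off (g := fun x => B (pd i f x) (g x) + B (f x) (pd i g x))
    (fun y hy => pd_bilin B (hf.differentiableAt hy) (hg.differentiableAt hy) i) i hx,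
    pd_add (((hf.pd i).bilin B hg).differentiableAt hx)
      ((hf.bilin B (hg.pd i)).differentiableAt hx),
    pd_bilin B ((hf.pd i).differentiableAt hx) (hg.differentiableAt hx),
    pd_bilin B (hf.differentiableAt hx) ((hg.pd i).differentiableAt hx), two_smul]
  abel

theorem lap_smul {f : EuclideanSpace ℝ (Fin m) → ℝ} {g : EuclideanSpace ℝ (Fin m) → G}
    {x : EuclideanSpace ℝ (Fin m)} (hx : x ≠ 0) (hf : SmoothOff f) (hg : SmoothOff g) :
    lap (fun x => f x • g x) x
      = lap f x • g x + (2 : ℝ) • ∑ i, pd i f x • pd i g x + f x • lap g x :=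
  lap_bilin (ContinuousLinearMap.lsmul ℝ ℝ) hx hf hg

theorem lap_const_smul {f : EuclideanSpace ℝ (Fin m) → F} (c : ℝ)
    {x : EuclideanSpace ℝ (Fin m)} (hx : x ≠ 0) (hf : SmoothOff f) :
    lap (fun x => c • f x) x = c • lap f x := by
  simp only [lap, Finset.smul_sum]
  refine Finset.sum_congr rfl fun i _ => ?_
  rw [pd_congr_off (g := fun x => c • pd i f x)
    (fun y hy => pd_const_smul c (hf.differentiableAt hy) i) i hx,
    pd_const_smul c ((hf.pd i).differentiableAt hx)]

theorem lap_sub {f g : EuclideanSpace ℝ (Fin m) → F}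
    {x : EuclideanSpace ℝ (Fin m)} (hx : x ≠ 0) (hf : SmoothOff f) (hg : SmoothOff g) :
    lap (fun x => f x - g x) x = lap f x - lap g x := by
  simp only [lap, ← Finset.sum_sub_distrib]
  refine Finset.sum_congr rfl fun i _ => ?_
  rw [pd_congr_off (g := fun x => pd i f x - pd i g x)
    (fun y hy => pd_sub (hf.differentiableAt hy) (hg.differentiableAt hy) i) i hx,
    pd_sub ((hf.pd i).differentiableAt hx) ((hg.pd i).differentiableAt hx)]

theorem pd_lap {f : EuclideanSpace ℝ (Fin m) → F} (hf : SmoothOff f)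
    {x : EuclideanSpace ℝ (Fin m)} (hx : x ≠ 0) (j : Fin m) :
    lap (pd j f) x = pd j (lap f) x := by
  have : pd j (lap f) x = ∑ i, pd j (pd i (pd i f)) x :=
    pd_sum (fun i _ => ((hf.pd i).pd i).differentiableAt hx) j
  rw [this]
  refine Finset.sum_congr rfl fun i _ => ?_
  rw [pd_congr_off (fun y hy => pd_comm hf hy i j) i hx, pd_comm (hf.pd i) hx]

theorem sum_smul_stdVec (x : EuclideanSpace ℝ (Fin m)) : ∑ i, x i • stdVec i = x := by
  have := (EuclideanSpace.basisFun (Fin m) ℝ).sum_repr x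
  simpa [stdVec] using this

theorem fderiv_self_eq_sum (f : EuclideanSpace ℝ (Fin m) → F) (x : EuclideanSpace ℝ (Fin m)) :
    fderiv ℝ f x x = ∑ i, x i • pd i f x := by
  conv_lhs => arg 2; rw [← sum_smul_stdVec x]
  simp only [map_sum, map_smul, pd]

theorem norm_sq_eq_sum (x : EuclideanSpace ℝ (Fin m)) : ‖x‖ ^ 2 = ∑ i, x i ^ 2 := by
  simp [EuclideanSpace.norm_sq_eq]

/-! ### Positively homogeneous maps -/

/-- Maps that are smooth away from the origin and positively homogeneous of degree `d` there. The
value at the origin is arbitrary. -/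
structure HomSmooth (d : ℤ) (f : EuclideanSpace ℝ (Fin m) → F) : Prop where
  smooth : SmoothOff f
  hom : ∀ t : ℝ, 0 < t → ∀ x, x ≠ 0 → f (t • x) = t ^ d • f x

theorem HomSmooth.congr {d : ℤ} {f g : EuclideanSpace ℝ (Fin m) → F} (hf : HomSmooth d f)
    (h : ∀ x, x ≠ 0 → g x = f x) : HomSmooth d g :=
  ⟨hf.smooth.congr h, fun t ht x hx => by
    rw [h _ (smul_ne_zero ht.ne' hx), h x hx, hf.hom t ht x hx]⟩

theorem HomSmooth.bilin {d e : ℤ} {f : EuclideanSpace ℝ (Fin m) → F}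
    {g : EuclideanSpace ℝ (Fin m) → G} (B : F →L[ℝ] G →L[ℝ] H) (hf : HomSmooth d f)
    (hg : HomSmooth e g) : HomSmooth (d + e) (fun x => B (f x) (g x)) :=
  ⟨hf.smooth.bilin B hg.smooth, fun t ht x hx => by
    simp only [hf.hom t ht x hx, hg.hom t ht x hx, map_smul, smul_apply, smul_smul,
      zpow_add₀ ht.ne', mul_comm (t ^ d)]⟩

theorem HomSmooth.clm {d : ℤ} {f : EuclideanSpace ℝ (Fin m) → F} (hf : HomSmooth d f)
    (L : F →L[ℝ] G) : HomSmooth d (fun x => L (f x)) :=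
  ⟨L.contDiff.comp_contDiffOn hf.smooth, fun t ht x hx => by rw [hf.hom t ht x hx, map_smul]⟩

theorem HomSmooth.smul {d e : ℤ} {f : EuclideanSpace ℝ (Fin m) → ℝ}
    {g : EuclideanSpace ℝ (Fin m) → G} (hf : HomSmooth d f)
    (hg : HomSmooth e g) : HomSmooth (d + e) (fun x => f x • g x) :=
  hf.bilin (ContinuousLinearMap.lsmul ℝ ℝ) hg

theorem HomSmooth.mul {d e : ℤ} {f g : EuclideanSpace ℝ (Fin m) → ℝ} (hf : HomSmooth d f)
    (hg : HomSmooth e g) : HomSmooth (d + e) (fun x => f x * g x) :=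
  hf.smul hg

theorem HomSmooth.add {d : ℤ} {f g : EuclideanSpace ℝ (Fin m) → F}
    (hf : HomSmooth d f) (hg : HomSmooth d g) : HomSmooth d (fun x => f x + g x) :=
  ⟨hf.smooth.add hg.smooth, fun t ht x hx => by simp [hf.hom t ht x hx, hg.hom t ht x hx]⟩

theorem HomSmooth.const_smul {d : ℤ} {f : EuclideanSpace ℝ (Fin m) → F} (c : ℝ)
    (hf : HomSmooth d f) : HomSmooth d (fun x => c • f x) :=
  ⟨hf.smooth.const_smul c, fun t ht x hx => by
    rw [hf.hom t ht x hx, smul_comm]⟩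

theorem HomSmooth.sub {d : ℤ} {f g : EuclideanSpace ℝ (Fin m) → F}
    (hf : HomSmooth d f) (hg : HomSmooth d g) : HomSmooth d (fun x => f x - g x) := by
  simpa [sub_eq_add_neg] using hf.add (hg.const_smul (-1))

theorem HomSmooth.const (c : F) : HomSmooth (m := m) 0 (fun _ => c) :=
  ⟨contDiffOn_const, fun t ht x hx => by simp⟩

theorem HomSmooth.pd {d : ℤ} {f : EuclideanSpace ℝ (Fin m) → F} (hf : HomSmooth d f)
    (i : Fin m) : HomSmooth (d - 1) (pd i f) := by
  refine ⟨hf.smooth.pd i, fun t ht x hx => ?_⟩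
  have htx : t • x ≠ 0 := smul_ne_zero ht.ne' hx
  have h1 : HasFDerivAt (fun y => f (t • y)) (t • fderiv ℝ f (t • x)) x := by
    have := (hf.smooth.differentiableAt htx).hasFDerivAt.comp x
      ((hasFDerivAt_id x).const_smul t)
    convert! this using 1
    ext v; simp
  have h2 : HasFDerivAt (fun y => f (t • y)) (t ^ d • fderiv ℝ f x) x := by
    refine ((hf.smooth.differentiableAt hx).hasFDerivAt.const_smul (t ^ d)).congr_of_eventuallyEq ?_
    filter_upwards [isOpen_compl_singleton.mem_nhds hx] with y hy using hf.hom t ht y hy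
  have h3 := congrArg (fun A : EuclideanSpace ℝ (Fin m) →L[ℝ] F => t⁻¹ • A (stdVec i))
    (h1.unique h2)
  simp only [smul_apply, smul_smul, inv_mul_cancel₀ ht.ne', one_smul] at h3
  simp only [BiharmonicBall.pd, h3]
  rw [zpow_sub₀ ht.ne', zpow_one, div_eq_inv_mul]

/-- Euler's identity for homogeneous maps. -/
theorem HomSmooth.euler {d : ℤ} {f : EuclideanSpace ℝ (Fin m) → F} (hf : HomSmooth d f)
    {x : EuclideanSpace ℝ (Fin m)} (hx : x ≠ 0) :
    ∑ i, x i • BiharmonicBall.pd i f x = (d : ℝ) • f x := by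
  rw [← fderiv_self_eq_sum]
  have h1 : HasDerivAt (fun t : ℝ => f (t • x)) (fderiv ℝ f x x) 1 := by
    have h0 : HasFDerivAt f (fderiv ℝ f x) ((1 : ℝ) • x) := by
      simpa using (hf.smooth.differentiableAt hx).hasFDerivAt
    have := h0.comp_hasDerivAt (1 : ℝ) ((hasDerivAt_id (1 : ℝ)).smul_const x)
    simpa [Function.comp_def] using this
  have h2 : HasDerivAt (fun t : ℝ => f (t • x)) ((d : ℝ) • f x) 1 := by
    have := (hasDerivAt_zpow d (1 : ℝ) (by simp)).smul_const (f x)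
    simp only [one_zpow, mul_one] at this
    refine this.congr_of_eventuallyEq ?_
    filter_upwards [Ioi_mem_nhds (zero_lt_one' ℝ)] with t ht using hf.hom t ht x hx
  exact h1.unique h2

theorem HomSmooth.exists_bound {d : ℤ} {f : EuclideanSpace ℝ (Fin m) → F} (hf : HomSmooth d f) :
    ∃ C, 0 ≤ C ∧ ∀ x, x ≠ 0 → ‖f x‖ ≤ C * ‖x‖ ^ d := by
  have hc : ContinuousOn f (Metric.sphere 0 1) :=
    hf.smooth.continuousOn.mono fun x hx => by
      rintro rfl; simp at hx
  obtain ⟨C, hC⟩ := (isCompact_sphere _ _).exists_bound_of_continuousOn hc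
  refine ⟨max C 0, le_max_right _ _, fun x hx => ?_⟩
  have hr : 0 < ‖x‖ := norm_pos_iff.2 hx
  have hy : ‖x‖⁻¹ • x ≠ 0 := smul_ne_zero (inv_ne_zero hr.ne') hx
  have h1 := hf.hom ‖x‖ hr _ hy
  rw [smul_smul, mul_inv_cancel₀ hr.ne', one_smul] at h1
  rw [h1, norm_smul, norm_zpow, norm_norm, mul_comm]
  gcongr
  refine (hC _ ?_).trans (le_max_left _ _)
  simp [norm_smul, hr.ne']

theorem HomSmooth.coord (j : Fin m) : HomSmooth (m := m) 1 (fun x => x j) :=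
  ⟨(EuclideanSpace.proj (𝕜 := ℝ) j).contDiff.contDiffOn, fun t ht x hx => by simp⟩

theorem pd_coord (i j : Fin m) (x : EuclideanSpace ℝ (Fin m)) :
    pd i (fun x => x j) x = if i = j then 1 else 0 := by
  have : pd i (fun x : EuclideanSpace ℝ (Fin m) => x j) x =
      EuclideanSpace.proj (𝕜 := ℝ) j (stdVec i) := by
    have := (EuclideanSpace.proj (𝕜 := ℝ) j : EuclideanSpace ℝ (Fin m) →L[ℝ] ℝ).fderiv (x := x)
    simp only [pd]
    exact congrArg (fun A => A (stdVec i)) this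
  rw [this]
  simp [stdVec, eq_comm]

theorem lap_coord (j : Fin m) (x : EuclideanSpace ℝ (Fin m)) :
    lap (fun x => x j) x = 0 := by
  refine Finset.sum_eq_zero fun i _ => ?_
  have : pd i (fun x : EuclideanSpace ℝ (Fin m) => x j) = fun _ => if i = j then 1 else 0 :=
    funext fun y => pd_coord i j y
  rw [this, pd_const]

theorem HomSmooth.norm_zpow (d : ℤ) : HomSmooth (m := m) d (fun x => ‖x‖ ^ d) := by
  refine ⟨fun x hx => ?_, fun t ht x hx => ?_⟩
  · have hr : ‖x‖ ≠ 0 := norm_ne_zero_iff.2 hx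
    have h1 : ContDiffAt ℝ ∞ (fun x : EuclideanSpace ℝ (Fin m) => ‖x‖) x := contDiffAt_norm ℝ hx
    rcases d with k | k
    · simpa using (h1.pow k).contDiffWithinAt
    · simp only [zpow_negSucc]
      exact ((h1.pow (k + 1)).inv (pow_ne_zero _ hr)).contDiffWithinAt
  · simp [norm_smul, abs_of_pos ht, mul_zpow]

theorem pd_norm_zpow (d : ℤ) (i : Fin m) {x : EuclideanSpace ℝ (Fin m)} (hx : x ≠ 0) :
    pd i (fun x => ‖x‖ ^ d) x = d * ‖x‖ ^ (d - 2) * x i := by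
  have hr : ‖x‖ ≠ 0 := norm_ne_zero_iff.2 hx
  -- the chain rule for `r^d`, with the gradient of `r` read off from `r² = ⟨x, x⟩`
  have hd : DifferentiableAt ℝ (fun x : EuclideanSpace ℝ (Fin m) => ‖x‖) x :=
    (contDiffAt_norm (n := 1) ℝ hx).differentiableAt (by simp)
  have h1 : 2 * ‖x‖ * fderiv ℝ (fun x : EuclideanSpace ℝ (Fin m) => ‖x‖) x (stdVec i)
      = 2 * x i := by
    have e1 := (hd.hasFDerivAt.pow 2).fderiv
    have e2 := (hasStrictFDerivAt_norm_sq x).hasFDerivAt.fderiv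
    have e3 := congrArg (fun A : EuclideanSpace ℝ (Fin m) →L[ℝ] ℝ => A (stdVec i))
      (e1.symm.trans e2)
    simpa [stdVec, EuclideanSpace.inner_single_right] using e3
  have h2 : pd i (fun x => ‖x‖ ^ d) x
      = (d * ‖x‖ ^ (d - 1)) * fderiv ℝ (fun x : EuclideanSpace ℝ (Fin m) => ‖x‖) x (stdVec i) := by
    have := (hasDerivAt_zpow d ‖x‖ (Or.inl hr)).comp_hasFDerivAt x hd.hasFDerivAt
    simp only [pd]
    have h3 := this.fderiv
    simp only [Function.comp_def] at h3
    rw [h3]; simp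
  have h3 : fderiv ℝ (fun x : EuclideanSpace ℝ (Fin m) => ‖x‖) x (stdVec i) = x i / ‖x‖ := by
    field_simp; linarith
  rw [h2, h3, show d - 1 = d - 2 + 1 by ring, zpow_add_one₀ hr]
  field_simp

theorem lap_norm_zpow (d : ℤ) {x : EuclideanSpace ℝ (Fin m)} (hx : x ≠ 0) :
    lap (fun x => ‖x‖ ^ d) x = d * (d + m - 2) * ‖x‖ ^ (d - 2) := by
  have hr : ‖x‖ ≠ 0 := norm_ne_zero_iff.2 hx
  have h1 : ∀ i, pd i (pd i (fun x : EuclideanSpace ℝ (Fin m) => ‖x‖ ^ d)) x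
      = d * ((d - 2) * ‖x‖ ^ (d - 4) * x i ^ 2 + ‖x‖ ^ (d - 2)) := by
    intro i
    have hs1 := (HomSmooth.norm_zpow (m := m) (d - 2)).smooth
    have hs2 := (HomSmooth.coord i).smooth
    rw [pd_congr_off (g := fun x => d * (‖x‖ ^ (d - 2) * x i))
      (fun y hy => by rw [pd_norm_zpow d i hy]; ring) i hx,
      pd_const_mul _ ((hs1.mul hs2).differentiableAt hx),
      pd_mul (hs1.differentiableAt hx) (hs2.differentiableAt hx), pd_norm_zpow _ i hx,
      pd_coord, if_pos rfl, show d - 2 - 2 = d - 4 by ring]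
    push_cast; ring
  simp only [lap, h1]
  rw [← Finset.mul_sum, Finset.sum_add_distrib, ← Finset.mul_sum, ← norm_sq_eq_sum]
  have : ‖x‖ ^ (d - 2) = ‖x‖ ^ (d - 4) * ‖x‖ ^ 2 := by
    rw [← zpow_natCast, ← zpow_add₀ hr]; congr 1; push_cast; ring
  simp only [Finset.sum_const, Finset.card_univ, Fintype.card_fin, nsmul_eq_mul, this]
  ring

end Calculus

/-! ### Integrability of homogeneous maps on the ball -/

section Integration

variable {m : ℕ} {F G H : Type*} [NormedAddCommGroup F] [InnerProductSpace ℝ F]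
  [NormedAddCommGroup G] [InnerProductSpace ℝ G] [NormedAddCommGroup H] [NormedSpace ℝ H]
  {K : Type*} [NormedAddCommGroup K] [NormedSpace ℝ K]

instance : IsFiniteMeasure (ballVol m) := ⟨by
  rw [ballVol, Measure.restrict_apply_univ]; exact measure_ball_lt_top⟩

theorem ae_mem_ball : ∀ᵐ x ∂(ballVol m), ‖x‖ < 1 := by
  filter_upwards [ae_restrict_mem measurableSet_ball] with x hx
  simpa using hx

theorem ae_ne_zero [NeZero m] : ∀ᵐ x ∂(ballVol m), x ≠ 0 := by
  have : ∀ᵐ x : EuclideanSpace ℝ (Fin m), x ≠ 0 := by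
    simp [ae_iff]
  exact ae_restrict_of_ae this

theorem integrable_norm_zpow [NeZero m] {d : ℤ} (hd : -(m : ℤ) < d) :
    Integrable (fun x : EuclideanSpace ℝ (Fin m) => ‖x‖ ^ d) (ballVol m) := by
  have hm : 0 < m := NeZero.pos m
  obtain ⟨k, hk⟩ : ∃ k : ℕ, (k : ℤ) = (m - 1 : ℕ) + d := ⟨((m - 1 : ℕ) + d).toNat, by omega⟩
  refine (integrableOn_fun_norm_addHaar (E := EuclideanSpace ℝ (Fin m)) volume
    (f := fun y : ℝ => y ^ d) (r := 1)).2 ?_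
  have h1 : IntegrableOn (fun y : ℝ => y ^ k) (Set.Ioo 0 1) :=
    ((continuous_pow k).integrableOn_Icc (a := 0) (b := 1)).mono_set Set.Ioo_subset_Icc_self
  refine h1.congr_fun (fun y hy => ?_) measurableSet_Ioo
  have : y ≠ 0 := hy.1.ne'
  simp only [finrank_euclideanSpace, Fintype.card_fin, smul_eq_mul]
  rw [← zpow_natCast, ← zpow_natCast, hk, zpow_add₀ this]

theorem SmoothOff.aestronglyMeasurable [NeZero m] {f : EuclideanSpace ℝ (Fin m) → H}
    (hf : SmoothOff f) : AEStronglyMeasurable f (ballVol m) := by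
  have h1 : AEStronglyMeasurable f (volume.restrict {0}ᶜ) :=
    hf.continuousOn.aestronglyMeasurable (measurableSet_singleton 0).compl
  rw [restrict_compl_singleton] at h1
  exact h1.mono_measure Measure.restrict_le_self

theorem integrable_of_norm_le_zpow [NeZero m] {E : Type*} [NormedAddCommGroup E] {d : ℤ}
    (hd : -(m : ℤ) < d) (C : ℝ) {f : EuclideanSpace ℝ (Fin m) → E}
    (hf : AEStronglyMeasurable f (ballVol m))
    (hb : ∀ x, x ≠ 0 → ‖x‖ < 1 → ‖f x‖ ≤ C * ‖x‖ ^ d) : Integrable f (ballVol m) := by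
  refine ((integrable_norm_zpow hd).const_mul C).mono' hf ?_
  filter_upwards [ae_mem_ball, ae_ne_zero] with x h1 h2 using hb x h2 h1

theorem exists_bound_on_ball {E : Type*} [NormedAddCommGroup E]
    {g : EuclideanSpace ℝ (Fin m) → E} (hg : Continuous g) :
    ∃ C, 0 ≤ C ∧ ∀ x, ‖x‖ < 1 → ‖g x‖ ≤ C := by
  obtain ⟨C, hC⟩ :=
    (isCompact_closedBall (0 : EuclideanSpace ℝ (Fin m)) 1).exists_bound_of_continuousOn hg.continuousOn
  exact ⟨max C 0, le_max_right _ _, fun x hx =>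
    (hC x (by simpa using hx.le)).trans (le_max_left _ _)⟩

theorem HomSmooth.integrable_bilin [NeZero m] {d : ℤ} (hd : -(m : ℤ) < d)
    {f : EuclideanSpace ℝ (Fin m) → K} {g : EuclideanSpace ℝ (Fin m) → G}
    (B : K →L[ℝ] G →L[ℝ] H) (hf : HomSmooth d f) (hg : Continuous g) :
    Integrable (fun x => B (f x) (g x)) (ballVol m) := by
  obtain ⟨C, hC0, hC⟩ := hf.exists_bound
  obtain ⟨D, hD0, hD⟩ := exists_bound_on_ball hg
  refine integrable_of_norm_le_zpow hd (‖B‖ * C * D)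
    (B.aestronglyMeasurable_comp₂ hf.smooth.aestronglyMeasurable hg.aestronglyMeasurable) ?_
  intro x hx hx1
  have hz : 0 ≤ ‖x‖ ^ d := zpow_nonneg (norm_nonneg x) d
  calc ‖B (f x) (g x)‖ ≤ ‖B‖ * ‖f x‖ * ‖g x‖ := B.le_opNorm₂ _ _
    _ ≤ ‖B‖ * (C * ‖x‖ ^ d) * D := by
        gcongr
        · exact hC x hx
        · exact hD x hx1
    _ = ‖B‖ * C * D * ‖x‖ ^ d := by ring

theorem HomSmooth.memLp [NeZero m] {d : ℤ} {p : ℕ} (hp : p ≠ 0) (hd : -(m : ℤ) < d * p)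
    {f : EuclideanSpace ℝ (Fin m) → K} (hf : HomSmooth d f) : MemLp f p (ballVol m) := by
  rw [← integrable_norm_rpow_iff hf.smooth.aestronglyMeasurable (by simpa using hp) (by simp)]
  obtain ⟨C, hC0, hC⟩ := hf.exists_bound
  refine integrable_of_norm_le_zpow hd (C ^ p) ?_ ?_
  · exact (hf.smooth.aestronglyMeasurable.norm.aemeasurable.pow_const _).aestronglyMeasurable
  · intro x hx _
    simp only [ENNReal.toReal_natCast, Real.rpow_natCast, norm_pow, norm_norm]
    calc ‖f x‖ ^ p ≤ (C * ‖x‖ ^ d) ^ p := by gcongr; exact hC x hx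
      _ = _ := by rw [mul_pow, ← zpow_natCast (‖x‖ ^ d), ← zpow_mul]

/-! ### Integration by parts across an isolated singularity -/

/-- A smooth cutoff that vanishes for `a ‖x‖ ≤ 1` and equals one for `a ‖x‖ ≥ √2`. -/
noncomputable def cutoff (a : ℝ) (x : EuclideanSpace ℝ (Fin m)) : ℝ :=
  Real.smoothTransition (a ^ 2 * ‖x‖ ^ 2 - 1)

theorem contDiff_cutoff (a : ℝ) : ContDiff ℝ ∞ (cutoff (m := m) a) :=
  Real.smoothTransition.contDiff.comp
    ((contDiff_const.mul (contDiff_norm_sq ℝ)).sub contDiff_const)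

theorem deriv_smoothTransition_eq_zero {s : ℝ} (hs : s < 0 ∨ 1 < s) :
    deriv Real.smoothTransition s = 0 := by
  rcases hs with hs | hs
  · have : Real.smoothTransition =ᶠ[𝓝 s] fun _ => 0 := by
      filter_upwards [Iio_mem_nhds hs] with t ht
      exact Real.smoothTransition.zero_of_nonpos (le_of_lt ht)
    rw [this.deriv_eq, deriv_const]
  · have : Real.smoothTransition =ᶠ[𝓝 s] fun _ => 1 := by
      filter_upwards [Ioi_mem_nhds hs] with t ht
      exact Real.smoothTransition.one_of_one_le (le_of_lt ht)
    rw [this.deriv_eq, deriv_const]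

theorem exists_bound_deriv_smoothTransition :
    ∃ M, 0 ≤ M ∧ ∀ s, |deriv Real.smoothTransition s| ≤ M := by
  have hc : Continuous (deriv Real.smoothTransition) :=
    (Real.smoothTransition.contDiff (n := 1)).continuous_deriv (by simp)
  obtain ⟨M, hM⟩ := (isCompact_Icc (a := (0 : ℝ)) (b := 1)).exists_bound_of_continuousOn
    hc.continuousOn
  refine ⟨max M 0, le_max_right _ _, fun s => ?_⟩
  by_cases hs : s ∈ Set.Icc (0 : ℝ) 1
  · exact (hM s hs).trans (le_max_left _ _)
  · rw [deriv_smoothTransition_eq_zero (by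
      simp only [Set.mem_Icc, not_and_or, not_le] at hs; exact hs)]
    simp

theorem pd_cutoff (a : ℝ) (i : Fin m) (x : EuclideanSpace ℝ (Fin m)) :
    pd i (cutoff a) x = deriv Real.smoothTransition (a ^ 2 * ‖x‖ ^ 2 - 1) * (2 * a ^ 2 * x i) := by
  have h1 : HasDerivAt Real.smoothTransition
      (deriv Real.smoothTransition (a ^ 2 * ‖x‖ ^ 2 - 1)) (a ^ 2 * ‖x‖ ^ 2 - 1) :=
    ((Real.smoothTransition.contDiff (n := 1)).differentiable (by simp) _).hasDerivAt
  have h2 := ((hasStrictFDerivAt_norm_sq x).hasFDerivAt.const_mul (a ^ 2)).sub_const 1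
  have h3 := (h1.comp_hasFDerivAt x h2).fderiv
  change fderiv ℝ (Real.smoothTransition ∘ fun x => a ^ 2 * ‖x‖ ^ 2 - 1) x (stdVec i) = _
  rw [h3]
  simp [stdVec, EuclideanSpace.inner_single_right]
  ring_nf
  simp

theorem exists_bound_pd_cutoff : ∃ M, 0 ≤ M ∧ ∀ (a : ℝ) (i : Fin m) (x : EuclideanSpace ℝ (Fin m)),
    x ≠ 0 → |pd i (cutoff a) x| ≤ M * ‖x‖⁻¹ := by
  obtain ⟨M, hM0, hM⟩ := exists_bound_deriv_smoothTransition
  refine ⟨4 * M, by positivity, fun a i x hx => ?_⟩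
  have hr : 0 < ‖x‖ := norm_pos_iff.2 hx
  rw [pd_cutoff]
  by_cases hs : a ^ 2 * ‖x‖ ^ 2 - 1 < 0 ∨ 1 < a ^ 2 * ‖x‖ ^ 2 - 1
  · rw [deriv_smoothTransition_eq_zero hs]; simp; positivity
  · push Not at hs
    have hxi : |x i| ≤ ‖x‖ := by simpa using PiLp.norm_apply_le x i
    rw [abs_mul, abs_mul, abs_of_nonneg (by positivity : 0 ≤ 2 * a ^ 2)]
    calc |deriv Real.smoothTransition (a ^ 2 * ‖x‖ ^ 2 - 1)| * (2 * a ^ 2 * |x i|)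
        ≤ M * (2 * a ^ 2 * ‖x‖) := by gcongr; exact hM _
      _ = 2 * M * (a ^ 2 * ‖x‖ ^ 2) * ‖x‖⁻¹ := by field_simp
      _ ≤ 2 * M * 2 * ‖x‖⁻¹ := by gcongr; linarith
      _ = 4 * M * ‖x‖⁻¹ := by ring

theorem eventually_cutoff {x : EuclideanSpace ℝ (Fin m)} (hx : x ≠ 0) :
    ∀ᶠ n : ℕ in atTop, cutoff (n : ℝ) x = 1 ∧ ∀ i, pd i (cutoff (n : ℝ)) x = 0 := by
  have hr : 0 < ‖x‖ := norm_pos_iff.2 hx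
  have : Tendsto (fun n : ℕ => (n : ℝ) * ‖x‖) atTop atTop :=
    tendsto_natCast_atTop_atTop.atTop_mul_const hr
  filter_upwards [this.eventually_ge_atTop 2] with n hn
  have h1 : 1 < (n : ℝ) ^ 2 * ‖x‖ ^ 2 - 1 := by rw [← mul_pow]; nlinarith
  refine ⟨Real.smoothTransition.one_of_one_le h1.le, fun i => ?_⟩
  rw [pd_cutoff, deriv_smoothTransition_eq_zero (Or.inr h1), zero_mul]

theorem IsTest.pd {φ : EuclideanSpace ℝ (Fin m) → F} (hφ : IsTest φ) (i : Fin m) :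
    IsTest (pd i φ) := by
  have h : tsupport (BiharmonicBall.pd i φ) ⊆ tsupport φ :=
    tsupport_fderiv_apply_subset ℝ (stdVec i)
  exact ⟨contDiff_pd hφ.1 i, hφ.2.1.of_isClosed_subset (isClosed_tsupport _) h, h.trans hφ.2.2⟩

theorem IsTest.bilin_left {φ : EuclideanSpace ℝ (Fin m) → F} {g : EuclideanSpace ℝ (Fin m) → G}
    {H : Type*} [NormedAddCommGroup H] [InnerProductSpace ℝ H]
    (B : F →L[ℝ] G →L[ℝ] H) (hφ : IsTest φ) (hg : ContDiff ℝ ∞ g) :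
    IsTest (fun x => B (φ x) (g x)) := by
  have h : tsupport (fun x => B (φ x) (g x)) ⊆ tsupport φ :=
    closure_mono fun x hx h0 => hx (by simp [h0])
  exact ⟨(B.contDiff.comp hφ.1).clm_apply hg,
    hφ.2.1.of_isClosed_subset (isClosed_tsupport _) h, h.trans hφ.2.2⟩

theorem IsTest.smul_left {φ : EuclideanSpace ℝ (Fin m) → ℝ} {g : EuclideanSpace ℝ (Fin m) → G}
    (hφ : IsTest φ) (hg : ContDiff ℝ ∞ g) : IsTest (fun x => φ x • g x) :=
  hφ.bilin_left (ContinuousLinearMap.lsmul ℝ ℝ) hg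

theorem IsTest.eq_zero {φ : EuclideanSpace ℝ (Fin m) → F} (hφ : IsTest φ)
    {x : EuclideanSpace ℝ (Fin m)} (hx : x ∉ Metric.ball 0 1) : φ x = 0 :=
  image_eq_zero_of_notMem_tsupport fun h => hx (hφ.2.2 h)

theorem IsTest.contDiff {φ : EuclideanSpace ℝ (Fin m) → F} (hφ : IsTest φ) : ContDiff ℝ ∞ φ := hφ.1

theorem IsTest.continuous {φ : EuclideanSpace ℝ (Fin m) → F} (hφ : IsTest φ) : Continuous φ :=
  hφ.1.continuous

theorem IsTest.differentiableAt {φ : EuclideanSpace ℝ (Fin m) → F} (hφ : IsTest φ)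
    (x : EuclideanSpace ℝ (Fin m)) : DifferentiableAt ℝ φ x :=
  hφ.1.differentiable (by simp) x

theorem integral_ballVol_eq {f : EuclideanSpace ℝ (Fin m) → H}
    (h : ∀ x, x ∉ Metric.ball (0 : EuclideanSpace ℝ (Fin m)) 1 → f x = 0) :
    ∫ x, f x ∂(ballVol m) = ∫ x, f x :=
  setIntegral_eq_integral_of_forall_compl_eq_zero h

theorem integrable_volume_of_ballVol {E : Type*} [NormedAddCommGroup E]
    {f : EuclideanSpace ℝ (Fin m) → E}
    (hf : Integrable f (ballVol m))
    (h : ∀ x, x ∉ Metric.ball (0 : EuclideanSpace ℝ (Fin m)) 1 → f x = 0) : Integrable f := by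
  refine (integrableOn_iff_integrable_of_support_subset fun x hx => ?_).1 hf
  by_contra h'
  exact hx (h x h')

theorem zero_notMem_tsupport_cutoff_smul {a : ℝ} (φ : EuclideanSpace ℝ (Fin m) → G) :
    (0 : EuclideanSpace ℝ (Fin m)) ∉ tsupport (fun x => cutoff a x • φ x) := by
  rw [notMem_tsupport_iff_eventuallyEq]
  have h : ∀ᶠ x : EuclideanSpace ℝ (Fin m) in 𝓝 0, a ^ 2 * ‖x‖ ^ 2 - 1 < 0 := by
    have hc : Continuous fun x : EuclideanSpace ℝ (Fin m) => a ^ 2 * ‖x‖ ^ 2 - 1 := by fun_prop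
    exact hc.continuousAt.eventually (Iio_mem_nhds (by simp))
  filter_upwards [h] with x hx
  simp [cutoff, Real.smoothTransition.zero_of_nonpos hx.le]

/-- Integration by parts against a test map for a map that is smooth away from the origin and
homogeneous of degree larger than `1 - m`: the singularity at the origin does not contribute. -/
theorem integral_bilin_pd [NeZero m] {d : ℤ} (hd : 1 - (m : ℤ) < d)
    {f : EuclideanSpace ℝ (Fin m) → K} {φ : EuclideanSpace ℝ (Fin m) → G}
    (B : K →L[ℝ] G →L[ℝ] H) (hf : HomSmooth d f) (hφ : IsTest φ) (i : Fin m) :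
    ∫ x, B (pd i f x) (φ x) ∂(ballVol m) = -∫ x, B (f x) (pd i φ x) ∂(ballVol m) := by
  have hd0 : -(m : ℤ) < d := by omega
  have hd1 : -(m : ℤ) < d - 1 := by omega
  have hχ : ∀ n : ℕ, ContDiff ℝ ∞ (cutoff (m := m) n) := fun n => contDiff_cutoff _
  have hχφ : ∀ n : ℕ, IsTest (fun x => cutoff n x • φ x) := fun n =>
    hφ.bilin_left (ContinuousLinearMap.lsmul ℝ ℝ).flip (hχ n)
  have hpd : ∀ (n : ℕ) x, pd i (fun x => cutoff n x • φ x) x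
      = pd i (cutoff n) x • φ x + cutoff n x • pd i φ x := fun n x =>
    pd_smul ((hχ n).differentiable (by simp) x) (hφ.differentiableAt x) i
  have hI1 : ∀ n : ℕ, Integrable (fun x => B (pd i f x) (cutoff n x • φ x)) (ballVol m) :=
    fun n => (hf.pd i).integrable_bilin hd1 B (hχφ n).continuous
  have hI2 : ∀ n : ℕ, Integrable (fun x => B (f x) (pd i (cutoff n) x • φ x)) (ballVol m) :=
    fun n => hf.integrable_bilin hd0 B ((contDiff_pd (hχ n) i).continuous.smul hφ.continuous)
  have hI3 : ∀ n : ℕ, Integrable (fun x => B (f x) (cutoff n x • pd i φ x)) (ballVol m) :=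
    fun n => hf.integrable_bilin hd0 B ((hχ n).continuous.smul (hφ.pd i).continuous)
  -- away from the singularity the classical formula applies
  have hparts : ∀ n : ℕ, ∫ x, B (f x) (pd i (cutoff n) x • φ x) ∂(ballVol m)
      + ∫ x, B (f x) (cutoff n x • pd i φ x) ∂(ballVol m)
      = -∫ x, B (pd i f x) (cutoff n x • φ x) ∂(ballVol m) := by
    intro n
    rw [← integral_add (hI2 n) (hI3 n)]
    have e : ∀ x, B (f x) (pd i (cutoff n) x • φ x) + B (f x) (cutoff n x • pd i φ x)
        = B (f x) (pd i (fun x => cutoff n x • φ x) x) := fun x => by rw [hpd, map_add]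
    have hI4 : Integrable (fun x => B (f x) (pd i (fun x => cutoff n x • φ x) x)) (ballVol m) :=
      ((hI2 n).add (hI3 n)).congr (ae_of_all _ e)
    simp only [e]
    have z1 : ∀ x, x ∉ Metric.ball (0 : EuclideanSpace ℝ (Fin m)) 1 →
        B (f x) (pd i (fun x => cutoff n x • φ x) x) = 0 := fun x hx => by
      rw [((hχφ n).pd i).eq_zero hx, map_zero]
    have z2 : ∀ x, x ∉ Metric.ball (0 : EuclideanSpace ℝ (Fin m)) 1 →
        B (pd i f x) (cutoff n x • φ x) = 0 := fun x hx => by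
      rw [(hχφ n).eq_zero hx, map_zero]
    have z3 : ∀ x, x ∉ Metric.ball (0 : EuclideanSpace ℝ (Fin m)) 1 →
        B (f x) (cutoff n x • φ x) = 0 := fun x hx => by
      rw [(hχφ n).eq_zero hx, map_zero]
    rw [integral_ballVol_eq z1, integral_ballVol_eq z2]
    refine integral_bilinear_fderiv_right_eq_neg_left_of_integrable (B := B)
      (integrable_volume_of_ballVol (hI1 n) z2) (integrable_volume_of_ballVol hI4 z1)
      (integrable_volume_of_ballVol (hf.integrable_bilin hd0 B (hχφ n).continuous) z3)
      (fun x hx => hf.smooth.differentiableAt ?_) (fun x _ => (hχφ n).differentiableAt x)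
    rintro rfl
    exact zero_notMem_tsupport_cutoff_smul φ hx
  have hle : ∀ (n : ℕ) (x : EuclideanSpace ℝ (Fin m)), |cutoff n x| ≤ 1 := fun n x => by
    rw [cutoff, abs_of_nonneg (Real.smoothTransition.nonneg _)]
    exact Real.smoothTransition.le_one _
  have hlim3 : Tendsto (fun n : ℕ => ∫ x, B (f x) (cutoff n x • pd i φ x) ∂(ballVol m)) atTop
      (𝓝 (∫ x, B (f x) (pd i φ x) ∂(ballVol m))) := by
    refine tendsto_integral_of_dominated_convergence (fun x => ‖B (f x) (pd i φ x)‖)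
      (fun n => (hI3 n).1) (hf.integrable_bilin hd0 B (hφ.pd i).continuous).norm
      (fun n => ae_of_all _ fun x => ?_) ?_
    · rw [map_smul, norm_smul]
      exact mul_le_of_le_one_left (norm_nonneg _) (hle n x)
    · filter_upwards [ae_ne_zero] with x hx
      refine tendsto_const_nhds.congr' ?_
      filter_upwards [eventually_cutoff hx] with n hn
      rw [hn.1, one_smul]
  have hlim1 : Tendsto (fun n : ℕ => ∫ x, B (pd i f x) (cutoff n x • φ x) ∂(ballVol m)) atTop
      (𝓝 (∫ x, B (pd i f x) (φ x) ∂(ballVol m))) := by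
    refine tendsto_integral_of_dominated_convergence (fun x => ‖B (pd i f x) (φ x)‖)
      (fun n => (hI1 n).1) ((hf.pd i).integrable_bilin hd1 B hφ.continuous).norm
      (fun n => ae_of_all _ fun x => ?_) ?_
    · rw [map_smul, norm_smul]
      exact mul_le_of_le_one_left (norm_nonneg _) (hle n x)
    · filter_upwards [ae_ne_zero] with x hx
      refine tendsto_const_nhds.congr' ?_
      filter_upwards [eventually_cutoff hx] with n hn
      rw [hn.1, one_smul]
  have hlim2 : Tendsto (fun n : ℕ => ∫ x, B (f x) (pd i (cutoff n) x • φ x) ∂(ballVol m)) atTop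
      (𝓝 0) := by
    obtain ⟨M, hM0, hM⟩ := exists_bound_pd_cutoff (m := m)
    have hdom : Integrable (fun x : EuclideanSpace ℝ (Fin m) =>
        ‖ContinuousLinearMap.lsmul ℝ ℝ (‖x‖ ^ (-1 : ℤ)) (B (f x) (φ x))‖) (ballVol m) := by
      have := ((HomSmooth.norm_zpow (-1)).smul hf).integrable_bilin (m := m) (by omega) B
        hφ.continuous
      simpa using this.norm
    rw [show (0 : H) = ∫ x, (0 : H) ∂(ballVol m) by simp]
    refine tendsto_integral_of_dominated_convergence _
      (fun n => (hI2 n).1) (hdom.const_mul M) (fun n => ?_) ?_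
    · filter_upwards [ae_ne_zero] with x hx
      rw [map_smul, norm_smul]
      simp only [ContinuousLinearMap.lsmul_apply, norm_smul, zpow_neg, zpow_one, norm_inv,
        norm_norm]
      rw [← mul_assoc]
      gcongr
      exact hM n i x hx
    · filter_upwards [ae_ne_zero] with x hx
      refine tendsto_const_nhds.congr' ?_
      filter_upwards [eventually_cutoff hx] with n hn
      rw [hn.2 i, zero_smul, map_zero]
  have := tendsto_nhds_unique ((hlim2.add hlim3).congr hparts) hlim1.neg
  rw [zero_add] at this
  rw [this, neg_neg]

end Integration

/-! ### Eigenmaps and the generalized radial projection -/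

section EigenMaps

variable {m : ℕ} {F G : Type*} [NormedAddCommGroup F] [InnerProductSpace ℝ F]
  [NormedAddCommGroup G] [InnerProductSpace ℝ G]

theorem pd_inner {f g : EuclideanSpace ℝ (Fin m) → F} {x : EuclideanSpace ℝ (Fin m)}
    (hf : DifferentiableAt ℝ f x) (hg : DifferentiableAt ℝ g x) (i : Fin m) :
    pd i (fun x => (inner ℝ (f x) (g x) : ℝ)) x
      = inner ℝ (pd i f x) (g x) + inner ℝ (f x) (pd i g x) :=
  pd_bilin (innerSL ℝ : F →L[ℝ] F →L[ℝ] ℝ) hf hg i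

theorem lap_inner {f g : EuclideanSpace ℝ (Fin m) → F} {x : EuclideanSpace ℝ (Fin m)}
    (hx : x ≠ 0) (hf : SmoothOff f) (hg : SmoothOff g) :
    lap (fun x => (inner ℝ (f x) (g x) : ℝ)) x
      = inner ℝ (lap f x) (g x) + 2 * ∑ i, inner ℝ (pd i f x) (pd i g x)
        + inner ℝ (f x) (lap g x) :=
  lap_bilin (innerSL ℝ : F →L[ℝ] F →L[ℝ] ℝ) hx hf hg

theorem pd_clm (L : F →L[ℝ] G) {f : EuclideanSpace ℝ (Fin m) → F}
    {x : EuclideanSpace ℝ (Fin m)} (hf : DifferentiableAt ℝ f x) (i : Fin m) :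
    pd i (fun x => L (f x)) x = L (pd i f x) := by
  have := (L.hasFDerivAt.comp x hf.hasFDerivAt).fderiv
  change fderiv ℝ (L ∘ f) x (stdVec i) = _
  rw [this]; rfl

theorem lap_clm (L : F →L[ℝ] G) {f : EuclideanSpace ℝ (Fin m) → F}
    {x : EuclideanSpace ℝ (Fin m)} (hx : x ≠ 0) (hf : SmoothOff f) :
    lap (fun x => L (f x)) x = L (lap f x) := by
  simp only [lap, map_sum]
  refine Finset.sum_congr rfl fun i _ => ?_
  rw [pd_congr_off (fun y hy => pd_clm L (hf.differentiableAt hy) i) i hx,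
    pd_clm L ((hf.pd i).differentiableAt hx)]

/-- The Laplacian of `r^d f` for a homogeneous map `f`; the mixed term is given by Euler's
identity. -/
theorem HomSmooth.lap_norm_zpow_smul {e : ℤ} {f : EuclideanSpace ℝ (Fin m) → F}
    (hf : HomSmooth e f) (d : ℤ) {x : EuclideanSpace ℝ (Fin m)} (hx : x ≠ 0) :
    BiharmonicBall.lap (fun x => ‖x‖ ^ d • f x) x
      = (d * (d + m - 2 + 2 * e) * ‖x‖ ^ (d - 2)) • f x + ‖x‖ ^ d • BiharmonicBall.lap f x := by
  rw [lap_smul hx (HomSmooth.norm_zpow d).smooth hf.smooth, lap_norm_zpow d hx]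
  have : ∑ i, BiharmonicBall.pd i (fun x => ‖x‖ ^ d) x • BiharmonicBall.pd i f x
      = (d * ‖x‖ ^ (d - 2) * e) • f x := by
    simp only [pd_norm_zpow d _ hx, mul_smul _ (x _)]
    rw [← Finset.smul_sum, hf.euler hx, smul_smul]
  rw [this, smul_smul, ← add_smul]
  congr 2; ring

/-- A map into the sphere of squared radius `c`, homogeneous of degree zero, whose restriction to
the unit sphere of `ℝ^m` is an eigenmap of the spherical Laplacian for the eigenvalue `lam`. -/
structure EigenMap (lam c : ℝ) (h : EuclideanSpace ℝ (Fin m) → F) : Prop where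
  hom : HomSmooth 0 h
  lap_eq : ∀ x, x ≠ 0 → lap h x = (-(lam * ‖x‖ ^ (-2 : ℤ))) • h x
  norm_sq : ∀ x, x ≠ 0 → ‖h x‖ ^ 2 = c

variable {lam c : ℝ} {h : EuclideanSpace ℝ (Fin m) → F}

theorem EigenMap.inner_pd (hh : EigenMap lam c h) {x : EuclideanSpace ℝ (Fin m)} (hx : x ≠ 0)
    (i : Fin m) : inner ℝ (h x) (pd i h x) = 0 := by
  have h1 := pd_inner (hh.hom.smooth.differentiableAt hx) (hh.hom.smooth.differentiableAt hx) i
  rw [pd_congr_off (g := fun _ => c)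
    (fun y hy => by rw [real_inner_self_eq_norm_sq, hh.norm_sq y hy]) i hx, pd_const,
    real_inner_comm] at h1
  linarith

/-- The energy density of an eigenmap, from `Δ|h|² = 0`. -/
theorem EigenMap.sum_norm_pd_sq (hh : EigenMap lam c h) {x : EuclideanSpace ℝ (Fin m)}
    (hx : x ≠ 0) : ∑ i, ‖pd i h x‖ ^ 2 = lam * c * ‖x‖ ^ (-2 : ℤ) := by
  have h1 := lap_inner hx hh.hom.smooth hh.hom.smooth
  have h0 : lap (fun x => (inner ℝ (h x) (h x) : ℝ)) x = 0 := by
    rw [lap_congr_off (g := fun _ => c)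
      (fun y hy => by rw [real_inner_self_eq_norm_sq, hh.norm_sq y hy]) hx, lap_const]
  rw [h0, hh.lap_eq x hx, real_inner_smul_left, real_inner_smul_right,
    real_inner_self_eq_norm_sq, hh.norm_sq x hx] at h1
  simp only [real_inner_self_eq_norm_sq] at h1
  linarith

end EigenMaps

section RadialProjection

variable {m : ℕ}

/-- Multiplication by `y_j` and the derivative `r ∂_j` combine, with the coefficient
`c = (ℓ + m - 2)⁻¹`, to an operator that raises the degree `ℓ` of a spherical harmonic by one. -/
theorem lap_degree_raising {l : ℝ} {u : EuclideanSpace ℝ (Fin m) → ℝ} (hl : l + m - 2 ≠ 0)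
    (hu : HomSmooth 0 u)
    (hlap : ∀ x, x ≠ 0 → lap u x = -(l * (l + m - 2) * ‖x‖ ^ (-2 : ℤ)) * u x) (j : Fin m)
    {x : EuclideanSpace ℝ (Fin m)} (hx : x ≠ 0) :
    lap (fun x => x j / ‖x‖ * u x - 1 / (l + m - 2) * ‖x‖ * pd j u x) x
      = -((l + 1) * (l + 1 + m - 2) * ‖x‖ ^ (-2 : ℤ))
        * (x j / ‖x‖ * u x - 1 / (l + m - 2) * ‖x‖ * pd j u x) := by
  have hr : ‖x‖ ≠ 0 := norm_ne_zero_iff.2 hx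
  have hg : HomSmooth (-1 + 0) (fun x => ‖x‖ ^ (-1 : ℤ) • u x) := (HomSmooth.norm_zpow (-1)).smul hu
  have hk : HomSmooth (1 + (0 - 1)) (fun x => ‖x‖ ^ (1 : ℤ) • pd j u x) :=
    (HomSmooth.norm_zpow 1).smul (hu.pd j)
  have hxj := HomSmooth.coord j
  have e1 : lap (fun x => ‖x‖ ^ (-1 : ℤ) • u x) x
      = -(m - 3 + l * (l + m - 2)) * ‖x‖ ^ (-3 : ℤ) * u x := by
    rw [hu.lap_norm_zpow_smul (-1) hx, hlap x hx]
    simp only [smul_eq_mul]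
    rw [show (-1 : ℤ) - 2 = -3 by ring, show (-3 : ℤ) = -1 + -2 by ring, zpow_add₀ hr]
    push_cast; ring
  have e2 : pd j (fun x => ‖x‖ ^ (-1 : ℤ) • u x) x
      = -(‖x‖ ^ (-3 : ℤ) * x j * u x) + ‖x‖ ^ (-1 : ℤ) * pd j u x := by
    rw [pd_smul ((HomSmooth.norm_zpow (-1)).smooth.differentiableAt hx)
      (hu.smooth.differentiableAt hx), pd_norm_zpow (-1) j hx]
    simp only [smul_eq_mul]
    push_cast; ring_nf
  have e3 : lap (fun x => x j • (‖x‖ ^ (-1 : ℤ) • u x)) x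
      = -(m - 1 + l * (l + m - 2)) * ‖x‖ ^ (-3 : ℤ) * (x j * u x)
        + 2 * ‖x‖ ^ (-1 : ℤ) * pd j u x := by
    have hs : ∑ i, pd i (fun x => x j) x • pd i (fun x => ‖x‖ ^ (-1 : ℤ) • u x) x
        = pd j (fun x => ‖x‖ ^ (-1 : ℤ) • u x) x := by
      simp [pd_coord]
    rw [lap_smul hx hxj.smooth hg.smooth, lap_coord, e1, hs, e2]
    simp only [smul_eq_mul]
    ring
  have e4 : lap (pd j u) x = 2 * (l * (l + m - 2)) * ‖x‖ ^ (-4 : ℤ) * x j * u x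
      - (l * (l + m - 2)) * ‖x‖ ^ (-2 : ℤ) * pd j u x := by
    rw [pd_lap hu.smooth hx, pd_congr_off (g := fun x => (-(l * (l + m - 2))) *
      (‖x‖ ^ (-2 : ℤ) * u x)) (fun y hy => by rw [hlap y hy]; ring) j hx,
      pd_const_mul _ (((HomSmooth.norm_zpow (-2)).mul hu).smooth.differentiableAt hx),
      pd_mul ((HomSmooth.norm_zpow (-2)).smooth.differentiableAt hx)
      (hu.smooth.differentiableAt hx), pd_norm_zpow (-2) j hx]
    push_cast; ring_nf
  have e5 : lap (fun x => ‖x‖ ^ (1 : ℤ) • pd j u x) x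
      = (m - 3 - l * (l + m - 2)) * ‖x‖ ^ (-1 : ℤ) * pd j u x
        + 2 * (l * (l + m - 2)) * ‖x‖ ^ (-3 : ℤ) * x j * u x := by
    rw [(hu.pd j).lap_norm_zpow_smul 1 hx, e4]
    simp only [smul_eq_mul]
    rw [show (1 : ℤ) - 2 = -1 by ring, show (-4 : ℤ) = -3 + -1 by ring, zpow_add₀ hr,
      show (-2 : ℤ) = -1 + -1 by ring, zpow_add₀ hr]
    simp only [zpow_neg, zpow_one]
    push_cast; field_simp; ring
  rw [lap_congr_off (g := fun x => x j • (‖x‖ ^ (-1 : ℤ) • u x)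
      - (1 / (l + m - 2)) • (‖x‖ ^ (1 : ℤ) • pd j u x)) (fun y hy => by
        simp only [smul_eq_mul, zpow_neg, zpow_one, div_eq_mul_inv]; ring) hx,
    lap_sub hx (hxj.smul hg).smooth (hk.const_smul _).smooth, lap_const_smul _ hx hk.smooth, e3, e5]
  have z1 : ‖x‖ ^ (-3 : ℤ) = (‖x‖ ^ 3)⁻¹ := by rw [zpow_neg]; norm_cast
  have z2 : ‖x‖ ^ (-2 : ℤ) = (‖x‖ ^ 2)⁻¹ := by rw [zpow_neg]; norm_cast
  rw [z1, z2, zpow_neg, zpow_one, smul_eq_mul]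
  field_simp
  ring

/-- The generalized radial projection `u^{(ℓ)}` as a vector-valued map. -/
noncomputable def radialVec (m l : ℕ) (x : EuclideanSpace ℝ (Fin m)) :
    EuclideanSpace ℝ (Fin l → Fin m) :=
  WithLp.toLp 2 fun i => radialProj m l i x

theorem pd_component {ι : Type*} [Fintype ι] {f : EuclideanSpace ℝ (Fin m) → EuclideanSpace ℝ ι}
    {x : EuclideanSpace ℝ (Fin m)} (hf : DifferentiableAt ℝ f x) (i : Fin m) (b : ι) :
    pd i f x b = pd i (fun x => f x b) x :=
  (pd_clm (EuclideanSpace.proj (𝕜 := ℝ) b) hf i).symm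

theorem lap_component {ι : Type*} [Fintype ι] {f : EuclideanSpace ℝ (Fin m) → EuclideanSpace ℝ ι}
    {x : EuclideanSpace ℝ (Fin m)} (hx : x ≠ 0) (hf : SmoothOff f) (b : ι) :
    lap f x b = lap (fun x => f x b) x :=
  (lap_clm (EuclideanSpace.proj (𝕜 := ℝ) b) hx hf).symm

theorem homSmooth_euclidean {ι : Type*} [Fintype ι] {d : ℤ}
    {f : EuclideanSpace ℝ (Fin m) → EuclideanSpace ℝ ι}
    (hf : ∀ b, HomSmooth d (fun x => f x b)) : HomSmooth d f :=
  ⟨contDiffOn_euclidean.2 fun b => (hf b).smooth, fun t ht x hx => by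
    ext b; exact (hf b).hom t ht x hx⟩

theorem eigenMap_radialVec (hm : 3 ≤ m) (n : ℕ) :
    EigenMap (((n : ℝ) + 1) * ((n : ℝ) + 1 + m - 2)) 1 (radialVec m (n + 1)) := by
  have hm' : (3 : ℝ) ≤ m := by exact_mod_cast hm
  induction n with
  | zero =>
    have hh : HomSmooth 0 (radialVec m 1) := homSmooth_euclidean fun b =>
      HomSmooth.congr (d := 1 + -1) ((HomSmooth.coord (b 0)).mul (HomSmooth.norm_zpow (-1)))
        fun x hx => by simp [radialVec, radialProj, div_eq_mul_inv]
    refine ⟨hh, fun x hx => ?_, fun x hx => ?_⟩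
    · have hr : ‖x‖ ≠ 0 := norm_ne_zero_iff.2 hx
      ext b
      have hu : HomSmooth (m := m) 0 (fun _ => (1 : ℝ)) := HomSmooth.const 1
      have h1 := lap_degree_raising (m := m) (l := 0) (by linarith) hu (fun y hy => by
        rw [lap_const]; simp) (b 0) hx
      simp only [pd_const, mul_zero, mul_one, sub_zero] at h1
      rw [lap_component hx hh.smooth]
      have e : ∀ x, radialVec m 1 x b = x (b 0) / ‖x‖ := fun x => by simp [radialVec, radialProj]
      simp only [e, PiLp.smul_apply, h1, smul_eq_mul]
      simp
    · have hr : ‖x‖ ≠ 0 := norm_ne_zero_iff.2 hx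
      have e := Fintype.sum_equiv (Equiv.funUnique (Fin 1) (Fin m))
        (fun i => (x (i 0) / ‖x‖) ^ 2) (fun j => (x j / ‖x‖) ^ 2) (fun i => rfl)
      rw [EuclideanSpace.real_norm_sq_eq]
      simp only [radialVec, radialProj]
      rw [e]
      simp only [div_pow]
      rw [← Finset.sum_div, ← norm_sq_eq_sum]
      field_simp
  | succ n ih =>
    set l : ℝ := (n : ℝ) + 1 with hl
    have hn : (0 : ℝ) ≤ n := n.cast_nonneg
    have hlpos : 0 < l + m - 2 := by linarith
    have hlpos' : 0 < 2 * l + m - 2 := by linarith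
    set C : ℝ := √((l + m - 2) / (2 * l + m - 2)) with hC
    have hC2 : C ^ 2 = (l + m - 2) / (2 * l + m - 2) := by
      rw [hC, Real.sq_sqrt (div_nonneg hlpos.le hlpos'.le)]
    have hu : ∀ i, HomSmooth 0 (radialProj m (n + 1) i) := fun i =>
      ih.hom.clm (EuclideanSpace.proj (𝕜 := ℝ) i)
    have hlap : ∀ i x, x ≠ 0 → lap (radialProj m (n + 1) i) x
        = -(l * (l + m - 2) * ‖x‖ ^ (-2 : ℤ)) * radialProj m (n + 1) i x := fun i x hx => by
      have h1 := lap_component hx ih.hom.smooth i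
      rw [ih.lap_eq x hx] at h1
      exact h1.symm
    have e : ∀ i x, radialProj m (n + 2) i x = C • (x (i (Fin.last (n + 1))) / ‖x‖ *
        radialProj m (n + 1) (Fin.init i) x - 1 / (l + m - 2) * ‖x‖ *
        pd (i (Fin.last (n + 1))) (radialProj m (n + 1) (Fin.init i)) x) := by
      intro i x
      have e1 : (n : ℝ) + 2 + m - 3 = l + m - 2 := by rw [hl]; ring
      have e2 : 2 * ((n : ℝ) + 2) + m - 4 = 2 * l + m - 2 := by rw [hl]; ring
      rw [radialProj, hC, pd]
      simp only [smul_eq_mul, e1, e2]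
    have hw : ∀ i j, HomSmooth 0 (fun x => x j / ‖x‖ * radialProj m (n + 1) i x
        - 1 / (l + m - 2) * ‖x‖ * pd j (radialProj m (n + 1) i) x) := fun i j => by
      have h1 : HomSmooth 0 (fun x => x j * ‖x‖ ^ (-1 : ℤ) * radialProj m (n + 1) i x) := by
        rw [show (0 : ℤ) = 1 + -1 + 0 by norm_num]
        exact ((HomSmooth.coord j).mul (HomSmooth.norm_zpow (-1))).mul (hu i)
      have h2 : HomSmooth 0 (fun x => ‖x‖ ^ (1 : ℤ) * pd j (radialProj m (n + 1) i) x) :=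
        (HomSmooth.norm_zpow 1).mul ((hu i).pd j)
      refine (h1.sub (h2.const_smul (1 / (l + m - 2)))).congr fun x hx => ?_
      simp only [zpow_neg, zpow_one, smul_eq_mul, div_eq_mul_inv]
      ring
    have hh : HomSmooth 0 (radialVec m (n + 2)) := homSmooth_euclidean fun i =>
      ((hw (Fin.init i) (i (Fin.last (n + 1)))).const_smul C).congr fun x _ => e i x
    have hcast : (((n + 1 : ℕ) : ℝ) + 1) = l + 1 := by push_cast; rw [hl]
    refine ⟨hh, fun x hx => ?_, fun x hx => ?_⟩
    · ext i
      rw [lap_component hx hh.smooth, hcast]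
      simp only [radialVec, PiLp.smul_apply, smul_eq_mul]
      rw [lap_congr_off (fun y _ => e i y) hx, lap_const_smul _ hx (hw _ _).smooth,
        lap_degree_raising hlpos.ne' (hu _) (hlap _) _ hx, e i x, smul_eq_mul, smul_eq_mul]
      ring
    · have hr : ‖x‖ ≠ 0 := norm_ne_zero_iff.2 hx
      have hsum : ∀ i, ∑ j, (x j / ‖x‖ * radialProj m (n + 1) i x
          - 1 / (l + m - 2) * ‖x‖ * pd j (radialProj m (n + 1) i) x) ^ 2
          = radialProj m (n + 1) i x ^ 2
            + (1 / (l + m - 2) * ‖x‖) ^ 2 * ∑ j, pd j (radialProj m (n + 1) i) x ^ 2 := by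
        intro i
        have h1 := (hu i).euler hx
        simp only [smul_eq_mul, Int.cast_zero, zero_mul] at h1
        have h2 := norm_sq_eq_sum x
        have h3 : ∀ j, (x j / ‖x‖ * radialProj m (n + 1) i x
            - 1 / (l + m - 2) * ‖x‖ * pd j (radialProj m (n + 1) i) x) ^ 2
            = (radialProj m (n + 1) i x / ‖x‖) ^ 2 * x j ^ 2
              - 2 * (1 / (l + m - 2)) * radialProj m (n + 1) i x
                * (x j * pd j (radialProj m (n + 1) i) x)
              + (1 / (l + m - 2) * ‖x‖) ^ 2 * pd j (radialProj m (n + 1) i) x ^ 2 := by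
          intro j; field_simp; ring
        simp only [h3]
        rw [Finset.sum_add_distrib, Finset.sum_sub_distrib, ← Finset.mul_sum, ← Finset.mul_sum,
          ← Finset.mul_sum, h1, ← h2]
        field_simp
        ring
      have hA : ∑ i, radialProj m (n + 1) i x ^ 2 = 1 := by
        rw [← ih.norm_sq x hx, EuclideanSpace.real_norm_sq_eq]; rfl
      have hB : ∑ i, ∑ j, pd j (radialProj m (n + 1) i) x ^ 2
          = l * (l + m - 2) * ‖x‖ ^ (-2 : ℤ) := by
        have h1 := ih.sum_norm_pd_sq hx
        rw [mul_one] at h1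
        rw [← h1, Finset.sum_comm]
        refine Finset.sum_congr rfl fun j _ => ?_
        rw [EuclideanSpace.real_norm_sq_eq]
        refine Finset.sum_congr rfl fun i _ => ?_
        rw [pd_component (ih.hom.smooth.differentiableAt hx)]; rfl
      have hre := Fintype.sum_equiv (Fin.snocEquiv (fun _ : Fin (n + 2) => Fin m))
        (fun p => (C • (x p.1 / ‖x‖ * radialProj m (n + 1) p.2 x
          - 1 / (l + m - 2) * ‖x‖ * pd p.1 (radialProj m (n + 1) p.2) x)) ^ 2)
        (fun i => radialProj m (n + 2) i x ^ 2) (fun p => by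
          rw [e]; simp [Fin.snocEquiv])
      have hz : ‖x‖ ^ (-2 : ℤ) = (‖x‖ ^ 2)⁻¹ := by rw [zpow_neg]; norm_cast
      rw [EuclideanSpace.real_norm_sq_eq]
      simp only [radialVec]
      rw [← hre, Fintype.sum_prod_type_right]
      simp only [smul_eq_mul, mul_pow C, ← Finset.mul_sum, hsum]
      rw [Finset.sum_add_distrib, ← Finset.mul_sum, hA, hB, hC2, hz]
      have hne := hlpos.ne'
      have hne' := hlpos'.ne'
      rw [show (1 / (l + m - 2) * ‖x‖) ^ 2 * (l * (l + m - 2) * (‖x‖ ^ 2)⁻¹) = l / (l + m - 2) by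
        field_simp, one_add_div hne, div_mul_div_comm, div_eq_one_iff_eq (by positivity)]
      ring

end RadialProjection

/-! ### Weak derivatives of maps with a singularity at the origin -/

section WeakDerivatives

variable {m : ℕ} {F G K : Type*} [NormedAddCommGroup F] [InnerProductSpace ℝ F]
  [NormedAddCommGroup G] [InnerProductSpace ℝ G] [NormedAddCommGroup K] [NormedSpace ℝ K]
  {f f' g g' : EuclideanSpace ℝ (Fin m) → F} {i : Fin m}

theorem IsTest.integrable_smul {θ : EuclideanSpace ℝ (Fin m) → ℝ} (hθ : IsTest θ)
    (hf : LocallyIntegrableOn f (Metric.ball 0 1)) :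
    Integrable (fun x => θ x • f x) (ballVol m) := by
  have h1 : IntegrableOn f (tsupport θ) := hf.integrableOn_compact_subset hθ.2.2 hθ.2.1
  have h2 : IntegrableOn (fun x => θ x • f x) (tsupport θ) :=
    h1.continuousOn_smul hθ.continuous.continuousOn hθ.2.1
  have h3 : Integrable (fun x => θ x • f x) :=
    (integrableOn_iff_integrable_of_support_subset fun x hx => by
      by_contra h
      exact hx (by simp [image_eq_zero_of_notMem_tsupport h])).1 h2
  exact h3.mono_measure Measure.restrict_le_self

theorem IsWeakPartial.congr (h : IsWeakPartial i f g) (hf : f =ᵐ[ballVol m] f')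
    (hg : g =ᵐ[ballVol m] g') : IsWeakPartial i f' g' := by
  refine ⟨h.1.congr hf, h.2.1.congr hg, fun φ hφ => ?_⟩
  have e1 : ∫ x, (fderiv ℝ φ x (stdVec i)) • f' x ∂(ballVol m)
      = ∫ x, (fderiv ℝ φ x (stdVec i)) • f x ∂(ballVol m) :=
    integral_congr_ae (by filter_upwards [hf] with x hx; rw [hx])
  have e2 : ∫ x, φ x • g' x ∂(ballVol m) = ∫ x, φ x • g x ∂(ballVol m) :=
    integral_congr_ae (by filter_upwards [hg] with x hx; rw [hx])
  rw [e1, e2, h.2.2 φ hφ]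

theorem IsWeakPartial.sub (h : IsWeakPartial i f g) (h' : IsWeakPartial i f' g') :
    IsWeakPartial i (fun x => f x - f' x) (fun x => g x - g' x) := by
  refine ⟨h.1.sub h'.1, h.2.1.sub h'.2.1, fun φ hφ => ?_⟩
  have i1 : Integrable (fun x => fderiv ℝ φ x (stdVec i) • f x) (ballVol m) :=
    (hφ.pd i).integrable_smul h.1
  have i2 : Integrable (fun x => fderiv ℝ φ x (stdVec i) • f' x) (ballVol m) :=
    (hφ.pd i).integrable_smul h'.1
  simp only [smul_sub]
  rw [integral_sub i1 i2,
    integral_sub (hφ.integrable_smul h.2.1) (hφ.integrable_smul h'.2.1), h.2.2 φ hφ, h'.2.2 φ hφ]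
  abel

theorem IsWeakPartial.add (h : IsWeakPartial i f g) (h' : IsWeakPartial i f' g') :
    IsWeakPartial i (fun x => f x + f' x) (fun x => g x + g' x) := by
  refine ⟨h.1.add h'.1, h.2.1.add h'.2.1, fun φ hφ => ?_⟩
  have i1 : Integrable (fun x => fderiv ℝ φ x (stdVec i) • f x) (ballVol m) :=
    (hφ.pd i).integrable_smul h.1
  have i2 : Integrable (fun x => fderiv ℝ φ x (stdVec i) • f' x) (ballVol m) :=
    (hφ.pd i).integrable_smul h'.1
  simp only [smul_add]
  rw [integral_add i1 i2,
    integral_add (hφ.integrable_smul h.2.1) (hφ.integrable_smul h'.2.1), h.2.2 φ hφ, h'.2.2 φ hφ]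
  abel

theorem IsWeakPartial.unique [CompleteSpace F] (h : IsWeakPartial i f g)
    (h' : IsWeakPartial i f g') : g =ᵐ[ballVol m] g' := by
  have h0 : ∀ᵐ x : EuclideanSpace ℝ (Fin m), x ∈ Metric.ball 0 1 → (g - g') x = 0 := by
    refine Metric.isOpen_ball.ae_eq_zero_of_integral_contDiff_smul_eq_zero (h.2.1.sub h'.2.1) ?_
    intro θ h1 h2 h3
    have hθ : IsTest θ := ⟨h1, h2, h3⟩
    rw [← integral_ballVol_eq fun x hx => by rw [hθ.eq_zero hx, zero_smul]]
    simp only [Pi.sub_apply, smul_sub]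
    rw [integral_sub (hθ.integrable_smul h.2.1) (hθ.integrable_smul h'.2.1)]
    have e1 := h.2.2 θ hθ
    have e2 := h'.2.2 θ hθ
    rw [e1, neg_inj] at e2
    rw [e2, sub_self]
  have h1 := (ae_restrict_iff' measurableSet_ball).2 h0
  filter_upwards [h1] with x hx using sub_eq_zero.1 hx

theorem isWeakPartial_wPartial (h : ∃ g, IsWeakPartial i f g) :
    IsWeakPartial i f (wPartial i f) := by
  rw [wPartial, dif_pos h]
  exact h.choose_spec

theorem IsWeakPartial.wPartial_ae_eq [CompleteSpace F] (h : IsWeakPartial i f g) :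
    wPartial i f =ᵐ[ballVol m] g :=
  (isWeakPartial_wPartial ⟨g, h⟩).unique h

open Classical in
theorem wPartial_congr (h : f =ᵐ[ballVol m] f') : wPartial i f = wPartial i f' := by
  have : IsWeakPartial i f = IsWeakPartial i f' := funext fun g => propext
    ⟨fun H => H.congr h (ae_eq_refl _), fun H => H.congr h.symm (ae_eq_refl _)⟩
  -- equal predicates have the same chosen witness
  have key : ∀ P Q : (EuclideanSpace ℝ (Fin m) → F) → Prop, P = Q →
      (if h : ∃ g, P g then h.choose else 0) = if h : ∃ g, Q g then h.choose else 0 := by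
    rintro P _ rfl; rfl
  exact key _ _ this

theorem wLaplacian_ae_eq_lap [CompleteSpace F] (h1 : ∀ i, IsWeakPartial i f (pd i f))
    (h2 : ∀ i, IsWeakPartial i (pd i f) (pd i (pd i f))) :
    wLaplacian f =ᵐ[ballVol m] lap f := by
  have : ∀ᵐ x ∂(ballVol m), ∀ i, wPartial i (wPartial i f) x = pd i (pd i f) x :=
    ae_all_iff.2 fun i => by
      rw [wPartial_congr (h1 i).wPartial_ae_eq]
      exact (h2 i).wPartial_ae_eq
  filter_upwards [this] with x hx
  exact Finset.sum_congr rfl fun i _ => hx i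

/-- The weak partial derivatives of a product of a homogeneous map of degree larger than `1 - m`
and a smooth map are given by the Leibniz rule. -/
theorem isWeakPartial_bilin [NeZero m] {d : ℤ} (hd : 1 - (m : ℤ) < d)
    {T : EuclideanSpace ℝ (Fin m) → K} {φ : EuclideanSpace ℝ (Fin m) → G}
    (B : K →L[ℝ] G →L[ℝ] F) (hT : HomSmooth d T) (hφ : ContDiff ℝ ∞ φ) (i : Fin m) :
    IsWeakPartial i (fun x => B (T x) (φ x))
      (fun x => B (pd i T x) (φ x) + B (T x) (pd i φ x)) := by
  have hd0 : -(m : ℤ) < d := by omega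
  have hd1 : -(m : ℤ) < d - 1 := by omega
  refine ⟨?_, ?_, fun θ hθ => ?_⟩
  · exact IntegrableOn.locallyIntegrableOn (hT.integrable_bilin hd0 B hφ.continuous)
  · exact IntegrableOn.locallyIntegrableOn (((hT.pd i).integrable_bilin hd1 B hφ.continuous).add
      (hT.integrable_bilin hd0 B (contDiff_pd hφ i).continuous))
  · have hθφ : IsTest (fun x => θ x • φ x) := hθ.smul_left hφ
    have key := integral_bilin_pd hd B hT hθφ i
    have e : ∀ x, pd i (fun x => θ x • φ x) x = pd i θ x • φ x + θ x • pd i φ x := fun x =>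
      pd_smul (hθ.differentiableAt x) (hφ.differentiable (by simp) x) i
    simp only [e, map_add, map_smul] at key
    have i1 : Integrable (fun x => pd i θ x • B (T x) (φ x)) (ballVol m) := by
      simpa only [Pi.smul_apply', map_smul] using hT.integrable_bilin hd0 B
        ((hθ.pd i).continuous.smul hφ.continuous)
    have i2 : Integrable (fun x => θ x • B (T x) (pd i φ x)) (ballVol m) := by
      simpa only [Pi.smul_apply', map_smul] using hT.integrable_bilin hd0 B
        (hθ.continuous.smul (contDiff_pd hφ i).continuous)
    have i3 : Integrable (fun x => θ x • B (pd i T x) (φ x)) (ballVol m) := by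
      simpa only [Pi.smul_apply', map_smul] using (hT.pd i).integrable_bilin hd1 B
        (hθ.continuous.smul hφ.continuous)
    rw [integral_add i1 i2] at key
    simp only [smul_add]
    rw [integral_add i3 i2, key]
    change ∫ x, pd i θ x • B (T x) (φ x) ∂(ballVol m) = _
    abel

theorem HomSmooth.isWeakPartial [NeZero m] {d : ℤ} (hd : 1 - (m : ℤ) < d)
    (hf : HomSmooth d f) (i : Fin m) : IsWeakPartial i f (BiharmonicBall.pd i f) := by
  have h := isWeakPartial_bilin (φ := fun _ => (1 : ℝ)) hd
    (ContinuousLinearMap.lsmul ℝ ℝ : ℝ →L[ℝ] F →L[ℝ] F).flip hf contDiff_const i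
  simpa [pd_const] using h

theorem isWeakPartial_of_contDiff [NeZero m] (hm : 2 ≤ m) (hf : ContDiff ℝ ∞ f) (i : Fin m) :
    IsWeakPartial i f (pd i f) := by
  have h := isWeakPartial_bilin (T := fun _ => (1 : ℝ)) (d := 0) (by omega)
    (ContinuousLinearMap.lsmul ℝ ℝ : ℝ →L[ℝ] F →L[ℝ] F) (HomSmooth.const 1) hf i
  simpa [pd_const] using h

theorem isWeakPartial_pd_bilin [NeZero m] {d : ℤ} (hd : 1 - (m : ℤ) < d)
    {T : EuclideanSpace ℝ (Fin m) → K} {φ : EuclideanSpace ℝ (Fin m) → G}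
    (B : K →L[ℝ] G →L[ℝ] F) (hT : HomSmooth d T) (hφ : ContDiff ℝ ∞ φ) (i : Fin m) :
    IsWeakPartial i (fun x => B (T x) (φ x)) (pd i (fun x => B (T x) (φ x))) := by
  refine (isWeakPartial_bilin hd B hT hφ i).congr (ae_eq_refl _) ?_
  filter_upwards [ae_ne_zero] with x hx
  exact (pd_bilin B (hT.smooth.differentiableAt hx) (hφ.differentiable (by simp) x) i).symm

/-- For products of a homogeneous map and a smooth map the weak Laplacian is the classical
one. -/
theorem wLaplacian_bilin [NeZero m] [CompleteSpace F] {d : ℤ} (hd : 2 - (m : ℤ) < d)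
    {T : EuclideanSpace ℝ (Fin m) → K} {φ : EuclideanSpace ℝ (Fin m) → G}
    (B : K →L[ℝ] G →L[ℝ] F) (hT : HomSmooth d T) (hφ : ContDiff ℝ ∞ φ) :
    wLaplacian (fun x => B (T x) (φ x)) =ᵐ[ballVol m] lap (fun x => B (T x) (φ x)) := by
  refine wLaplacian_ae_eq_lap (fun i => isWeakPartial_pd_bilin (by omega) B hT hφ i) fun i => ?_
  have e : ∀ x, x ≠ 0 → pd i (fun x => B (T x) (φ x)) x
      = B (pd i T x) (φ x) + B (T x) (pd i φ x) := fun x hx =>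
    pd_bilin B (hT.smooth.differentiableAt hx) (hφ.differentiable (by simp) x) i
  have h := (isWeakPartial_pd_bilin (by omega) B (hT.pd i) hφ i).add
    (isWeakPartial_pd_bilin (by omega) B hT (contDiff_pd hφ i) i)
  refine h.congr ?_ ?_
  · filter_upwards [ae_ne_zero] with x hx using (e x hx).symm
  · filter_upwards [ae_ne_zero] with x hx
    rw [pd_congr_off e i hx]
    exact (pd_add (((hT.pd i).smooth.bilin B (.of_contDiff hφ)).differentiableAt hx)
      ((hT.smooth.bilin B (.of_contDiff (contDiff_pd hφ i))).differentiableAt hx) i).symm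

section Homogeneous

variable [NeZero m] [CompleteSpace F]

theorem HomSmooth.wPartial_ae_eq {d : ℤ} (hd : 1 - (m : ℤ) < d) (hf : HomSmooth d f) (i : Fin m) :
    wPartial i f =ᵐ[ballVol m] BiharmonicBall.pd i f :=
  (hf.isWeakPartial hd i).wPartial_ae_eq

theorem HomSmooth.wPartial_wPartial_ae_eq {d : ℤ} (hd : 2 - (m : ℤ) < d) (hf : HomSmooth d f)
    (i j : Fin m) : wPartial j (wPartial i f) =ᵐ[ballVol m]
      BiharmonicBall.pd j (BiharmonicBall.pd i f) := by
  rw [wPartial_congr (hf.wPartial_ae_eq (by omega) i)]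
  exact (hf.pd i).wPartial_ae_eq (by omega) j

theorem HomSmooth.wLaplacian_ae_eq {d : ℤ} (hd : 2 - (m : ℤ) < d) (hf : HomSmooth d f) :
    wLaplacian f =ᵐ[ballVol m] BiharmonicBall.lap f :=
  wLaplacian_ae_eq_lap (fun i => hf.isWeakPartial (by omega) i)
    fun i => (hf.pd i).isWeakPartial (by omega) i

theorem HomSmooth.memW22 {d : ℤ} (hd : 4 - (m : ℤ) < 2 * d) (hd' : 2 - (m : ℤ) < d)
    (hf : HomSmooth d f) : MemW22 f := by
  have h2 : ∀ {e : ℤ} {g : EuclideanSpace ℝ (Fin m) → F}, d - 2 ≤ e → HomSmooth e g →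
      MemLp g 2 (ballVol m) := fun {e g} he hg => by
    simpa using hg.memLp (p := 2) (by simp) (by push_cast; omega)
  refine ⟨h2 (by omega) hf, fun i => ⟨⟨_, hf.isWeakPartial (by omega) i⟩, ?_, fun j => ⟨?_, ?_⟩⟩⟩
  · exact (memLp_congr_ae (hf.wPartial_ae_eq (by omega) i)).2 (h2 (by omega) (hf.pd i))
  · exact ⟨_, ((hf.pd i).isWeakPartial (by omega) j).congr
      (hf.wPartial_ae_eq (by omega) i).symm (ae_eq_refl _)⟩
  · exact (memLp_congr_ae (hf.wPartial_wPartial_ae_eq (by omega) i j)).2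
      (h2 (by omega) ((hf.pd i).pd j))

end Homogeneous

end WeakDerivatives

/-! ### Inequalities of Hardy and Rellich for test maps -/

section HardyRellich

variable {m : ℕ} {F : Type*} [NormedAddCommGroup F] [InnerProductSpace ℝ F]

theorem IsTest.inner {φ g : EuclideanSpace ℝ (Fin m) → F} (hφ : IsTest φ) (hg : ContDiff ℝ ∞ g) :
    IsTest (fun x => (inner ℝ (φ x) (g x) : ℝ)) :=
  hφ.bilin_left (innerSL ℝ : F →L[ℝ] F →L[ℝ] ℝ) hg

theorem integral_add_const_mul_add_const_mul {f g h : EuclideanSpace ℝ (Fin m) → ℝ} (a b : ℝ)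
    (hf : Integrable f (ballVol m)) (hg : Integrable g (ballVol m))
    (hh : Integrable h (ballVol m)) :
    ∫ x, (f x + a * g x + b * h x) ∂(ballVol m)
      = ∫ x, f x ∂(ballVol m) + a * ∫ x, g x ∂(ballVol m) + b * ∫ x, h x ∂(ballVol m) := by
  rw [integral_add (f := fun x => f x + a * g x) (hf.add (hg.const_mul a)) (hh.const_mul b),
    integral_add hf (hg.const_mul a), integral_const_mul, integral_const_mul]

variable [NeZero m]

theorem HomSmooth.integrable_mul {d : ℤ} (hd : -(m : ℤ) < d) {f g : EuclideanSpace ℝ (Fin m) → ℝ}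
    (hf : HomSmooth d f) (hg : Continuous g) : Integrable (fun x => f x * g x) (ballVol m) :=
  hf.integrable_bilin hd (ContinuousLinearMap.lsmul ℝ ℝ : ℝ →L[ℝ] ℝ →L[ℝ] ℝ) hg

theorem integral_mul_pd {d : ℤ} (hd : 1 - (m : ℤ) < d) {f θ : EuclideanSpace ℝ (Fin m) → ℝ}
    (hf : HomSmooth d f) (hθ : IsTest θ) (i : Fin m) :
    ∫ x, pd i f x * θ x ∂(ballVol m) = -∫ x, f x * pd i θ x ∂(ballVol m) :=
  integral_bilin_pd hd (ContinuousLinearMap.lsmul ℝ ℝ : ℝ →L[ℝ] ℝ →L[ℝ] ℝ) hf hθ i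

variable {φ : EuclideanSpace ℝ (Fin m) → F}

/-- The divergence of `r⁻² ⟨φ, ∇φ⟩` has integral zero. -/
theorem integral_inner_lap (hm : 4 ≤ m) (hφ : IsTest φ) :
    ∫ x, ‖x‖ ^ (-2 : ℤ) * ∑ i, ‖pd i φ x‖ ^ 2 ∂(ballVol m)
      + ∫ x, ‖x‖ ^ (-2 : ℤ) * inner ℝ (φ x) (lap φ x) ∂(ballVol m)
      = 2 * ∫ x, ‖x‖ ^ (-4 : ℤ) * ∑ i, x i * inner ℝ (φ x) (pd i φ x) ∂(ballVol m) := by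
  have hc := hφ.continuous
  have hc1 := fun i => (hφ.pd i).continuous
  have hc2 := fun i => ((hφ.pd i).pd i).continuous
  have h1 := HomSmooth.norm_zpow (m := m) (-2)
  have key : ∀ i, ∫ x, (‖x‖ ^ (-2 : ℤ) * ‖pd i φ x‖ ^ 2
      + ‖x‖ ^ (-2 : ℤ) * inner ℝ (φ x) (pd i (pd i φ) x)) ∂(ballVol m)
      = 2 * ∫ x, ‖x‖ ^ (-4 : ℤ) * (x i * inner ℝ (φ x) (pd i φ x)) ∂(ballVol m) := by
    intro i
    have h := integral_mul_pd (by omega) h1 (hφ.inner (hφ.pd i).contDiff) i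
    rw [← neg_eq_iff_eq_neg] at h
    have e1 : ∀ x, pd i (fun x => (inner ℝ (φ x) (pd i φ x) : ℝ)) x
        = ‖pd i φ x‖ ^ 2 + inner ℝ (φ x) (pd i (pd i φ) x) := fun x => by
      rw [pd_inner (hφ.differentiableAt x) ((hφ.pd i).differentiableAt x),
        real_inner_self_eq_norm_sq]
    simp only [e1, mul_add] at h
    rw [← h, ← integral_neg, ← integral_const_mul]
    refine integral_congr_ae ?_
    filter_upwards [ae_ne_zero] with x hx
    rw [pd_norm_zpow _ i hx]
    push_cast
    ring
  have hi1 : ∀ i, Integrable (fun x => ‖x‖ ^ (-2 : ℤ) * ‖pd i φ x‖ ^ 2) (ballVol m) := fun i =>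
    h1.integrable_mul (by omega) ((hc1 i).norm.pow 2)
  have hi2 : ∀ i, Integrable (fun x => ‖x‖ ^ (-2 : ℤ) * inner ℝ (φ x) (pd i (pd i φ) x))
      (ballVol m) := fun i => h1.integrable_mul (by omega) (hc.inner (hc2 i))
  have hi3 : ∀ i, Integrable (fun x => ‖x‖ ^ (-4 : ℤ) * (x i * inner ℝ (φ x) (pd i φ x)))
      (ballVol m) := fun i => by
    have := ((HomSmooth.norm_zpow (-4)).mul (HomSmooth.coord i)).integrable_mul
      (m := m) (by omega) (hc.inner (hc1 i))
    simpa only [mul_assoc] using this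
  simp only [lap, inner_sum, Finset.mul_sum]
  rw [integral_finsetSum _ fun i _ => hi1 i, integral_finsetSum _ fun i _ => hi2 i,
    integral_finsetSum _ fun i _ => hi3 i, ← Finset.sum_add_distrib, Finset.mul_sum]
  refine Finset.sum_congr rfl fun i _ => ?_
  rw [← key i, integral_add (hi1 i) (hi2 i)]

/-- The divergence of `r⁻⁴ |φ|² x` has integral zero. -/
theorem integral_radial (hm : 5 ≤ m) (hφ : IsTest φ) :
    ((m : ℝ) - 4) * ∫ x, ‖x‖ ^ (-4 : ℤ) * ‖φ x‖ ^ 2 ∂(ballVol m)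
      = -2 * ∫ x, ‖x‖ ^ (-4 : ℤ) * ∑ i, x i * inner ℝ (φ x) (pd i φ x) ∂(ballVol m) := by
  have hc := hφ.continuous
  have hc1 := fun i => (hφ.pd i).continuous
  have hT : ∀ i, HomSmooth (m := m) (-4 + 1) (fun x => ‖x‖ ^ (-4 : ℤ) * x i) := fun i =>
    (HomSmooth.norm_zpow (-4)).mul (HomSmooth.coord i)
  have key : ∀ i, ∫ x, pd i (fun x => ‖x‖ ^ (-4 : ℤ) * x i) x * inner ℝ (φ x) (φ x) ∂(ballVol m)
      = -2 * ∫ x, ‖x‖ ^ (-4 : ℤ) * (x i * inner ℝ (φ x) (pd i φ x)) ∂(ballVol m) := by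
    intro i
    rw [integral_mul_pd (by omega) (hT i) (hφ.inner hφ.contDiff) i, neg_mul, neg_inj,
      ← integral_const_mul]
    refine integral_congr_ae (ae_of_all _ fun x => ?_)
    beta_reduce
    rw [pd_inner (hφ.differentiableAt x) (hφ.differentiableAt x),
      real_inner_comm (φ x)]
    ring
  have hi3 : ∀ i, Integrable (fun x => ‖x‖ ^ (-4 : ℤ) * (x i * inner ℝ (φ x) (pd i φ x)))
      (ballVol m) := fun i => by
    have := (hT i).integrable_mul (by omega) (hc.inner (hc1 i))
    simpa only [mul_assoc] using this
  have hi4 : ∀ i, Integrable (fun x => pd i (fun x => ‖x‖ ^ (-4 : ℤ) * x i) x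
      * inner ℝ (φ x) (φ x)) (ballVol m) := fun i =>
    ((hT i).pd i).integrable_mul (by omega) (hc.inner hc)
  simp only [Finset.mul_sum]
  rw [integral_finsetSum _ fun i _ => hi3 i, Finset.mul_sum, ← Finset.sum_congr rfl fun i _ => key i,
    ← integral_finsetSum _ fun i _ => hi4 i, ← integral_const_mul]
  refine integral_congr_ae ?_
  filter_upwards [ae_ne_zero] with x hx
  have hr : ‖x‖ ≠ 0 := norm_ne_zero_iff.2 hx
  have e : ∀ i, pd i (fun x => ‖x‖ ^ (-4 : ℤ) * x i) x
      = -4 * ‖x‖ ^ (-6 : ℤ) * x i ^ 2 + ‖x‖ ^ (-4 : ℤ) := fun i => by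
    rw [pd_mul ((HomSmooth.norm_zpow (-4)).smooth.differentiableAt hx)
      ((HomSmooth.coord i).smooth.differentiableAt hx), pd_norm_zpow _ i hx, pd_coord, if_pos rfl]
    push_cast; ring_nf
  have hz : ‖x‖ ^ (-4 : ℤ) = ‖x‖ ^ (-6 : ℤ) * ‖x‖ ^ 2 := by
    rw [← zpow_natCast, ← zpow_add₀ hr]; norm_num
  rw [← Finset.sum_mul, real_inner_self_eq_norm_sq]
  simp only [e]
  rw [Finset.sum_add_distrib, ← Finset.mul_sum, ← norm_sq_eq_sum]
  simp only [Finset.sum_const, Finset.card_univ, Fintype.card_fin, nsmul_eq_mul]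
  rw [hz]; ring

/-- **Hardy's inequality** with weights, for test maps. It is the non-negativity of
`∫ r⁻² |∇φ + (m - 4) / 2 · r⁻² x φ|²`. -/
theorem hardy_test (hm : 5 ≤ m) (hφ : IsTest φ) :
    ((m : ℝ) - 4) ^ 2 / 4 * ∫ x, ‖x‖ ^ (-4 : ℤ) * ‖φ x‖ ^ 2 ∂(ballVol m)
      ≤ ∫ x, ‖x‖ ^ (-2 : ℤ) * ∑ i, ‖pd i φ x‖ ^ 2 ∂(ballVol m) := by
  have hc := hφ.continuous
  have hc1 := fun i => (hφ.pd i).continuous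
  set k : ℝ := ((m : ℝ) - 4) / 2 with hk
  have ia : Integrable (fun x => ‖x‖ ^ (-2 : ℤ) * ∑ i, ‖pd i φ x‖ ^ 2) (ballVol m) :=
    (HomSmooth.norm_zpow (-2)).integrable_mul (by omega)
      (continuous_finsetSum _ fun i _ => (hc1 i).norm.pow 2)
  have ip : Integrable (fun x => ‖x‖ ^ (-4 : ℤ) * ‖φ x‖ ^ 2) (ballVol m) :=
    (HomSmooth.norm_zpow (-4)).integrable_mul (by omega) (hc.norm.pow 2)
  have iX : Integrable (fun x => ‖x‖ ^ (-4 : ℤ) * ∑ i, x i * inner ℝ (φ x) (pd i φ x))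
      (ballVol m) :=
    (HomSmooth.norm_zpow (-4)).integrable_mul (by omega)
      (continuous_finsetSum _ fun i _ =>
        (EuclideanSpace.proj (𝕜 := ℝ) i).continuous.mul (hc.inner (hc1 i)))
  have h0 : 0 ≤ ∫ x, (‖x‖ ^ (-2 : ℤ) * ∑ i, ‖pd i φ x‖ ^ 2
      + 2 * k * (‖x‖ ^ (-4 : ℤ) * ∑ i, x i * inner ℝ (φ x) (pd i φ x))
      + k ^ 2 * (‖x‖ ^ (-4 : ℤ) * ‖φ x‖ ^ 2)) ∂(ballVol m) := by
    refine integral_nonneg_of_ae ?_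
    filter_upwards [ae_ne_zero] with x hx
    have hr : ‖x‖ ≠ 0 := norm_ne_zero_iff.2 hx
    have h1 : 0 ≤ ‖x‖ ^ (-2 : ℤ) * ∑ i, ‖pd i φ x + (k * ‖x‖ ^ (-2 : ℤ) * x i) • φ x‖ ^ 2 :=
      mul_nonneg (zpow_nonneg (norm_nonneg x) _) (Finset.sum_nonneg fun i _ => sq_nonneg _)
    have e : ∀ i, ‖pd i φ x + (k * ‖x‖ ^ (-2 : ℤ) * x i) • φ x‖ ^ 2 = ‖pd i φ x‖ ^ 2
        + (2 * k * ‖x‖ ^ (-2 : ℤ)) * (x i * inner ℝ (φ x) (pd i φ x))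
        + (k ^ 2 * (‖x‖ ^ (-2 : ℤ)) ^ 2 * ‖φ x‖ ^ 2) * x i ^ 2 := fun i => by
      rw [norm_add_sq_real, norm_smul, real_inner_smul_right, real_inner_comm, mul_pow,
        Real.norm_eq_abs, sq_abs]
      ring
    simp only [e] at h1
    rw [Finset.sum_add_distrib, Finset.sum_add_distrib, ← Finset.mul_sum, ← Finset.mul_sum,
      ← norm_sq_eq_sum] at h1
    have hz2 : ‖x‖ ^ (-2 : ℤ) = (‖x‖ ^ 2)⁻¹ := by rw [zpow_neg]; norm_cast
    have hz4 : ‖x‖ ^ (-4 : ℤ) = (‖x‖ ^ 2)⁻¹ ^ 2 := by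
      rw [zpow_neg, ← inv_pow, ← pow_mul, inv_pow]; norm_cast
    rw [hz2] at h1
    rw [hz2, hz4]
    refine h1.trans (le_of_eq ?_)
    field_simp
  rw [integral_add_const_mul_add_const_mul _ _ ia iX ip] at h0
  have h2 := integral_radial hm hφ
  have h4 : k ^ 2 = ((m : ℝ) - 4) ^ 2 / 4 := by rw [hk]; ring
  rw [← h4]
  rw [show (m : ℝ) - 4 = 2 * k by rw [hk]; ring] at h2
  set X := ∫ x, ‖x‖ ^ (-4 : ℤ) * ∑ i, x i * inner ℝ (φ x) (pd i φ x) ∂(ballVol m)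
  set P := ∫ x, ‖x‖ ^ (-4 : ℤ) * ‖φ x‖ ^ 2 ∂(ballVol m)
  have hX : X = -(k * P) := by linarith
  rw [hX] at h0
  linarith

/-- **Rellich's inequality** with the gradient on the right-hand side, for test maps and in
dimension at least eight. It is the non-negativity of `∫ |Δφ + m (m - 4) / 4 · r⁻² φ|²`, combined
with Hardy's inequality. -/
theorem rellich_test (hm : 8 ≤ m) (hφ : IsTest φ) :
    (m : ℝ) ^ 2 / 4 * ∫ x, ‖x‖ ^ (-2 : ℤ) * ∑ i, ‖pd i φ x‖ ^ 2 ∂(ballVol m)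
      ≤ ∫ x, ‖lap φ x‖ ^ 2 ∂(ballVol m) := by
  have hm' : (8 : ℝ) ≤ m := by exact_mod_cast hm
  have hc := hφ.continuous
  have hcl : Continuous (lap φ) := (contDiff_lap hφ.contDiff).continuous
  set c : ℝ := (m : ℝ) * (m - 4) / 4 with hcdef
  have ip : Integrable (fun x => ‖x‖ ^ (-4 : ℤ) * ‖φ x‖ ^ 2) (ballVol m) :=
    (HomSmooth.norm_zpow (-4)).integrable_mul (by omega) (hc.norm.pow 2)
  have iY : Integrable (fun x => ‖x‖ ^ (-2 : ℤ) * inner ℝ (φ x) (lap φ x)) (ballVol m) :=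
    (HomSmooth.norm_zpow (-2)).integrable_mul (by omega) (hc.inner hcl)
  have iL : Integrable (fun x => ‖lap φ x‖ ^ 2) (ballVol m) := by
    simpa using (HomSmooth.const (m := m) (1 : ℝ)).integrable_mul (by omega) (hcl.norm.pow 2)
  have h0 : 0 ≤ ∫ x, (‖lap φ x‖ ^ 2 + 2 * c * (‖x‖ ^ (-2 : ℤ) * inner ℝ (φ x) (lap φ x))
      + c ^ 2 * (‖x‖ ^ (-4 : ℤ) * ‖φ x‖ ^ 2)) ∂(ballVol m) := by
    refine integral_nonneg fun x => ?_
    have h1 : 0 ≤ ‖lap φ x + (c * ‖x‖ ^ (-2 : ℤ)) • φ x‖ ^ 2 := sq_nonneg _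
    rw [norm_add_sq_real, norm_smul, real_inner_smul_right, real_inner_comm, mul_pow,
      Real.norm_eq_abs, sq_abs] at h1
    have hz4 : ‖x‖ ^ (-4 : ℤ) = (‖x‖ ^ (-2 : ℤ)) ^ 2 := by
      rw [← zpow_natCast, ← zpow_mul]; norm_num
    simp only [Pi.zero_apply, hz4]
    linarith
  rw [integral_add_const_mul_add_const_mul _ _ iL iY ip] at h0
  have h2 := integral_radial (by omega) hφ
  have h3 := integral_inner_lap (by omega) hφ
  have h4 := hardy_test (by omega) hφ
  set A := ∫ x, ‖x‖ ^ (-2 : ℤ) * ∑ i, ‖pd i φ x‖ ^ 2 ∂(ballVol m)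
  set P := ∫ x, ‖x‖ ^ (-4 : ℤ) * ‖φ x‖ ^ 2 ∂(ballVol m)
  set Y := ∫ x, ‖x‖ ^ (-2 : ℤ) * inner ℝ (φ x) (lap φ x) ∂(ballVol m)
  set L := ∫ x, ‖lap φ x‖ ^ 2 ∂(ballVol m)
  have hY : Y = -A - (m - 4) * P := by linarith
  rw [hY] at h0
  -- what is left over is a multiple of the deficit in Hardy's inequality, non-negative for `8 ≤ m`
  have h5 : 0 ≤ (m : ℝ) * (m - 8) / 4 * (A - (m - 4) ^ 2 / 4 * P) :=
    mul_nonneg (by apply div_nonneg (mul_nonneg _ _) <;> linarith) (by linarith)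
  have h6 : L - (m : ℝ) ^ 2 / 4 * A = (L + 2 * c * (-A - (m - 4) * P) + c ^ 2 * P)
      + (m : ℝ) * (m - 8) / 4 * (A - (m - 4) ^ 2 / 4 * P) := by
    rw [hcdef]; ring
  linarith

/-- The coercivity of `∫ |Δφ|² - κ ∫ r⁻² |∇φ|²` on test maps, for `κ` below the constant `m² / 4`
of Rellich's inequality. -/
theorem coercive_test (hm : 8 ≤ m) (hφ : IsTest φ) {κ : ℝ} (hκ : κ ≤ (m : ℝ) ^ 2 / 4) :
    κ * ∫ x, ‖x‖ ^ (-2 : ℤ) * ∑ i, ‖pd i φ x‖ ^ 2 ∂(ballVol m)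
      + ((m : ℝ) ^ 2 / 4 - κ) * ∫ x, ‖φ x‖ ^ 2 ∂(ballVol m)
      ≤ ∫ x, ‖lap φ x‖ ^ 2 ∂(ballVol m) := by
  have hm' : (8 : ℝ) ≤ m := by exact_mod_cast hm
  have h1 := rellich_test hm hφ
  have h2 := hardy_test (by omega) hφ
  have hc := hφ.continuous
  have h3 : ∫ x, ‖φ x‖ ^ 2 ∂(ballVol m) ≤ ∫ x, ‖x‖ ^ (-4 : ℤ) * ‖φ x‖ ^ 2 ∂(ballVol m) := by
    refine integral_mono_ae ?_ ((HomSmooth.norm_zpow (-4)).integrable_mul (by omega)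
      (hc.norm.pow 2)) ?_
    · simpa using (HomSmooth.const (m := m) (1 : ℝ)).integrable_mul (by omega) (hc.norm.pow 2)
    · filter_upwards [ae_ne_zero, ae_mem_ball] with x hx hx1
      refine le_mul_of_one_le_left (sq_nonneg _) ?_
      exact one_le_zpow_of_nonpos₀ (norm_pos_iff.2 hx) hx1.le (by norm_num)
  have h4 : 0 ≤ ∫ x, ‖φ x‖ ^ 2 ∂(ballVol m) := integral_nonneg fun x => sq_nonneg _
  set A := ∫ x, ‖x‖ ^ (-2 : ℤ) * ∑ i, ‖pd i φ x‖ ^ 2 ∂(ballVol m)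
  set P := ∫ x, ‖x‖ ^ (-4 : ℤ) * ‖φ x‖ ^ 2 ∂(ballVol m)
  set N := ∫ x, ‖φ x‖ ^ 2 ∂(ballVol m)
  have h6 : 1 ≤ ((m : ℝ) - 4) ^ 2 / 4 := by nlinarith
  have h5 : N ≤ A := by nlinarith
  nlinarith

end HardyRellich

/-! ### Biharmonic maps of constant latitude over an eigenmap -/

section Cone

variable {m : ℕ} {F : Type*} [NormedAddCommGroup F] [InnerProductSpace ℝ F]

/-- The data of a map `q = h + e` to the unit sphere, with `h` an eigenmap into a sphere of squared
radius `s` and `e` a constant vector orthogonal to its values, whose radius satisfies the algebraic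
condition `2 λ s = λ + 2 m - 8` for `q` to be biharmonic. -/
structure BiharmonicCone (lam s : ℝ) (h : EuclideanSpace ℝ (Fin m) → F) (e : F) : Prop where
  eigen : EigenMap lam s h
  orth : ∀ x, x ≠ 0 → inner ℝ (h x) e = 0
  norm_e : ‖e‖ ^ 2 = 1 - s
  balance : 2 * lam * s = lam + 2 * m - 8

theorem zpow_neg_two (r : ℝ) : r ^ (-2 : ℤ) = (r ^ 2)⁻¹ := by
  rw [zpow_neg]; norm_cast

theorem zpow_neg_four (r : ℝ) : r ^ (-4 : ℤ) = (r ^ (-2 : ℤ)) ^ 2 := by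
  rw [← zpow_natCast, ← zpow_mul]; norm_num

theorem integral_inner_pd [NeZero m] {d : ℤ} (hd : 1 - (m : ℤ) < d)
    {f φ : EuclideanSpace ℝ (Fin m) → F} (hf : HomSmooth d f) (hφ : IsTest φ) (i : Fin m) :
    ∫ x, inner ℝ (pd i f x) (φ x) ∂(ballVol m)
      = -∫ x, inner ℝ (f x) (pd i φ x) ∂(ballVol m) :=
  integral_bilin_pd hd (innerSL ℝ : F →L[ℝ] F →L[ℝ] ℝ) hf hφ i

theorem HomSmooth.integrable_inner [NeZero m] {d : ℤ} (hd : -(m : ℤ) < d)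
    {f g : EuclideanSpace ℝ (Fin m) → F} (hf : HomSmooth d f) (hg : Continuous g) :
    Integrable (fun x => (inner ℝ (f x) (g x) : ℝ)) (ballVol m) :=
  hf.integrable_bilin hd (innerSL ℝ : F →L[ℝ] F →L[ℝ] ℝ) hg

/-- Green's second formula for a homogeneous map and a test map. -/
theorem integral_inner_lap_right [NeZero m] {d : ℤ} (hd : 2 - (m : ℤ) < d)
    {f φ : EuclideanSpace ℝ (Fin m) → F} (hf : HomSmooth d f) (hφ : IsTest φ) :
    ∫ x, inner ℝ (f x) (lap φ x) ∂(ballVol m) = ∫ x, inner ℝ (lap f x) (φ x) ∂(ballVol m) := by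
  simp only [lap, inner_sum, sum_inner]
  rw [integral_finsetSum _ fun i _ => hf.integrable_inner (by omega) ((hφ.pd i).pd i).continuous,
    integral_finsetSum _ fun i _ => ((hf.pd i).pd i).integrable_inner (by omega) hφ.continuous]
  refine Finset.sum_congr rfl fun i _ => ?_
  rw [integral_inner_pd (by omega) (hf.pd i) hφ, integral_inner_pd (by omega) hf (hφ.pd i), neg_neg]

namespace BiharmonicCone

variable {lam s : ℝ} {h : EuclideanSpace ℝ (Fin m) → F} {e : F}

section

variable (H : BiharmonicCone lam s h e)
include H

theorem hom : HomSmooth 0 (fun x => h x + e) := H.eigen.hom.add (HomSmooth.const e)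

theorem inner_left {x : EuclideanSpace ℝ (Fin m)} (hx : x ≠ 0) : inner ℝ (h x) (h x + e) = s := by
  rw [inner_add_right, H.orth x hx, real_inner_self_eq_norm_sq, H.eigen.norm_sq x hx, add_zero]

theorem norm_eq_one {x : EuclideanSpace ℝ (Fin m)} (hx : x ≠ 0) : ‖h x + e‖ = 1 := by
  have : ‖h x + e‖ ^ 2 = 1 := by
    rw [norm_add_sq_real, H.orth x hx, H.norm_e, H.eigen.norm_sq x hx]; ring
  nlinarith [norm_nonneg (h x + e)]

theorem pd_eq {x : EuclideanSpace ℝ (Fin m)} (hx : x ≠ 0) (i : Fin m) :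
    pd i (fun x => h x + e) x = pd i h x := by
  rw [pd_add (H.eigen.hom.smooth.differentiableAt hx) (differentiableAt_const e), pd_const,
    add_zero]

theorem lap_eq {x : EuclideanSpace ℝ (Fin m)} (hx : x ≠ 0) :
    lap (fun x => h x + e) x = (-(lam * ‖x‖ ^ (-2 : ℤ))) • h x := by
  rw [← H.eigen.lap_eq x hx]
  exact Finset.sum_congr rfl fun i _ => pd_congr_off (fun y hy => H.pd_eq hy i) i hx

variable [NeZero m] {φ : EuclideanSpace ℝ (Fin m) → F}

theorem integral_inner_h_lap (hm : 5 ≤ m) (hφ : IsTest φ) :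
    ∫ x, ‖x‖ ^ (-2 : ℤ) * inner ℝ (h x) (lap φ x) ∂(ballVol m)
      = -(2 * m - 8 + lam) * ∫ x, ‖x‖ ^ (-4 : ℤ) * inner ℝ (h x) (φ x) ∂(ballVol m) := by
  have h1 := integral_inner_lap_right (by omega) ((HomSmooth.norm_zpow (-2)).smul H.eigen.hom) hφ
  simp only [real_inner_smul_left] at h1
  rw [h1, ← integral_const_mul]
  refine integral_congr_ae ?_
  filter_upwards [ae_ne_zero] with x hx
  rw [H.eigen.hom.lap_norm_zpow_smul (-2) hx, H.eigen.lap_eq x hx, smul_smul, ← add_smul,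
    real_inner_smul_left, show (-2 : ℤ) - 2 = -4 by norm_num, zpow_neg_four]
  push_cast; ring

theorem integral_inner_pd_pd (hm : 5 ≤ m) (hφ : IsTest φ) :
    ∫ x, ‖x‖ ^ (-2 : ℤ) * ∑ i, inner ℝ (pd i h x) (pd i φ x) ∂(ballVol m)
      = lam * ∫ x, ‖x‖ ^ (-4 : ℤ) * inner ℝ (h x) (φ x) ∂(ballVol m) := by
  have hw : ∀ i, HomSmooth (-2 + (0 - 1)) (fun x => ‖x‖ ^ (-2 : ℤ) • pd i h x) := fun i =>
    (HomSmooth.norm_zpow (-2)).smul (H.eigen.hom.pd i)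
  simp only [Finset.mul_sum, ← real_inner_smul_left]
  rw [integral_finsetSum _ fun i _ => (hw i).integrable_inner (by omega) (hφ.pd i).continuous,
    Finset.sum_congr rfl fun i _ => eq_neg_of_add_eq_zero_right
      (add_eq_zero_iff_eq_neg.2 (integral_inner_pd (by omega) (hw i) hφ i)), Finset.sum_neg_distrib,
    ← integral_finsetSum _ fun i _ => ((hw i).pd i).integrable_inner (by omega) hφ.continuous,
    ← integral_neg, ← integral_const_mul]
  refine integral_congr_ae ?_
  filter_upwards [ae_ne_zero] with x hx
  have e1 : ∑ i, pd i (fun x => ‖x‖ ^ (-2 : ℤ) • pd i h x) x = (-(lam * ‖x‖ ^ (-4 : ℤ))) • h x := by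
    have e2 : ∀ i, pd i (fun x => ‖x‖ ^ (-2 : ℤ) • pd i h x) x
        = (-2 * ‖x‖ ^ (-4 : ℤ)) • (x i • pd i h x) + ‖x‖ ^ (-2 : ℤ) • pd i (pd i h) x := fun i => by
      rw [pd_smul ((HomSmooth.norm_zpow (-2)).smooth.differentiableAt hx)
        ((H.eigen.hom.pd i).smooth.differentiableAt hx), pd_norm_zpow _ i hx, smul_smul]
      push_cast; rfl
    simp only [e2]
    rw [Finset.sum_add_distrib, ← Finset.smul_sum, H.eigen.hom.euler hx, ← Finset.smul_sum,
      Int.cast_zero, zero_smul, smul_zero, zero_add]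
    change ‖x‖ ^ (-2 : ℤ) • lap h x = _
    rw [H.eigen.lap_eq x hx, zpow_neg_four, smul_smul]
    congr 1; ring
  rw [← sum_inner, e1, real_inner_smul_left, real_inner_smul_left]
  ring

theorem integral_inner_q_lap (hm : 5 ≤ m) (hφ : IsTest φ) :
    ∫ x, ‖x‖ ^ (-2 : ℤ) * inner ℝ (h x + e) (lap φ x) ∂(ballVol m)
      = -(2 * m - 8) * ∫ x, ‖x‖ ^ (-4 : ℤ) * inner ℝ (h x + e) (φ x) ∂(ballVol m)
        - lam * ∫ x, ‖x‖ ^ (-4 : ℤ) * inner ℝ (h x) (φ x) ∂(ballVol m) := by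
  have h1 := integral_inner_lap_right (by omega) ((HomSmooth.norm_zpow (-2)).smul H.hom) hφ
  have i1 : Integrable (fun x => ‖x‖ ^ (-4 : ℤ) * inner ℝ (h x + e) (φ x)) (ballVol m) := by
    simpa only [real_inner_smul_left] using
      ((HomSmooth.norm_zpow (-4)).smul H.hom).integrable_inner (by omega) hφ.continuous
  have i2 : Integrable (fun x => ‖x‖ ^ (-4 : ℤ) * inner ℝ (h x) (φ x)) (ballVol m) := by
    simpa only [real_inner_smul_left] using
      ((HomSmooth.norm_zpow (-4)).smul H.eigen.hom).integrable_inner (by omega) hφ.continuous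
  simp only [real_inner_smul_left] at h1
  rw [h1, ← integral_const_mul, ← integral_const_mul,
    ← integral_sub (i1.const_mul _) (i2.const_mul _)]
  refine integral_congr_ae ?_
  filter_upwards [ae_ne_zero] with x hx
  rw [H.hom.lap_norm_zpow_smul (-2) hx, H.lap_eq hx, smul_smul, inner_add_left,
    real_inner_smul_left, real_inner_smul_left, show (-2 : ℤ) - 2 = -4 by norm_num, zpow_neg_four]
  push_cast; ring

/-- The linear part of the biharmonic map equation, `Δ² q + 2 div (|dq|² dq) = 0`, tested
against `φ`. -/
theorem integral_linear (hm : 5 ≤ m) (hφ : IsTest φ) :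
    Integrable (fun x => inner ℝ ((-(lam * ‖x‖ ^ (-2 : ℤ))) • h x) (lap φ x)
      - 2 * (lam * s * ‖x‖ ^ (-2 : ℤ)) * ∑ i, inner ℝ (pd i h x) (pd i φ x)) (ballVol m) ∧
    ∫ x, (inner ℝ ((-(lam * ‖x‖ ^ (-2 : ℤ))) • h x) (lap φ x)
      - 2 * (lam * s * ‖x‖ ^ (-2 : ℤ)) * ∑ i, inner ℝ (pd i h x) (pd i φ x)) ∂(ballVol m) = 0 := by
  have i1 : Integrable (fun x => ‖x‖ ^ (-2 : ℤ) * inner ℝ (h x) (lap φ x)) (ballVol m) := by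
    simpa only [real_inner_smul_left] using
      ((HomSmooth.norm_zpow (-2)).smul H.eigen.hom).integrable_inner (by omega)
        (contDiff_lap hφ.contDiff).continuous
  have i2 : Integrable (fun x => ‖x‖ ^ (-2 : ℤ) * ∑ i, inner ℝ (pd i h x) (pd i φ x))
      (ballVol m) := by
    simp only [Finset.mul_sum, ← real_inner_smul_left]
    exact integrable_finsetSum _ fun i _ => ((HomSmooth.norm_zpow (-2)).smul
      (H.eigen.hom.pd i)).integrable_inner (by omega) (hφ.pd i).continuous
  have e1 : ∀ x, inner ℝ ((-(lam * ‖x‖ ^ (-2 : ℤ))) • h x) (lap φ x)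
      - 2 * (lam * s * ‖x‖ ^ (-2 : ℤ)) * ∑ i, inner ℝ (pd i h x) (pd i φ x)
      = (-lam) * (‖x‖ ^ (-2 : ℤ) * inner ℝ (h x) (lap φ x))
        + (-(2 * lam * s)) * (‖x‖ ^ (-2 : ℤ) * ∑ i, inner ℝ (pd i h x) (pd i φ x)) := fun x => by
    rw [real_inner_smul_left]; ring
  simp only [e1]
  refine ⟨(i1.const_mul _).add (i2.const_mul _), ?_⟩
  rw [integral_add (i1.const_mul _) (i2.const_mul _), integral_const_mul, integral_const_mul,
    H.integral_inner_h_lap hm hφ, H.integral_inner_pd_pd hm hφ, H.balance]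
  ring

/-- The normal part of the biharmonic map equation, `(⟨Δ² q, q⟩ - 2 |dq|⁴) q`, vanishes against `φ`,
with `⟨Δ² q, q⟩` in the weak form `⟨Δq, Δ(⟨q, φ⟩ q)⟩`. -/
theorem integral_normal (hm : 5 ≤ m) (hφ : IsTest φ) :
    Integrable (fun x => -inner ℝ ((-(lam * ‖x‖ ^ (-2 : ℤ))) • h x)
        (lap (fun y => (inner ℝ (h y + e) (φ y) : ℝ) • (h y + e)) x)
      + 2 * (lam * s * ‖x‖ ^ (-2 : ℤ)) ^ 2 * inner ℝ (h x + e) (φ x)) (ballVol m) ∧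
    ∫ x, (-inner ℝ ((-(lam * ‖x‖ ^ (-2 : ℤ))) • h x)
        (lap (fun y => (inner ℝ (h y + e) (φ y) : ℝ) • (h y + e)) x)
      + 2 * (lam * s * ‖x‖ ^ (-2 : ℤ)) ^ 2 * inner ℝ (h x + e) (φ x)) ∂(ballVol m) = 0 := by
  have i2 : Integrable (fun x => ‖x‖ ^ (-2 : ℤ) * ∑ i, inner ℝ (pd i h x) (pd i φ x))
      (ballVol m) := by
    simp only [Finset.mul_sum, ← real_inner_smul_left]
    exact integrable_finsetSum _ fun i _ => ((HomSmooth.norm_zpow (-2)).smul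
      (H.eigen.hom.pd i)).integrable_inner (by omega) (hφ.pd i).continuous
  have i3 : Integrable (fun x => ‖x‖ ^ (-2 : ℤ) * inner ℝ (h x + e) (lap φ x)) (ballVol m) := by
    simpa only [real_inner_smul_left] using
      ((HomSmooth.norm_zpow (-2)).smul H.hom).integrable_inner (by omega)
        (contDiff_lap hφ.contDiff).continuous
  have i4 : Integrable (fun x => ‖x‖ ^ (-4 : ℤ) * inner ℝ (h x) (φ x)) (ballVol m) := by
    simpa only [real_inner_smul_left] using
      ((HomSmooth.norm_zpow (-4)).smul H.eigen.hom).integrable_inner (by omega) hφ.continuous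
  have i5 : Integrable (fun x => ‖x‖ ^ (-4 : ℤ) * inner ℝ (h x + e) (φ x)) (ballVol m) := by
    simpa only [real_inner_smul_left] using
      ((HomSmooth.norm_zpow (-4)).smul H.hom).integrable_inner (by omega) hφ.continuous
  have hcongr : (fun x => -inner ℝ ((-(lam * ‖x‖ ^ (-2 : ℤ))) • h x)
        (lap (fun y => (inner ℝ (h y + e) (φ y) : ℝ) • (h y + e)) x)
      + 2 * (lam * s * ‖x‖ ^ (-2 : ℤ)) ^ 2 * inner ℝ (h x + e) (φ x))
      =ᵐ[ballVol m] fun x => ((-(lam ^ 2 * s) * (‖x‖ ^ (-4 : ℤ) * inner ℝ (h x) (φ x))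
          + (lam * s * (2 * lam * s - lam)) * (‖x‖ ^ (-4 : ℤ) * inner ℝ (h x + e) (φ x)))
        + (2 * lam * s) * (‖x‖ ^ (-2 : ℤ) * ∑ i, inner ℝ (pd i h x) (pd i φ x))
        + (lam * s) * (‖x‖ ^ (-2 : ℤ) * inner ℝ (h x + e) (lap φ x))) := by
    filter_upwards [ae_ne_zero] with x hx
    have hφs : SmoothOff φ := .of_contDiff hφ.contDiff
    have ha : SmoothOff (fun y => (inner ℝ (h y + e) (φ y) : ℝ)) :=
      H.hom.smooth.bilin (innerSL ℝ : F →L[ℝ] F →L[ℝ] ℝ) hφs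
    have hin : inner ℝ (h x) (h x) = s := by
      rw [real_inner_self_eq_norm_sq, H.eigen.norm_sq x hx]
    rw [lap_smul hx ha H.hom.smooth, lap_inner hx H.hom.smooth hφs, H.lap_eq hx]
    simp only [H.pd_eq hx]
    rw [real_inner_smul_left, inner_add_right, inner_add_right, real_inner_smul_right,
      H.inner_left hx, real_inner_smul_right, inner_sum]
    simp only [real_inner_smul_right, H.eigen.inner_pd hx, mul_zero, Finset.sum_const_zero, hin,
      real_inner_smul_left]
    rw [zpow_neg_four]
    ring
  have i45 : Integrable (fun x => -(lam ^ 2 * s) * (‖x‖ ^ (-4 : ℤ) * inner ℝ (h x) (φ x))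
      + (lam * s * (2 * lam * s - lam)) * (‖x‖ ^ (-4 : ℤ) * inner ℝ (h x + e) (φ x)))
      (ballVol m) := (i4.const_mul _).add (i5.const_mul _)
  refine ⟨((i45.add (i2.const_mul _)).add (i3.const_mul _)).congr hcongr.symm, ?_⟩
  rw [integral_congr_ae hcongr, integral_add_const_mul_add_const_mul _ _ i45 i2 i3,
    integral_add (i4.const_mul _) (i5.const_mul _), integral_const_mul, integral_const_mul,
    H.integral_inner_pd_pd hm hφ, H.integral_inner_q_lap hm hφ]
  linear_combination (lam * s * ∫ x, ‖x‖ ^ (-4 : ℤ) * inner ℝ (h x + e) (φ x) ∂(ballVol m))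
    * H.balance

variable [CompleteSpace F]

theorem wPartial_ae_eq (hm : 5 ≤ m) (i : Fin m) :
    wPartial i (fun x => h x + e) =ᵐ[ballVol m] pd i h := by
  filter_upwards [H.hom.wPartial_ae_eq (by omega) i, ae_ne_zero] with x hx hx0
  rw [hx, H.pd_eq hx0]

theorem wLaplacian_ae_eq (hm : 5 ≤ m) : wLaplacian (fun x => h x + e)
    =ᵐ[ballVol m] fun x => (-(lam * ‖x‖ ^ (-2 : ℤ))) • h x := by
  filter_upwards [H.hom.wLaplacian_ae_eq (by omega), ae_ne_zero] with x hx hx0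
  rw [hx, H.lap_eq hx0]

theorem gradSq_ae_eq (hm : 5 ≤ m) : gradSq (fun x => h x + e)
    =ᵐ[ballVol m] fun x => lam * s * ‖x‖ ^ (-2 : ℤ) := by
  have h1 : ∀ᵐ x ∂(ballVol m), ∀ i, wPartial i (fun x => h x + e) x = pd i h x :=
    ae_all_iff.2 fun i => H.wPartial_ae_eq hm i
  filter_upwards [h1, ae_ne_zero] with x hx hx0
  simp only [gradSq, hx]
  exact H.eigen.sum_norm_pd_sq hx0

theorem memW22Sphere (hm : 5 ≤ m) : MemW22Sphere (fun x => h x + e) := by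
  refine ⟨H.hom.memW22 (by omega) (by omega), ?_⟩
  filter_upwards [ae_ne_zero] with x hx
  simpa using H.norm_eq_one hx

theorem wLaplacian_normal_ae_eq (hm : 5 ≤ m) (hφ : IsTest φ) :
    wLaplacian (fun y => (inner ℝ (h y + e) (φ y) : ℝ) • (h y + e))
      =ᵐ[ballVol m] lap (fun y => (inner ℝ (h y + e) (φ y) : ℝ) • (h y + e)) :=
  -- the map is the smooth operator field `v ↦ ⟨q, v⟩ q`, homogeneous of degree zero, applied to `φ`
  wLaplacian_bilin (T := fun y => ((innerSL ℝ : F →L[ℝ] F →L[ℝ] ℝ) (h y + e)).smulRight (h y + e))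
    (d := 0 + 0) (by omega) (ContinuousLinearMap.id ℝ (F →L[ℝ] F))
    ((H.hom.clm (innerSL ℝ : F →L[ℝ] F →L[ℝ] ℝ)).bilin (ContinuousLinearMap.smulRightL ℝ F F) H.hom)
    hφ.contDiff

theorem isWeakBiharmonic (hm : 5 ≤ m) : IsWeakBiharmonic (fun x => h x + e) := by
  refine ⟨H.memW22Sphere hm, fun φ hφ => ?_⟩
  have h1 : ∀ᵐ x ∂(ballVol m), ∀ i, wPartial i (fun x => h x + e) x = pd i h x :=
    ae_all_iff.2 fun i => H.wPartial_ae_eq hm i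
  obtain ⟨iA, hA⟩ := H.integral_linear hm hφ
  obtain ⟨iB, hB⟩ := H.integral_normal hm hφ
  have hAB := integral_add iA iB
  rw [hA, hB, add_zero] at hAB
  rw [← hAB]
  refine integral_congr_ae ?_
  filter_upwards [h1, H.wLaplacian_ae_eq hm, H.gradSq_ae_eq hm, H.wLaplacian_normal_ae_eq hm hφ]
    with x e1 e2 e3 e4
  rw [e2, e3, e4, laplacian_eq_lap hφ.contDiff]
  simp only [e1]
  change _ - 2 * _ * ∑ i, inner ℝ (pd i h x) (pd i φ x) - _ + _ = _
  ring

theorem not_tension_ae_eq_zero (hm : 5 ≤ m) (hlam : lam ≠ 0) (hs : s ≠ 0) (hs1 : s ≠ 1) :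
    ¬ ∀ᵐ x ∂(ballVol m), tension (fun x => h x + e) x = 0 := by
  intro h0
  have hne : NeBot (ae (ballVol m)) := by
    rw [ae_neBot]
    intro hz
    have h1 : volume (Metric.ball (0 : EuclideanSpace ℝ (Fin m)) 1) = 0 := by
      rw [← Measure.restrict_apply_univ]
      exact congrArg (fun μ : Measure (EuclideanSpace ℝ (Fin m)) => μ Set.univ) hz
    exact (Metric.measure_ball_pos volume _ one_pos).ne' h1
  obtain ⟨x, hx, hx0, e2, e3⟩ :=
    (h0.and (ae_ne_zero.and ((H.wLaplacian_ae_eq hm).and (H.gradSq_ae_eq hm)))).exists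
  -- the component of the tension field in the direction of `e` does not vanish
  have h1 : inner ℝ (tension (fun x => h x + e) x) e = lam * s * ‖x‖ ^ (-2 : ℤ) * (1 - s) := by
    rw [tension, e2, e3, inner_add_left, real_inner_smul_left, real_inner_smul_left,
      inner_add_left, H.orth x hx0, real_inner_self_eq_norm_sq, H.norm_e]
    ring
  rw [hx, inner_zero_left] at h1
  have h2 : ‖x‖ ^ (-2 : ℤ) ≠ 0 := zpow_ne_zero _ (norm_ne_zero_iff.2 hx0)
  have h3 : lam * s * ‖x‖ ^ (-2 : ℤ) * (1 - s) ≠ 0 :=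
    mul_ne_zero (mul_ne_zero (mul_ne_zero hlam hs) h2) (sub_ne_zero.2 hs1.symm)
  exact h3 h1.symm

end

end BiharmonicCone
end Cone

/-! ### Twice differentiable curves -/

section Curves

variable {E E₁ E₂ E₃ : Type*} [NormedAddCommGroup E] [NormedSpace ℝ E]
  [NormedAddCommGroup E₁] [NormedSpace ℝ E₁] [NormedAddCommGroup E₂] [NormedSpace ℝ E₂]
  [NormedAddCommGroup E₃] [NormedSpace ℝ E₃]

theorem eventually_hasDerivAt {c : ℝ → E} {a : ℝ} (hc : ContDiffAt ℝ 2 c a) :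
    ∀ᶠ t in 𝓝 a, HasDerivAt c (deriv c t) t := by
  filter_upwards [hc.eventually (by simp)] with t ht
  exact (ht.differentiableAt (by simp)).hasDerivAt

theorem hasDerivAt_deriv {c : ℝ → E} {a : ℝ} (hc : ContDiffAt ℝ 2 c a) :
    HasDerivAt (deriv c) (deriv (deriv c) a) a := by
  have h1 : ContDiffAt ℝ 1 (fun t => fderiv ℝ c t 1) a :=
    (hc.fderiv_right (m := 1) (by norm_num)).clm_apply contDiffAt_const
  have h2 : (fun t => fderiv ℝ c t 1) = deriv c := funext fun t => fderiv_apply_one_eq_deriv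
  rw [h2] at h1
  exact (h1.differentiableAt (by simp)).hasDerivAt

theorem hasDerivAt_mem_of_sub_mem {S : Submodule ℝ E} (hS : IsClosed (S : Set E)) {c : ℝ → E}
    {c' : E} {a : ℝ} (hc : HasDerivAt c c' a) (h : ∀ᶠ t in 𝓝 a, c t - c a ∈ S) : c' ∈ S := by
  refine hS.mem_of_tendsto (hasDerivAt_iff_tendsto_slope.1 hc) ?_
  filter_upwards [h.filter_mono nhdsWithin_le_nhds] with t ht
  exact S.smul_mem _ ht

/-- A twice differentiable curve whose increments lie in a closed subspace has its first two
derivatives in that subspace. -/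
theorem deriv_mem_of_sub_mem {S : Submodule ℝ E} (hS : IsClosed (S : Set E)) {c : ℝ → E}
    {a : ℝ} (hc : ContDiffAt ℝ 2 c a) (h : ∀ᶠ t in 𝓝 a, c t - c a ∈ S) :
    deriv c a ∈ S ∧ deriv (deriv c) a ∈ S := by
  have h1 : ∀ᶠ t in 𝓝 a, deriv c t ∈ S := by
    filter_upwards [eventually_hasDerivAt hc, h.eventually_nhds, h] with t ht h' h''
    refine hasDerivAt_mem_of_sub_mem hS ht ?_
    filter_upwards [h'] with r hr
    have := S.sub_mem hr h''
    rwa [sub_sub_sub_cancel_right] at this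
  refine ⟨h1.self_of_nhds, hasDerivAt_mem_of_sub_mem hS (hasDerivAt_deriv hc) ?_⟩
  filter_upwards [h1] with t ht using S.sub_mem ht h1.self_of_nhds

theorem deriv_bilin (B : E₁ →L[ℝ] E₂ →L[ℝ] E₃) {f : ℝ → E₁} {g : ℝ → E₂} {a : ℝ}
    (hf : ContDiffAt ℝ 2 f a) (hg : ContDiffAt ℝ 2 g a) :
    deriv (fun t => B (f t) (g t)) a = B (deriv f a) (g a) + B (f a) (deriv g a)
      ∧ deriv (deriv (fun t => B (f t) (g t))) a
        = B (deriv (deriv f) a) (g a) + (2 : ℝ) • B (deriv f a) (deriv g a)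
          + B (f a) (deriv (deriv g) a) := by
  have key : ∀ {f' : E₁} {g' : E₂} {t : ℝ} {f : ℝ → E₁} {g : ℝ → E₂}, HasDerivAt f f' t →
      HasDerivAt g g' t → HasDerivAt (fun t => B (f t) (g t)) (B f' (g t) + B (f t) g') t :=
    fun hf hg => (B.hasFDerivAt.comp_hasDerivAt _ hf).clm_apply hg
  have h1 : deriv (fun t => B (f t) (g t)) =ᶠ[𝓝 a]
      fun t => B (deriv f t) (g t) + B (f t) (deriv g t) := by
    filter_upwards [eventually_hasDerivAt hf, eventually_hasDerivAt hg] with t h1 h2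
    exact (key h1 h2).deriv
  refine ⟨h1.self_of_nhds, ?_⟩
  rw [h1.deriv_eq]
  have hf1 := (eventually_hasDerivAt hf).self_of_nhds
  have hg1 := (eventually_hasDerivAt hg).self_of_nhds
  rw [((key (hasDerivAt_deriv hf) hg1).fun_add (key hf1 (hasDerivAt_deriv hg))).deriv, two_smul]
  abel

theorem contDiffAt_bilin (B : E₁ →L[ℝ] E₂ →L[ℝ] E₃) {f : ℝ → E₁} {g : ℝ → E₂} {a : ℝ}
    (hf : ContDiffAt ℝ 2 f a) (hg : ContDiffAt ℝ 2 g a) :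
    ContDiffAt ℝ 2 (fun t => B (f t) (g t)) a :=
  (B.contDiff.contDiffAt.comp a hf).clm_apply hg

theorem deriv_deriv_sum {ι : Type*} {s : Finset ι} {f : ι → ℝ → E} {a : ℝ}
    (hf : ∀ i ∈ s, ContDiffAt ℝ 2 (f i) a) :
    deriv (fun t => ∑ i ∈ s, f i t) a = ∑ i ∈ s, deriv (f i) a
      ∧ deriv (deriv (fun t => ∑ i ∈ s, f i t)) a = ∑ i ∈ s, deriv (deriv (f i)) a := by
  have h1 : deriv (fun t => ∑ i ∈ s, f i t) =ᶠ[𝓝 a] fun t => ∑ i ∈ s, deriv (f i) t := by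
    filter_upwards [(eventually_all_finset s).2 fun i hi => eventually_hasDerivAt (hf i hi)]
      with t ht
    exact (HasDerivAt.fun_sum fun i hi => ht i hi).deriv
  refine ⟨h1.self_of_nhds, ?_⟩
  rw [h1.deriv_eq]
  exact (HasDerivAt.fun_sum fun i hi => hasDerivAt_deriv (hf i hi)).deriv

end Curves

/-! ### The closure of the test maps -/

section SobolevZero

variable {m : ℕ} {F : Type*} [NormedAddCommGroup F] [InnerProductSpace ℝ F]

theorem memLp_of_continuous {E : Type*} [NormedAddCommGroup E]
    {g : EuclideanSpace ℝ (Fin m) → E} (hg : Continuous g) (p : ℝ≥0∞) :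
    MemLp g p (ballVol m) := by
  obtain ⟨C, _, hC⟩ := exists_bound_on_ball hg
  refine MemLp.of_bound hg.aestronglyMeasurable C ?_
  filter_upwards [ae_mem_ball] with x hx using hC x hx

theorem IsTest.zero : IsTest (0 : EuclideanSpace ℝ (Fin m) → F) := by
  refine ⟨contDiff_const, HasCompactSupport.zero, ?_⟩
  have : tsupport (0 : EuclideanSpace ℝ (Fin m) → F) = ∅ := by simp [tsupport]
  rw [this]; exact Set.empty_subset _

theorem IsTest.add {φ ψ : EuclideanSpace ℝ (Fin m) → F} (hφ : IsTest φ) (hψ : IsTest ψ) :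
    IsTest (fun x => φ x + ψ x) :=
  ⟨hφ.1.add hψ.1, hφ.2.1.add hψ.2.1,
    (tsupport_add φ ψ).trans (Set.union_subset hφ.2.2 hψ.2.2)⟩

theorem IsTest.const_smul {φ : EuclideanSpace ℝ (Fin m) → F} (hφ : IsTest φ) (c : ℝ) :
    IsTest (fun x => c • φ x) :=
  hφ.bilin_left (ContinuousLinearMap.lsmul ℝ ℝ : ℝ →L[ℝ] F →L[ℝ] F).flip contDiff_const

/-- The space `L² × (L²)^m × L²` for the triples `(w, ∇w, Δw)`. -/
abbrev JetSpace (m : ℕ) (F : Type*) [NormedAddCommGroup F] [InnerProductSpace ℝ F] : Type _ :=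
  Lp F 2 (ballVol m) × (Fin m → Lp F 2 (ballVol m)) × Lp F 2 (ballVol m)

/-- The triples `(φ, ∇φ, Δφ)` of the test maps `φ`. -/
def testJets (m : ℕ) (F : Type*) [NormedAddCommGroup F] [InnerProductSpace ℝ F] :
    Submodule ℝ (JetSpace m F) where
  carrier := {p | ∃ φ, IsTest φ ∧ p.1 =ᵐ[ballVol m] φ ∧
    (∀ i, p.2.1 i =ᵐ[ballVol m] pd i φ) ∧ p.2.2 =ᵐ[ballVol m] lap φ}
  zero_mem' := by
    refine ⟨0, IsTest.zero, Lp.coeFn_zero _ _ _, fun i => ?_, ?_⟩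
    · filter_upwards [Lp.coeFn_zero F 2 (ballVol m)] with x hx
      exact hx.trans (pd_const (0 : F) i x).symm
    · filter_upwards [Lp.coeFn_zero F 2 (ballVol m)] with x hx
      exact hx.trans (lap_const (0 : F) x).symm
  add_mem' := by
    rintro p q ⟨φ, hφ, a1, a2, a3⟩ ⟨ψ, hψ, b1, b2, b3⟩
    have e : ∀ i, pd i (fun x => φ x + ψ x) = fun x => pd i φ x + pd i ψ x := fun i =>
      funext fun x => pd_add (hφ.differentiableAt x) (hψ.differentiableAt x) i
    refine ⟨fun x => φ x + ψ x, hφ.add hψ, ?_, fun i => ?_, ?_⟩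
    · filter_upwards [Lp.coeFn_add p.1 q.1, a1, b1] with x h1 h2 h3
      rw [Prod.fst_add, h1, Pi.add_apply, h2, h3]
    · filter_upwards [Lp.coeFn_add (p.2.1 i) (q.2.1 i), a2 i, b2 i] with x h1 h2 h3
      rw [e, Prod.snd_add, Prod.fst_add, Pi.add_apply, h1, Pi.add_apply, h2, h3]
    · filter_upwards [Lp.coeFn_add p.2.2 q.2.2, a3, b3] with x h1 h2 h3
      rw [Prod.snd_add, Prod.snd_add, h1, Pi.add_apply, h2, h3]
      simp only [lap, ← Finset.sum_add_distrib]
      refine Finset.sum_congr rfl fun i _ => ?_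
      rw [e i]
      exact (pd_add ((hφ.pd i).differentiableAt x) ((hψ.pd i).differentiableAt x) i).symm
  smul_mem' := by
    rintro c p ⟨φ, hφ, a1, a2, a3⟩
    have e : ∀ i, pd i (fun x => c • φ x) = fun x => c • pd i φ x := fun i =>
      funext fun x => pd_const_smul c (hφ.differentiableAt x) i
    refine ⟨fun x => c • φ x, hφ.const_smul c, ?_, fun i => ?_, ?_⟩
    · filter_upwards [Lp.coeFn_smul c p.1, a1] with x h1 h2
      rw [Prod.smul_fst, h1, Pi.smul_apply, h2]
    · filter_upwards [Lp.coeFn_smul c (p.2.1 i), a2 i] with x h1 h2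
      rw [e, Prod.smul_snd, Prod.smul_fst, Pi.smul_apply, h1, Pi.smul_apply, h2]
    · filter_upwards [Lp.coeFn_smul c p.2.2, a3] with x h1 h2
      rw [Prod.smul_snd, Prod.smul_snd, h1, Pi.smul_apply, h2]
      simp only [lap, Finset.smul_sum]
      refine Finset.sum_congr rfl fun i _ => ?_
      rw [e i]
      exact (pd_const_smul c ((hφ.pd i).differentiableAt x) i).symm

theorem wPartial_sub_ae_eq [CompleteSpace F] {f f' : EuclideanSpace ℝ (Fin m) → F} {i : Fin m}
    (h : ∃ g, IsWeakPartial i f g) (h' : ∃ g, IsWeakPartial i f' g) :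
    wPartial i (fun x => f x - f' x) =ᵐ[ballVol m] fun x => wPartial i f x - wPartial i f' x :=
  ((isWeakPartial_wPartial h).sub (isWeakPartial_wPartial h')).wPartial_ae_eq

theorem wPartial_wPartial_sub_ae_eq [CompleteSpace F] {f f' : EuclideanSpace ℝ (Fin m) → F}
    (h : MemW22 f) (h' : MemW22 f') (i j : Fin m) :
    wPartial j (wPartial i (fun x => f x - f' x)) =ᵐ[ballVol m]
      fun x => wPartial j (wPartial i f) x - wPartial j (wPartial i f') x := by
  rw [wPartial_congr (wPartial_sub_ae_eq (h.2 i).1 (h'.2 i).1)]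
  exact wPartial_sub_ae_eq ((h.2 i).2.2 j).1 ((h'.2 i).2.2 j).1

theorem wLaplacian_sub_ae_eq [CompleteSpace F] {f f' : EuclideanSpace ℝ (Fin m) → F}
    (h : MemW22 f) (h' : MemW22 f') :
    wLaplacian (fun x => f x - f' x) =ᵐ[ballVol m] fun x => wLaplacian f x - wLaplacian f' x := by
  filter_upwards [ae_all_iff.2 fun i => wPartial_wPartial_sub_ae_eq h h' i i] with x hx
  simp only [wLaplacian, hx, Finset.sum_sub_distrib]

theorem IsTest.memW22 [NeZero m] [CompleteSpace F] (hm : 2 ≤ m)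
    {φ : EuclideanSpace ℝ (Fin m) → F} (hφ : IsTest φ) : MemW22 φ := by
  have e : ∀ i, wPartial i φ =ᵐ[ballVol m] BiharmonicBall.pd i φ := fun i =>
    (isWeakPartial_of_contDiff hm hφ.contDiff i).wPartial_ae_eq
  have e2 : ∀ i j, wPartial j (wPartial i φ) =ᵐ[ballVol m]
      BiharmonicBall.pd j (BiharmonicBall.pd i φ) := fun i j => by
    rw [wPartial_congr (e i)]
    exact (isWeakPartial_of_contDiff hm (hφ.pd i).contDiff j).wPartial_ae_eq
  refine ⟨memLp_of_continuous hφ.continuous 2, fun i =>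
    ⟨⟨_, isWeakPartial_of_contDiff hm hφ.contDiff i⟩,
      (memLp_congr_ae (e i)).2 (memLp_of_continuous (hφ.pd i).continuous 2), fun j => ⟨?_, ?_⟩⟩⟩
  · exact ⟨_, (isWeakPartial_of_contDiff hm (hφ.pd i).contDiff j).congr (e i).symm (ae_eq_refl _)⟩
  · exact (memLp_congr_ae (e2 i j)).2 (memLp_of_continuous ((hφ.pd i).pd j).continuous 2)

/-- Maps in `W^{2,2}_0` have their triple `(w, ∇w, Δw)` in the closure of the test triples. -/
theorem mem_closure_testJets [NeZero m] [CompleteSpace F] (hm : 2 ≤ m)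
    {w : EuclideanSpace ℝ (Fin m) → F} (hw : MemW22Zero w) {p : JetSpace m F}
    (h0 : p.1 =ᵐ[ballVol m] w) (h1 : ∀ i, p.2.1 i =ᵐ[ballVol m] wPartial i w)
    (h2 : p.2.2 =ᵐ[ballVol m] wLaplacian w) : p ∈ (testJets m F).topologicalClosure := by
  refine Metric.mem_closure_iff.2 fun ε hε => ?_
  obtain ⟨φ, hφ, hlt⟩ := hw.2 (ENNReal.ofReal ε) (by simpa using hε)
  have c0 := memLp_of_continuous hφ.continuous 2
  have c1 := fun i => memLp_of_continuous (hφ.pd i).continuous 2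
  have c2 := memLp_of_continuous (contDiff_lap hφ.contDiff).continuous 2
  refine ⟨(c0.toLp φ, fun i => (c1 i).toLp _, c2.toLp _), ⟨φ, hφ, c0.coeFn_toLp,
    fun i => (c1 i).coeFn_toLp, c2.coeFn_toLp⟩, ?_⟩
  have hd1 : ∀ i, wPartial i (w - φ) =ᵐ[ballVol m] fun x => wPartial i w x - pd i φ x := fun i => by
    filter_upwards [wPartial_sub_ae_eq (hw.1.2 i).1 ((hφ.memW22 hm).2 i).1,
      (isWeakPartial_of_contDiff hm hφ.contDiff i).wPartial_ae_eq] with x a1 a2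
    rw [← a2]; exact a1
  have hd2 : wLaplacian (w - φ) =ᵐ[ballVol m] fun x => wLaplacian w x - lap φ x := by
    filter_upwards [wLaplacian_sub_ae_eq hw.1 (hφ.memW22 hm), wLaplacian_ae_eq_lap
      (fun i => isWeakPartial_of_contDiff hm hφ.contDiff i)
      (fun i => isWeakPartial_of_contDiff hm (hφ.pd i).contDiff i)] with x a1 a2
    rw [← a2]; exact a1
  have hsub : MemW22 (w - φ) := by
    have h := hw.1
    have h' := hφ.memW22 hm
    refine ⟨h.1.sub h'.1, fun i => ⟨⟨_, (isWeakPartial_wPartial (h.2 i).1).sub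
      (isWeakPartial_wPartial (h'.2 i).1)⟩, ?_, fun j => ⟨⟨_, ((isWeakPartial_wPartial
        ((h.2 i).2.2 j).1).sub (isWeakPartial_wPartial ((h'.2 i).2.2 j).1)).congr
        (wPartial_sub_ae_eq (h.2 i).1 (h'.2 i).1).symm (ae_eq_refl _)⟩, ?_⟩⟩⟩
    · exact (memLp_congr_ae (wPartial_sub_ae_eq (h.2 i).1 (h'.2 i).1)).2
        ((h.2 i).2.1.sub (h'.2 i).2.1)
    · exact (memLp_congr_ae (wPartial_wPartial_sub_ae_eq h h' i j)).2
        (((h.2 i).2.2 j).2.sub ((h'.2 i).2.2 j).2)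
  have hdist : ∀ {a b : Lp F 2 (ballVol m)} {g : EuclideanSpace ℝ (Fin m) → F},
      (fun x => a x - b x) =ᵐ[ballVol m] g → eLpNorm g 2 (ballVol m) ≤ w22Norm (w - φ) →
      dist a b < ε := fun {a b g} hg hle => by
    rw [Lp.dist_def, ← ENNReal.toReal_ofReal hε.le]
    refine (ENNReal.toReal_lt_toReal ?_ ENNReal.ofReal_ne_top).2 ?_
    · exact (((Lp.memLp a).sub (Lp.memLp b)).eLpNorm_ne_top)
    · refine lt_of_le_of_lt ?_ hlt
      exact (eLpNorm_congr_ae hg).le.trans hle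
  have hn1 : eLpNorm (w - φ) 2 (ballVol m) ≤ w22Norm (w - φ) := by
    rw [w22Norm, add_assoc]; exact le_self_add
  have hn2 : ∀ i, eLpNorm (wPartial i (w - φ)) 2 (ballVol m) ≤ w22Norm (w - φ) := fun i => by
    rw [w22Norm]
    refine le_trans ?_ (le_self_add)
    refine le_trans ?_ (le_add_self)
    exact Finset.single_le_sum (f := fun i => eLpNorm (wPartial i (w - φ)) 2 (ballVol m))
      (fun _ _ => zero_le) (Finset.mem_univ i)
  have hn3 : eLpNorm (wLaplacian (w - φ)) 2 (ballVol m) ≤ w22Norm (w - φ) := by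
    rw [w22Norm]
    refine le_trans ?_ (le_add_self)
    have e : wLaplacian (w - φ) = ∑ i, wPartial i (wPartial i (w - φ)) := by
      funext x; simp [wLaplacian]
    rw [e]
    refine (eLpNorm_sum_le (fun i _ => ((hsub.2 i).2.2 i).2.1) (by norm_num)).trans ?_
    exact Finset.sum_le_sum fun i _ => Finset.single_le_sum
      (f := fun j => eLpNorm (wPartial j (wPartial i (w - φ))) 2 (ballVol m))
      (fun _ _ => zero_le) (Finset.mem_univ i)
  rw [Prod.dist_eq, Prod.dist_eq]
  refine max_lt (hdist ?_ hn1) (max_lt ((dist_pi_lt_iff hε).2 fun i => hdist ?_ (hn2 i))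
    (hdist ?_ hn3))
  · filter_upwards [h0, c0.coeFn_toLp] with x a1 a2
    rw [a1, a2]; rfl
  · filter_upwards [h1 i, (c1 i).coeFn_toLp, hd1 i] with x a1 a2 a3
    rw [a1, a2, a3]
  · filter_upwards [h2, c2.coeFn_toLp, hd2] with x a1 a2 a3
    rw [a1, a2, a3]

end SobolevZero

/-! ### Coercivity on the closure of the test maps -/

instance holderTriple_four : ENNReal.HolderTriple 4 4 2 where
  inv_add_inv_eq_inv := by
    rw [← two_mul, show (4 : ℝ≥0∞) = 2 * 2 by norm_num,
      ENNReal.mul_inv (Or.inl (by norm_num)) (Or.inl (by norm_num)), ← mul_assoc,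
      ENNReal.mul_inv_cancel (by norm_num) (by norm_num), one_mul]

section Stability

variable {m : ℕ} {F : Type*} [NormedAddCommGroup F] [InnerProductSpace ℝ F]

/-- Multiplication by a bounded measurable function, as an operator on `L²`. -/
noncomputable def mulBounded (ρ : Lp ℝ ∞ (ballVol m)) :
    Lp F 2 (ballVol m) →L[ℝ] Lp F 2 (ballVol m) :=
  (ContinuousLinearMap.lsmul ℝ ℝ : ℝ →L[ℝ] F →L[ℝ] F).holderL (ballVol m) ∞ 2 2 ρ

theorem coeFn_mulBounded (ρ : Lp ℝ ∞ (ballVol m)) (f : Lp F 2 (ballVol m)) :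
    mulBounded ρ f =ᵐ[ballVol m] fun x => ρ x • f x :=
  ContinuousLinearMap.coeFn_holder _ _ _

/-- The inclusion of `L⁴` into `L²`. -/
noncomputable def inclFourTwo : Lp F 4 (ballVol m) →L[ℝ] Lp F 2 (ballVol m) :=
  (ContinuousLinearMap.lsmul ℝ ℝ : ℝ →L[ℝ] F →L[ℝ] F).holderL (ballVol m) 4 4 2
    ((memLp_const (1 : ℝ)).toLp _)

theorem coeFn_inclFourTwo (f : Lp F 4 (ballVol m)) :
    inclFourTwo f =ᵐ[ballVol m] f := by
  have h1 := ContinuousLinearMap.coeFn_holder (r := 2)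
    (ContinuousLinearMap.lsmul ℝ ℝ : ℝ →L[ℝ] F →L[ℝ] F)
    ((memLp_const (μ := ballVol m) (p := 4) (1 : ℝ)).toLp _) f
  filter_upwards [h1, (memLp_const (μ := ballVol m) (p := 4) (1 : ℝ)).coeFn_toLp] with x hx hx'
  refine hx.trans ?_
  rw [hx']; simp

/-- The pointwise inner product of two maps in `L⁴`, as a function in `L²`. -/
noncomputable def innerFour :
    Lp F 4 (ballVol m) →L[ℝ] Lp F 4 (ballVol m) →L[ℝ] Lp ℝ 2 (ballVol m) :=
  (innerSL ℝ : F →L[ℝ] F →L[ℝ] ℝ).holderL (ballVol m) 4 4 2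

theorem coeFn_innerFour (f g : Lp F 4 (ballVol m)) :
    innerFour f g =ᵐ[ballVol m] fun x => inner ℝ (f x) (g x) :=
  ContinuousLinearMap.coeFn_holder _ _ _

theorem norm_sq_eq_integral (f : Lp F 2 (ballVol m)) :
    ‖f‖ ^ 2 = ∫ x, ‖f x‖ ^ 2 ∂(ballVol m) := by
  rw [← real_inner_self_eq_norm_sq, L2.inner_def]
  simp only [real_inner_self_eq_norm_sq]

theorem integrable_norm_sq (f : Lp F 2 (ballVol m)) :
    Integrable (fun x => ‖f x‖ ^ 2) (ballVol m) := by
  simpa only [real_inner_self_eq_norm_sq] using L2.integrable_inner (𝕜 := ℝ) f f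

/-- The truncation `min (r⁻¹) N` of the weight `r⁻¹`. -/
noncomputable def truncWeight (m N : ℕ) : Lp ℝ ∞ (ballVol m) :=
  MemLp.toLp (fun x : EuclideanSpace ℝ (Fin m) => min ‖x‖⁻¹ N)
    (memLp_top_of_bound (by fun_prop) (N : ℝ) (ae_of_all _ fun x => by
      rw [Real.norm_of_nonneg (by positivity)]; exact min_le_right _ _))

theorem coeFn_truncWeight (N : ℕ) :
    truncWeight m N =ᵐ[ballVol m] fun x => min ‖x‖⁻¹ (N : ℝ) :=
  MemLp.coeFn_toLp _

variable [NeZero m]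

/-- The coercivity estimate with a truncated weight is a closed condition and passes from test maps
to the closure. -/
theorem coercive_truncated (hm : 8 ≤ m) {κ : ℝ} (hκ0 : 0 ≤ κ) (hκ : κ ≤ (m : ℝ) ^ 2 / 4)
    {p : JetSpace m F} (hp : p ∈ (testJets m F).topologicalClosure) (N : ℕ) :
    κ * ∑ i, ‖mulBounded (truncWeight m N) (p.2.1 i)‖ ^ 2 + ((m : ℝ) ^ 2 / 4 - κ) * ‖p.1‖ ^ 2
      ≤ ‖p.2.2‖ ^ 2 := by
  have hcl : IsClosed {p : JetSpace m F |
      κ * ∑ i, ‖mulBounded (truncWeight m N) (p.2.1 i)‖ ^ 2 + ((m : ℝ) ^ 2 / 4 - κ) * ‖p.1‖ ^ 2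
      ≤ ‖p.2.2‖ ^ 2} := by
    refine isClosed_le ?_ ?_
    · refine (continuous_const.mul (continuous_finsetSum _ fun i _ => ?_)).add
        (continuous_const.mul (continuous_fst.norm.pow 2))
      exact ((mulBounded (truncWeight m N)).continuous.comp
        ((continuous_apply i).comp (continuous_fst.comp continuous_snd))).norm.pow 2
    · exact (continuous_snd.comp continuous_snd).norm.pow 2
  refine closure_minimal ?_ hcl hp
  rintro p ⟨φ, hφ, h0, h1, h2⟩
  refine le_trans ?_ ((coercive_test hm hφ hκ).trans (le_of_eq ?_))
  · rw [norm_sq_eq_integral p.1]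
    have e0 : ∫ x, ‖p.1 x‖ ^ 2 ∂(ballVol m) = ∫ x, ‖φ x‖ ^ 2 ∂(ballVol m) :=
      integral_congr_ae (by filter_upwards [h0] with x hx; rw [hx])
    rw [e0]
    gcongr
    simp only [norm_sq_eq_integral, Finset.mul_sum]
    have hi : ∀ i, Integrable (fun x => ‖x‖ ^ (-2 : ℤ) * ‖pd i φ x‖ ^ 2) (ballVol m) := fun i =>
      (HomSmooth.norm_zpow (-2)).integrable_mul (by omega) ((hφ.pd i).continuous.norm.pow 2)
    rw [integral_finsetSum _ fun i _ => hi i]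
    refine Finset.sum_le_sum fun i _ => ?_
    refine integral_mono_ae (integrable_norm_sq _) (hi i) ?_
    filter_upwards [coeFn_mulBounded (truncWeight m N) (p.2.1 i), coeFn_truncWeight (m := m) N, h1 i]
      with x a1 a2 a3
    rw [a1, a2, a3, norm_smul, mul_pow, zpow_neg_two, Real.norm_eq_abs, sq_abs, ← inv_pow]
    gcongr
    exact min_le_left _ _
  · rw [norm_sq_eq_integral]
    exact integral_congr_ae (by filter_upwards [h2] with x hx; rw [hx])

/-- The coercivity estimate on the closure of the test maps. -/
theorem coercive_closure (hm : 8 ≤ m) {κ : ℝ} (hκ0 : 0 ≤ κ) (hκ : κ ≤ (m : ℝ) ^ 2 / 4)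
    {p : JetSpace m F} (hp : p ∈ (testJets m F).topologicalClosure)
    (hi : ∀ i, Integrable (fun x => ‖x‖ ^ (-2 : ℤ) * ‖p.2.1 i x‖ ^ 2) (ballVol m)) :
    κ * ∫ x, ‖x‖ ^ (-2 : ℤ) * ∑ i, ‖p.2.1 i x‖ ^ 2 ∂(ballVol m)
      + ((m : ℝ) ^ 2 / 4 - κ) * ‖p.1‖ ^ 2 ≤ ‖p.2.2‖ ^ 2 := by
  simp only [Finset.mul_sum]
  rw [integral_finsetSum _ fun i _ => hi i]
  refine le_of_tendsto' (x := atTop) (f := fun N : ℕ => κ *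
    ∑ i, ‖mulBounded (truncWeight m N) (p.2.1 i)‖ ^ 2 + ((m : ℝ) ^ 2 / 4 - κ) * ‖p.1‖ ^ 2) ?_
    fun N => coercive_truncated hm hκ0 hκ hp N
  refine (Tendsto.const_mul _ (tendsto_finsetSum _ fun i _ => ?_)).add_const _
  have e : ∀ N : ℕ, ‖mulBounded (truncWeight m N) (p.2.1 i)‖ ^ 2
      = ∫ x, (min ‖x‖⁻¹ (N : ℝ)) ^ 2 * ‖p.2.1 i x‖ ^ 2 ∂(ballVol m) := fun N => by
    rw [norm_sq_eq_integral]
    refine integral_congr_ae ?_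
    filter_upwards [coeFn_mulBounded (truncWeight m N) (p.2.1 i), coeFn_truncWeight (m := m) N]
      with x a1 a2
    rw [a1, a2, norm_smul, mul_pow, Real.norm_eq_abs, sq_abs]
  simp only [e]
  refine tendsto_integral_of_dominated_convergence _ (fun N => ?_) (hi i) (fun N => ?_) ?_
  · exact AEStronglyMeasurable.mul (by fun_prop) ((Lp.aestronglyMeasurable _).norm.pow 2)
  · refine ae_of_all _ fun x => ?_
    rw [Real.norm_of_nonneg (by positivity), zpow_neg_two, ← inv_pow]
    gcongr
    exact min_le_left _ _
  · refine ae_of_all _ fun x => ?_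
    refine tendsto_const_nhds.congr' ?_
    filter_upwards [tendsto_natCast_atTop_atTop.eventually_ge_atTop ‖x‖⁻¹] with N hN
    rw [min_eq_left hN, zpow_neg_two, inv_pow]

namespace BiharmonicCone

variable {lam s : ℝ} {h : EuclideanSpace ℝ (Fin m) → F} {e : F}

/-- The linear part of the biharmonic map equation holds against all maps in the closure of the
test maps. -/
theorem inner_closure_eq_zero (H : BiharmonicCone lam s h e) (hm : 8 ≤ m) {p : JetSpace m F}
    (hp : p ∈ (testJets m F).topologicalClosure) {D : Lp F 2 (ballVol m)}
    {W : Fin m → Lp F 2 (ballVol m)} (hD : D =ᵐ[ballVol m] fun x => (-(lam * ‖x‖ ^ (-2 : ℤ))) • h x)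
    (hW : ∀ i, W i =ᵐ[ballVol m] fun x => (lam * s * ‖x‖ ^ (-2 : ℤ)) • pd i h x) :
    inner ℝ D p.2.2 = 2 * ∑ i, inner ℝ (W i) (p.2.1 i) := by
  have hcl : IsClosed {p : JetSpace m F |
      (inner ℝ D p.2.2 : ℝ) = 2 * ∑ i, inner ℝ (W i) (p.2.1 i)} := by
    refine isClosed_eq (continuous_const.inner (continuous_snd.comp continuous_snd))
      (continuous_const.mul (continuous_finsetSum _ fun i _ => continuous_const.inner
        ((continuous_apply i).comp (continuous_fst.comp continuous_snd))))
  refine closure_minimal ?_ hcl hp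
  rintro p ⟨φ, hφ, h0, h1, h2⟩
  obtain ⟨-, hlin⟩ := H.integral_linear (by omega) hφ
  have i1 := L2.integrable_inner (𝕜 := ℝ) D p.2.2
  have i2 := fun i => L2.integrable_inner (𝕜 := ℝ) (W i) (p.2.1 i)
  simp only [Set.mem_ofPred_eq, L2.inner_def]
  rw [← integral_finsetSum _ fun i _ => i2 i, ← integral_const_mul, ← sub_eq_zero,
    ← integral_sub i1 ((integrable_finsetSum _ fun i _ => i2 i).const_mul 2), ← hlin]
  refine integral_congr_ae ?_
  filter_upwards [hD, ae_all_iff.2 hW, ae_all_iff.2 h1, h2] with x a1 a2 a3 a4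
  rw [a1, a4]
  simp only [a2, a3, real_inner_smul_left]
  rw [← Finset.mul_sum]
  ring

end BiharmonicCone

end Stability

/-! ### The second variation of the bienergy -/

section JetCurves

variable {ι E E₁ E₂ E₃ : Type*} [Fintype ι] [NormedAddCommGroup E] [NormedSpace ℝ E]
  [NormedAddCommGroup E₁] [NormedSpace ℝ E₁] [NormedAddCommGroup E₂] [NormedSpace ℝ E₂]
  [NormedAddCommGroup E₃] [NormedSpace ℝ E₃]

theorem hasDerivAt_prod_pi (L : E →L[ℝ] E₂) {v : ℝ → E₁} {g : ι → ℝ → E} {D : ℝ → E₃} {v' : E₁}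
    {g' : ι → E} {D' : E₃} {a : ℝ} (hv : HasDerivAt v v' a) (hg : ∀ i, HasDerivAt (g i) (g' i) a)
    (hD : HasDerivAt D D' a) :
    HasDerivAt (fun t => (v t, (fun i => L (g i t)), D t)) (v', (fun i => L (g' i)), D') a :=
  hv.prodMk ((hasDerivAt_pi.2 fun i => L.hasFDerivAt.comp_hasDerivAt a (hg i)).prodMk hD)

/-- The first two derivatives of a curve in `E₁ × E₂^ι × E₃` are taken componentwise. -/
theorem deriv_prod_pi (L : E →L[ℝ] E₂) {v : ℝ → E₁} {g : ι → ℝ → E} {D : ℝ → E₃} {a : ℝ}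
    (hv : ContDiffAt ℝ 2 v a) (hg : ∀ i, ContDiffAt ℝ 2 (g i) a) (hD : ContDiffAt ℝ 2 D a) :
    ContDiffAt ℝ 2 (fun t => (v t, (fun i => L (g i t)), D t)) a ∧
      deriv (fun t => (v t, (fun i => L (g i t)), D t)) a
        = (deriv v a, (fun i => L (deriv (g i) a)), deriv D a) ∧
      deriv (deriv fun t => (v t, (fun i => L (g i t)), D t)) a
        = (deriv (deriv v) a, (fun i => L (deriv (deriv (g i)) a)), deriv (deriv D) a) := by
  have h1 : (deriv fun t => (v t, (fun i => L (g i t)), D t)) =ᶠ[𝓝 a]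
      fun t => (deriv v t, (fun i => L (deriv (g i) t)), deriv D t) := by
    filter_upwards [eventually_hasDerivAt hv, eventually_all.2 fun i => eventually_hasDerivAt (hg i),
      eventually_hasDerivAt hD] with t a1 a2 a3
    exact (hasDerivAt_prod_pi L a1 a2 a3).deriv
  refine ⟨hv.prodMk ((contDiffAt_pi.2 fun i =>
    L.contDiff.contDiffAt.comp a (hg i)).prodMk hD), h1.self_of_nhds, ?_⟩
  rw [h1.deriv_eq]
  exact (hasDerivAt_prod_pi L (hasDerivAt_deriv hv) (fun i => hasDerivAt_deriv (hg i))
    (hasDerivAt_deriv hD)).deriv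

theorem deriv_prod_pi_mem (L : E →L[ℝ] E₂) {v : ℝ → E₁} {g : ι → ℝ → E} {D : ℝ → E₃} {a : ℝ}
    (hv : ContDiffAt ℝ 2 v a) (hg : ∀ i, ContDiffAt ℝ 2 (g i) a) (hD : ContDiffAt ℝ 2 D a)
    {S : Submodule ℝ (E₁ × (ι → E₂) × E₃)} (hS : IsClosed (S : Set (E₁ × (ι → E₂) × E₃)))
    (h : ∀ᶠ t in 𝓝 a, (v t - v a, (fun i => L (g i t) - L (g i a)), D t - D a) ∈ S) :
    (deriv v a, (fun i => L (deriv (g i) a)), deriv D a) ∈ S ∧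
      (deriv (deriv v) a, (fun i => L (deriv (deriv (g i)) a)), deriv (deriv D) a) ∈ S := by
  obtain ⟨h0, h1, h2⟩ := deriv_prod_pi L hv hg hD
  rw [← h1, ← h2]
  exact deriv_mem_of_sub_mem hS h0 h

end JetCurves

section SecondVariation

variable {m : ℕ} {F : Type*} [NormedAddCommGroup F] [InnerProductSpace ℝ F]

theorem bienergy_eq {u : EuclideanSpace ℝ (Fin m) → F} {D : Lp F 2 (ballVol m)}
    {G : Lp ℝ 2 (ballVol m)} (hD : D =ᵐ[ballVol m] wLaplacian u) (hG : G =ᵐ[ballVol m] gradSq u) :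
    bienergy u = 1 / 2 * (inner ℝ D D - inner ℝ G G) := by
  rw [bienergy, L2.inner_def, L2.inner_def,
    ← integral_sub (L2.integrable_inner (𝕜 := ℝ) D D) (L2.integrable_inner (𝕜 := ℝ) G G)]
  congr 1
  refine integral_congr_ae ?_
  filter_upwards [hD, hG] with x a1 a2
  rw [a1, a2, real_inner_self_eq_norm_sq, real_inner_self_eq_norm_sq, Real.norm_eq_abs, sq_abs]

theorem coeFn_sum_lp {E ι : Type*} [NormedAddCommGroup E] [Fintype ι] (f : ι → Lp E 2 (ballVol m)) :
    (∑ i, f i : Lp E 2 (ballVol m)) =ᵐ[ballVol m] fun x => ∑ i, f i x := by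
  filter_upwards [Lp.coeFn_fun_finsetSum Finset.univ f] with x hx using hx

theorem sum_innerFour_ae_eq_gradSq {u : EuclideanSpace ℝ (Fin m) → F}
    {g : Fin m → Lp F 4 (ballVol m)} (hg : ∀ i, g i =ᵐ[ballVol m] wPartial i u) :
    (∑ i, innerFour (g i) (g i) : Lp ℝ 2 (ballVol m)) =ᵐ[ballVol m] gradSq u := by
  filter_upwards [coeFn_sum_lp fun i => innerFour (g i) (g i), ae_all_iff.2 hg,
    ae_all_iff.2 fun i => coeFn_innerFour (g i) (g i)] with x a1 a2 a3
  rw [a1, gradSq]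
  exact Finset.sum_congr rfl fun i _ => by rw [a3, a2, real_inner_self_eq_norm_sq]

/-- The Laplacians of a curve whose weak second partial derivatives are `C²` curves in `L²` form
a `C²` curve. -/
theorem exists_lap_curve {v : ℝ → Lp F 2 (ballVol m)} {k : Fin m → ℝ → Lp F 2 (ballVol m)}
    {a : ℝ} (hk : ∀ i, ContDiffAt ℝ 2 (k i) a)
    (hkv : ∀ᶠ t in 𝓝 a, ∀ i, k i t =ᵐ[ballVol m] wPartial i (wPartial i (v t))) :
    ∃ D : ℝ → Lp F 2 (ballVol m), ContDiffAt ℝ 2 D a ∧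
      ∀ᶠ t in 𝓝 a, D t =ᵐ[ballVol m] wLaplacian (v t) := by
  refine ⟨fun t => ∑ i, k i t, ContDiffAt.sum fun i _ => hk i, hkv.mono fun t ht => ?_⟩
  filter_upwards [coeFn_sum_lp fun i => k i t, ae_all_iff.2 ht] with x a1 a2
  rw [a1, wLaplacian]
  exact Finset.sum_congr rfl fun i _ => a2 i

theorem wLaplacian_congr {f f' : EuclideanSpace ℝ (Fin m) → F} (h : f =ᵐ[ballVol m] f') :
    wLaplacian f = wLaplacian f' := by
  funext x; simp only [wLaplacian, wPartial_congr h]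

theorem gradSq_congr {f f' : EuclideanSpace ℝ (Fin m) → F} (h : f =ᵐ[ballVol m] f') :
    gradSq f = gradSq f' := by
  funext x; simp only [gradSq, wPartial_congr h]

/-- The second derivative of `½ (|D|² - |G|²)` for two curves `D` and `G`. -/
theorem iteratedDeriv_two_half_sub {E E' : Type*} [NormedAddCommGroup E] [InnerProductSpace ℝ E]
    [NormedAddCommGroup E'] [InnerProductSpace ℝ E'] {D : ℝ → E} {G : ℝ → E'} {a : ℝ}
    (hD : ContDiffAt ℝ 2 D a) (hG : ContDiffAt ℝ 2 G a) :
    ContDiffAt ℝ 2 (fun t => 1 / 2 * (inner ℝ (D t) (D t) - inner ℝ (G t) (G t) : ℝ)) a ∧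
      iteratedDeriv 2 (fun t => 1 / 2 * (inner ℝ (D t) (D t) - inner ℝ (G t) (G t) : ℝ)) a
        = ‖deriv D a‖ ^ 2 + inner ℝ (D a) (deriv (deriv D) a)
          - (‖deriv G a‖ ^ 2 + inner ℝ (G a) (deriv (deriv G) a)) := by
  have c1 : ContDiffAt ℝ 2 (fun t => (inner ℝ (D t) (D t) : ℝ)) a :=
    contDiffAt_bilin (innerSL ℝ) hD hD
  have c2 : ContDiffAt ℝ 2 (fun t => (inner ℝ (G t) (G t) : ℝ)) a :=
    contDiffAt_bilin (innerSL ℝ) hG hG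
  have d1 : deriv (deriv fun t => (inner ℝ (D t) (D t) : ℝ)) a = inner ℝ (deriv (deriv D) a) (D a)
      + (2 : ℝ) • inner ℝ (deriv D a) (deriv D a) + inner ℝ (D a) (deriv (deriv D) a) :=
    (deriv_bilin (innerSL ℝ) hD hD).2
  have d2 : deriv (deriv fun t => (inner ℝ (G t) (G t) : ℝ)) a = inner ℝ (deriv (deriv G) a) (G a)
      + (2 : ℝ) • inner ℝ (deriv G a) (deriv G a) + inner ℝ (G a) (deriv (deriv G) a) :=
    (deriv_bilin (innerSL ℝ) hG hG).2
  refine ⟨contDiffAt_const.mul (c1.sub c2), ?_⟩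
  rw [iteratedDeriv_const_mul_field]
  change 1 / 2 * iteratedDeriv 2 ((fun t => (inner ℝ (D t) (D t) : ℝ))
    - fun t => (inner ℝ (G t) (G t) : ℝ)) a = _
  rw [iteratedDeriv_sub c1 c2]
  simp only [iteratedDeriv_succ, iteratedDeriv_zero]
  rw [d1, d2, real_inner_comm (D a), real_inner_comm (G a), real_inner_self_eq_norm_sq,
    real_inner_self_eq_norm_sq, smul_eq_mul, smul_eq_mul]
  ring

theorem innerFour_comm (f g : Lp F 4 (ballVol m)) : innerFour f g = innerFour g f := by
  refine Lp.ext ?_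
  filter_upwards [coeFn_innerFour f g, coeFn_innerFour g f] with x a1 a2
  rw [a1, a2, real_inner_comm]

theorem contDiffAt_sum_innerFour {g : Fin m → ℝ → Lp F 4 (ballVol m)} {a : ℝ}
    (hg : ∀ i, ContDiffAt ℝ 2 (g i) a) :
    ContDiffAt ℝ 2 (fun t => ∑ i, innerFour (g i t) (g i t)) a := by
  refine ContDiffAt.sum (f := fun i t => innerFour (g i t) (g i t)) fun i _ => ?_
  exact contDiffAt_bilin innerFour (hg i) (hg i)

theorem deriv_sum_innerFour {g : Fin m → ℝ → Lp F 4 (ballVol m)} {a : ℝ}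
    (hg : ∀ i, ContDiffAt ℝ 2 (g i) a) :
    deriv (fun t => ∑ i, innerFour (g i t) (g i t)) a
        = (2 : ℝ) • ∑ i, innerFour (deriv (g i) a) (g i a)
      ∧ deriv (deriv fun t => ∑ i, innerFour (g i t) (g i t)) a
        = (2 : ℝ) • (∑ i, innerFour (deriv (deriv (g i)) a) (g i a)
          + ∑ i, innerFour (deriv (g i) a) (deriv (g i) a)) := by
  have h1 := deriv_deriv_sum (s := Finset.univ) fun i _ =>
    contDiffAt_bilin innerFour (hg i) (hg i)
  rw [h1.1, h1.2, ← Finset.sum_add_distrib, Finset.smul_sum, Finset.smul_sum]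
  refine ⟨Finset.sum_congr rfl fun i _ => ?_, Finset.sum_congr rfl fun i _ => ?_⟩
  · rw [(deriv_bilin innerFour (hg i) (hg i)).1, innerFour_comm (g i a), two_smul]
  · rw [(deriv_bilin innerFour (hg i) (hg i)).2, innerFour_comm (g i a)]
    module

set_option maxHeartbeats 1000000 in
/-- The first two derivatives of a curve of triples `(w, ∇w, Δw)` whose increments lie in the
closure of the test maps. -/
theorem deriv_mem_closure_testJets {v D : ℝ → Lp F 2 (ballVol m)}
    {g : Fin m → ℝ → Lp F 4 (ballVol m)} {a : ℝ} (hv : ContDiffAt ℝ 2 v a)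
    (hg : ∀ i, ContDiffAt ℝ 2 (g i) a) (hD : ContDiffAt ℝ 2 D a)
    (h : ∀ᶠ t in 𝓝 a, ((v t - v a, fun i => inclFourTwo (g i t) - inclFourTwo (g i a),
      D t - D a) : JetSpace m F) ∈ (testJets m F).topologicalClosure) :
    ((deriv v a, fun i => inclFourTwo (deriv (g i) a), deriv D a) : JetSpace m F) ∈
        (testJets m F).topologicalClosure ∧
      ((deriv (deriv v) a, fun i => inclFourTwo (deriv (deriv (g i)) a),
        deriv (deriv D) a) : JetSpace m F) ∈ (testJets m F).topologicalClosure :=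
  deriv_prod_pi_mem (ι := Fin m) (E := Lp F 4 (ballVol m)) (E₁ := Lp F 2 (ballVol m))
    (E₂ := Lp F 2 (ballVol m)) (E₃ := Lp F 2 (ballVol m)) inclFourTwo hv hg hD
    (S := (testJets m F).topologicalClosure) (testJets m F).isClosed_topologicalClosure h

namespace BiharmonicCone

variable {lam s : ℝ} {h : EuclideanSpace ℝ (Fin m) → F} {e : F}

theorem inner_gradSq_eq {G : Lp ℝ 2 (ballVol m)}
    (hG : G =ᵐ[ballVol m] fun x => lam * s * ‖x‖ ^ (-2 : ℤ))
    (η : Fin m → Lp F 4 (ballVol m)) :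
    inner ℝ G (∑ i, innerFour (η i) (η i))
      = lam * s * ∫ x, ‖x‖ ^ (-2 : ℤ) * ∑ i, ‖η i x‖ ^ 2 ∂(ballVol m) := by
  rw [L2.inner_def, ← integral_const_mul]
  refine integral_congr_ae ?_
  filter_upwards [coeFn_sum_lp fun i => innerFour (η i) (η i), hG,
    ae_all_iff.2 fun i => coeFn_innerFour (η i) (η i)] with x a1 a2 a3
  rw [a1, a2]
  simp only [a3, real_inner_self_eq_norm_sq]
  rw [RCLike.inner_apply, conj_trivial]
  ring

variable [NeZero m]

theorem integrable_weight_norm_sq (hm : 5 ≤ m) (η : Lp F 4 (ballVol m)) :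
    Integrable (fun x => ‖x‖ ^ (-2 : ℤ) * ‖η x‖ ^ 2) (ballVol m) := by
  have hR : MemLp (fun x : EuclideanSpace ℝ (Fin m) => ‖x‖ ^ (-2 : ℤ)) (2 : ℕ) (ballVol m) :=
    (HomSmooth.norm_zpow (-2)).memLp two_ne_zero (by push_cast; omega)
  have hR' : MemLp (fun x : EuclideanSpace ℝ (Fin m) => ‖x‖ ^ (-2 : ℤ)) 2 (ballVol m) := by
    exact_mod_cast hR
  refine (L2.integrable_inner (𝕜 := ℝ) (innerFour η η) (hR'.toLp _)).congr ?_
  filter_upwards [hR'.coeFn_toLp, coeFn_innerFour η η] with x a1 a2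
  rw [a1, a2, real_inner_self_eq_norm_sq]
  rfl

/-- Half the derivative of `|du|²` in the direction `η` is `⟨η, dh⟩`, and its square is bounded
pointwise by `|dh|² |η|² = λ s r⁻² |η|²`. -/
theorem norm_sq_deriv_gradSq_le (H : BiharmonicCone lam s h e) (hm : 5 ≤ m)
    {γ η : Fin m → Lp F 4 (ballVol m)} (hγ : ∀ i, γ i =ᵐ[ballVol m] pd i h) :
    ‖∑ i, innerFour (η i) (γ i)‖ ^ 2
      ≤ lam * s * ∫ x, ‖x‖ ^ (-2 : ℤ) * ∑ i, ‖η i x‖ ^ 2 ∂(ballVol m) := by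
  rw [norm_sq_eq_integral, ← integral_const_mul]
  refine integral_mono_ae (integrable_norm_sq _) ?_ ?_
  · simp only [Finset.mul_sum]
    exact integrable_finsetSum _ fun i _ => (integrable_weight_norm_sq hm (η i)).const_mul _
  · filter_upwards [coeFn_sum_lp fun i => innerFour (η i) (γ i), ae_all_iff.2 hγ,
      ae_all_iff.2 fun i => coeFn_innerFour (η i) (γ i), ae_ne_zero] with x a1 a2 a3 hx
    rw [a1]
    simp only [a2, a3]
    calc ‖∑ i, inner ℝ (η i x) (pd i h x)‖ ^ 2
        ≤ (∑ i, ‖η i x‖ * ‖pd i h x‖) ^ 2 := by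
          gcongr
          exact norm_sum_le_of_le _ fun i _ => norm_inner_le_norm _ _
      _ ≤ (∑ i, ‖η i x‖ ^ 2) * ∑ i, ‖pd i h x‖ ^ 2 := Finset.sum_mul_sq_le_sq_mul_sq _ _ _
      _ = _ := by rw [H.eigen.sum_norm_pd_sq hx]; ring

theorem exists_weighted_pd (H : BiharmonicCone lam s h e) (hm : 7 ≤ m) (i : Fin m) :
    ∃ W : Lp F 2 (ballVol m),
      W =ᵐ[ballVol m] fun x => (lam * s * ‖x‖ ^ (-2 : ℤ)) • pd i h x := by
  have h1 := (((HomSmooth.norm_zpow (m := m) (-2)).smul (H.eigen.hom.pd i)).const_smul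
    (lam * s)).memLp
    two_ne_zero (by push_cast; omega)
  have h2 : MemLp (fun x => (lam * s) • (‖x‖ ^ (-2 : ℤ) • pd i h x)) 2 (ballVol m) := by
    exact_mod_cast h1
  refine ⟨h2.toLp _, h2.coeFn_toLp.trans (ae_of_all _ fun x => ?_)⟩
  simp only [smul_smul]

/-- Positivity of the second variation. In the second derivative
`|D'|² + ⟨D, D''⟩ - |G'|² - ⟨G, G''⟩` of the bienergy, with `D = Δu` and `G = |du|²`, the second
derivatives of the curve cancel because the linear part of the biharmonic map equation vanishes.
The term `|G'|²` is at most `4 λ s ∫ r⁻² |η|²` and the rest of `⟨G, G''⟩` is `2 λ s ∫ r⁻² |η|²`,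
which gives the constant `6 λ s`. -/
theorem second_variation_lower_bound (H : BiharmonicCone lam s h e) (hm : 8 ≤ m)
    (hls : 0 ≤ lam * s) (hls' : 6 * (lam * s) ≤ (m : ℝ) ^ 2 / 4)
    {D D' D'' η₀ ζ₀ : Lp F 2 (ballVol m)} {γ η ζ : Fin m → Lp F 4 (ballVol m)}
    {G : Lp ℝ 2 (ballVol m)}
    (hD : D =ᵐ[ballVol m] fun x => (-(lam * ‖x‖ ^ (-2 : ℤ))) • h x)
    (hγ : ∀ i, γ i =ᵐ[ballVol m] pd i h)
    (hG : G =ᵐ[ballVol m] fun x => lam * s * ‖x‖ ^ (-2 : ℤ))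
    (hη : ((η₀, fun i => inclFourTwo (η i), D') : JetSpace m F) ∈
      (testJets m F).topologicalClosure)
    (hζ : ((ζ₀, fun i => inclFourTwo (ζ i), D'') : JetSpace m F) ∈
      (testJets m F).topologicalClosure) :
    ((m : ℝ) ^ 2 / 4 - 6 * (lam * s)) * ‖η₀‖ ^ 2 ≤ ‖D'‖ ^ 2 + inner ℝ D D''
      - (‖(2 : ℝ) • ∑ i, innerFour (η i) (γ i)‖ ^ 2
        + inner ℝ G ((2 : ℝ) • (∑ i, innerFour (ζ i) (γ i) + ∑ i, innerFour (η i) (η i)))) := by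
  choose W hW using H.exists_weighted_pd (by omega)
  have e1 : inner ℝ D D'' = 2 * inner ℝ G (∑ i, innerFour (ζ i) (γ i)) := by
    rw [H.inner_closure_eq_zero hm hζ hD hW]
    congr 1
    simp only [inner_sum, L2.inner_def]
    refine Finset.sum_congr rfl fun i _ => integral_congr_ae ?_
    filter_upwards [hW i, hγ i, hG, coeFn_inclFourTwo (ζ i), coeFn_innerFour (ζ i) (γ i)]
      with x a1 a2 a3 a4 a5
    rw [a1, a3, a4, a5, a2, real_inner_smul_left, RCLike.inner_apply, conj_trivial,
      mul_comm, real_inner_comm]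
  have e2 := H.norm_sq_deriv_gradSq_le (by omega) (η := η) hγ
  have e3 := inner_gradSq_eq hG η
  have hae : ∀ᵐ x ∂(ballVol m), ∀ i, inclFourTwo (η i) x = η i x :=
    ae_all_iff.2 fun i => coeFn_inclFourTwo (η i)
  have e4 := coercive_closure hm (κ := 6 * (lam * s)) (by positivity) hls' hη fun i => by
    refine (integrable_weight_norm_sq (by omega) (η i)).congr ?_
    filter_upwards [hae] with x hx
    simp only [hx]
  have e5 : ∫ x, ‖x‖ ^ (-2 : ℤ) * ∑ i, ‖inclFourTwo (η i) x‖ ^ 2 ∂(ballVol m)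
      = ∫ x, ‖x‖ ^ (-2 : ℤ) * ∑ i, ‖η i x‖ ^ 2 ∂(ballVol m) := by
    refine integral_congr_ae ?_
    filter_upwards [hae] with x hx
    simp only [hx]
  simp only [e5] at e4
  rw [norm_smul, mul_pow, inner_smul_right, inner_add_right, e3, e1]
  rw [Real.norm_of_nonneg zero_le_two]
  linarith

variable [CompleteSpace F]

/-- The increments of the triples `(v, ∇v, Δv)` along a variation of `h + e` lie in the
closure of the test maps. -/
theorem variation_sub_mem (H : BiharmonicCone lam s h e) (hm : 5 ≤ m)
    {v : ℝ → Lp F 2 (ballVol m)} (hv : IsVariation (fun x => h x + e) v)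
    {g : Fin m → ℝ → Lp F 4 (ballVol m)} {D : ℝ → Lp F 2 (ballVol m)}
    (hg : ∀ᶠ t in 𝓝 (0 : ℝ), ∀ i, g i t =ᵐ[ballVol m] wPartial i (v t))
    (hD : ∀ᶠ t in 𝓝 (0 : ℝ), D t =ᵐ[ballVol m] wLaplacian (v t)) :
    ∀ᶠ t in 𝓝 (0 : ℝ), ((v t - v 0, fun i => inclFourTwo (g i t) - inclFourTwo (g i 0),
      D t - D 0) : JetSpace m F) ∈ (testJets m F).topologicalClosure := by
  have hu := (H.memW22Sphere hm).1
  have hD0 := hD.self_of_nhds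
  have hg0 := hg.self_of_nhds
  simp only [wLaplacian_congr hv.start] at hD0
  simp only [wPartial_congr hv.start] at hg0
  filter_upwards [hv.boundary, hv.sphere, hg, hD] with t hb hs hgt hDt
  refine mem_closure_testJets (by omega) hb ?_ (fun i => ?_) ?_
  · filter_upwards [Lp.coeFn_sub (v t) (v 0), hv.start] with x a1 a2
    rw [a1, Pi.sub_apply, a2]
  · filter_upwards [Lp.coeFn_sub (inclFourTwo (g i t)) (inclFourTwo (g i 0)),
      coeFn_inclFourTwo (g i t), coeFn_inclFourTwo (g i 0), hgt i, hg0 i,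
      wPartial_sub_ae_eq (hs.1.2 i).1 (hu.2 i).1] with x a1 a2 a3 a4 a5 a6
    rw [a1, Pi.sub_apply, a2, a3, a4, a5, a6]
  · filter_upwards [Lp.coeFn_sub (D t) (D 0), hDt, hD0, wLaplacian_sub_ae_eq hs.1 hu]
      with x a1 a2 a3 a4
    rw [a1, Pi.sub_apply, a2, a3, a4]

theorem isStrictlyStable (H : BiharmonicCone lam s h e) (hm : 8 ≤ m)
    (hls : 0 ≤ lam * s) (hls' : 6 * (lam * s) < (m : ℝ) ^ 2 / 4) :
    IsStrictlyStable (fun x => h x + e) := by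
  refine ⟨H.isWeakBiharmonic (by omega), fun v hv hne => ?_⟩
  choose g hg hgv using hv.contDiff_one
  choose k hk hkv using fun i => hv.contDiff_two i i
  obtain ⟨D, hD, hDv⟩ := exists_lap_curve hk (eventually_all.2 hkv)
  have hgv' := eventually_all.2 hgv
  have hGv : ∀ᶠ t in 𝓝 (0 : ℝ), (∑ i, innerFour (g i t) (g i t) : Lp ℝ 2 (ballVol m))
      =ᵐ[ballVol m] gradSq (v t) := by
    filter_upwards [hgv'] with t ht using sum_innerFour_ae_eq_gradSq ht
  have hG := contDiffAt_sum_innerFour hg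
  obtain ⟨m1, m2⟩ := deriv_mem_closure_testJets hv.contDiff_zero hg hD
    (H.variation_sub_mem (by omega) hv hgv' hDv)
  have hE : (fun t => bienergy (v t)) =ᶠ[𝓝 0] fun t => 1 / 2 * (inner ℝ (D t) (D t)
      - inner ℝ (∑ i, innerFour (g i t) (g i t)) (∑ i, innerFour (g i t) (g i t))) := by
    filter_upwards [hDv, hGv] with t a1 a2 using bienergy_eq a1 a2
  obtain ⟨c1, c2⟩ := iteratedDeriv_two_half_sub hD hG
  obtain ⟨hG', hG''⟩ := deriv_sum_innerFour hg
  refine ⟨c1.congr_of_eventuallyEq hE, ?_⟩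
  rw [hE.iteratedDeriv_eq, c2, hG', hG'']
  have z1 := hDv.self_of_nhds
  have z2 := hGv.self_of_nhds
  have z3 := hgv'.self_of_nhds
  simp only [wLaplacian_congr hv.start] at z1
  simp only [gradSq_congr hv.start] at z2
  simp only [wPartial_congr hv.start] at z3
  refine lt_of_lt_of_le (mul_pos (sub_pos.2 hls') (pow_pos (norm_pos_iff.2 hne) 2))
    (H.second_variation_lower_bound hm hls hls'.le
    (z1.trans (H.wLaplacian_ae_eq (by omega)))
    (fun i => (z3 i).trans (H.wPartial_ae_eq (by omega) i))
    (z2.trans (H.gradSq_ae_eq (by omega))) m1 m2)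

end BiharmonicCone

end SecondVariation

/-! ### The map `q` -/

section QMap

variable {m : ℕ}

/-- The component `(sin α · u^{(ℓ)}, 0)` of the map `q`. -/
noncomputable def qEquator (m l : ℕ) (α : ℝ) (x : EuclideanSpace ℝ (Fin m)) : Target m l :=
  WithLp.toLp 2 (Sum.elim (fun i => Real.sin α * radialProj m l i x) (fun _ => 0))

/-- The constant component `(0, cos α)` of the map `q`. -/
noncomputable def qPole (m l : ℕ) (α : ℝ) : Target m l :=
  WithLp.toLp 2 (Sum.elim (fun _ => 0) (fun _ => Real.cos α))

theorem qMap_eq (m l : ℕ) (α : ℝ) : qMap m l α = fun x => qEquator m l α x + qPole m l α := by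
  funext x
  ext (i | i) <;> simp [qMap, qEquator, qPole]

theorem biharmonicCone_qMap (hm : 3 ≤ m) {l : ℕ} (hl : 1 ≤ l) {α : ℝ}
    (hbal : 2 * ((l : ℝ) * ((l : ℝ) + m - 2)) * Real.sin α ^ 2
      = (l : ℝ) * ((l : ℝ) + m - 2) + 2 * m - 8) :
    BiharmonicCone ((l : ℝ) * ((l : ℝ) + m - 2)) (Real.sin α ^ 2) (qEquator m l α)
      (qPole m l α) := by
  obtain ⟨n, rfl⟩ : ∃ n, l = n + 1 := ⟨l - 1, by omega⟩
  have hE := eigenMap_radialVec hm n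
  have hr : ∀ i x, qEquator m (n + 1) α x (Sum.inl i) = Real.sin α • radialVec m (n + 1) x i :=
    fun i x => rfl
  have h0 : ∀ i x, qEquator m (n + 1) α x (Sum.inr i) = 0 := fun i x => rfl
  have hu : ∀ i, HomSmooth 0 (fun x => radialVec m (n + 1) x i) := fun i =>
    hE.hom.clm (EuclideanSpace.proj (𝕜 := ℝ) i)
  have hh : HomSmooth 0 (qEquator m (n + 1) α) := homSmooth_euclidean fun b => by
    rcases b with i | i
    · exact (hu i).const_smul _
    · exact HomSmooth.const 0
  refine ⟨⟨hh, fun x hx => ?_, fun x hx => ?_⟩, fun x _ => ?_, ?_, hbal⟩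
  · ext b
    rw [lap_component hx hh.smooth]
    rcases b with i | i
    · have h1 := lap_component hx hE.hom.smooth i
      rw [hE.lap_eq x hx] at h1
      simp only [hr]
      rw [lap_const_smul _ hx (hu i).smooth, ← h1, PiLp.smul_apply, PiLp.smul_apply, hr]
      push_cast
      simp only [smul_eq_mul]
      ring
    · simp only [h0, PiLp.smul_apply, smul_zero]
      rw [lap_const]
  · have h1 := hE.norm_sq x hx
    rw [EuclideanSpace.real_norm_sq_eq] at h1
    rw [EuclideanSpace.real_norm_sq_eq, Fintype.sum_sum_type]
    simp only [hr, h0, smul_eq_mul, mul_pow, ← Finset.mul_sum, h1]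
    simp
  · rw [PiLp.inner_apply, Fintype.sum_sum_type]
    simp [qEquator, qPole]
  · rw [EuclideanSpace.real_norm_sq_eq, Fintype.sum_sum_type]
    simp [qPole, Real.cos_sq']

end QMap

end BiharmonicBall

theorem proposition4p7 (m l : ℕ) (hm : 5 ≤ m) (hl : 1 ≤ l) (α : ℝ)
    (hα : α ∈ Set.Ioo 0 (Real.pi / 2))
    (hsin : Real.sin α ^ 2 =
      ((l : ℝ) * ((l : ℝ) + m - 2) + 2 * m - 8) / (2 * ((l : ℝ) * ((l : ℝ) + m - 2))))
    (hstab : 0 < (m : ℝ) ^ 2 - 12 * ((l : ℝ) * ((l : ℝ) + m - 2) + 2 * m - 8)) :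
    BiharmonicBall.IsProperWeakBiharmonic (BiharmonicBall.qMap m l α) ∧
      BiharmonicBall.IsStrictlyStable (BiharmonicBall.qMap m l α) := by
  have hm' : (5 : ℝ) ≤ m := by exact_mod_cast hm
  have hl' : (1 : ℝ) ≤ l := by exact_mod_cast hl
  set lam : ℝ := (l : ℝ) * ((l : ℝ) + m - 2) with hlam
  have h1 : (m : ℝ) - 1 ≤ lam := by rw [hlam]; nlinarith
  have hbal : 2 * lam * Real.sin α ^ 2 = lam + 2 * m - 8 := by
    have hne : lam ≠ 0 := by linarith
    rw [hsin]; field_simp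
  -- since `ℓ (ℓ + m - 2) ≥ m - 1`, the stability condition forces `m² > 36 m - 108`
  have h8 : 8 ≤ m := by
    by_contra hlt
    have : (m : ℝ) ≤ 7 := by exact_mod_cast (by omega : m ≤ 7)
    nlinarith
  have : NeZero m := ⟨by omega⟩
  have hcos : 0 < Real.cos α := Real.cos_pos_of_mem_Ioo ⟨by linarith [hα.1, Real.pi_pos], hα.2⟩
  have hs0 : 0 < Real.sin α := Real.sin_pos_of_pos_of_lt_pi hα.1 (by linarith [hα.2, Real.pi_pos])
  have hs1 : Real.sin α ^ 2 ≠ 1 := by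
    have := Real.sin_sq_add_cos_sq α
    nlinarith [pow_pos hcos 2]
  have H := BiharmonicBall.biharmonicCone_qMap (by omega) hl hbal
  rw [BiharmonicBall.qMap_eq]
  refine ⟨⟨H.isWeakBiharmonic hm, H.not_tension_ae_eq_zero hm ?_ (pow_pos hs0 2).ne' hs1⟩,
    H.isStrictlyStable h8 ?_ ?_⟩
  · linarith
  · exact mul_nonneg (by linarith) (sq_nonneg _)
  · linarith
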